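/- **Setting.** Consider a finite two-player zero-sum extensive-form game with perfect recall, chance moves of positive probability and payoffs in $[-1,1]$. Let $\mathcal S=\mathcal S_1\cup\mathcal S_2$ be the (nonempty) information sets of the two players, $\mathcal A_s$ the action set of $s$, $p(s)$ its owner, $\mu_c(h)$ the contribution of chance to reaching the node $h$, $\sigma(s)$ the last infoset-action pair of player $p(s)$ before $s$ ($\emptyset$ if there is none), and $|s|$ the number of nodes of $s$. For a strategy profile $\pi$ let $\mu^\pi(s,a)=\mu^\pi(\sigma(s))\,\pi(a|s)$, $\mu^\pi(\emptyset)=1$, be its sequence form, let $\mu_i^\pi(\sigma_i(h))$ be the product of the probabilities of player $i$'s actions on the path to $h$, and let $\mu^\pi_{-p(s)}(s)=\sum_{h\in s}\mu_c(h)\,\mu^\pi_{3-p(s)}(\sigma_{3-p(s)}(h))$. Let $D_\psi(x,y)=\psi(x)-\psi(y)-\langle\nabla\psi(y),x-y\rangle$. Let $\alpha_s>0$, $\tau>0$ and either $\psi_s(u)=\alpha_s(\log|\mathcal A_s|+\sum_a u_a\log u_a)$ for all $s$ (entropy), or $\psi_s(u)=\frac{\alpha_s}2\sum_a u_a^2$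 for all $s$ (Euclidean). The dilated regularizer of player $i$ is $\psi^{\Pi_i}(\mu)=\sum_{s\in\mathcal S_i}\mu(\sigma(s))\,\psi_s\big(\mu(s,\cdot)/\mu(\sigma(s))\big)$, and $\psi^\Pi=\psi^{\Pi_1}+\psi^{\Pi_2}$. Let $\gamma_s\in(0,1]$, let $\nu_s$ be a distribution of full support on $\mathcal A_s$, call $\pi$ feasible if $\pi(\cdot|s)\in\Delta_s:=\{u\in\Delta^{|\mathcal A_s|}: u_a\ge\gamma_s\nu_{s,a}\ \forall a\}$ for all $s$, and let $\gamma>0$ satisfy $\mu^\pi(s,a)\ge\gamma$ for all feasible $\pi$ and all $(s,a)$. Let $\pi^*$ (with sequence form $\mu^*$) be a Nash equilibrium, among feasible profiles, of the game $\max_{\pi_1}\min_{\pi_2}\ U_1(\pi)-\tau\psi^{\Pi_1}(\mu_1^{\pi_1})+\tau\psi^{\Pi_2}(\mu_2^{\pi_2})$, where $U_1$ is the expected payoff of player 1. **Feedback.** Let $U_{p(s)}$ denote the payoff of the owner of $s$, and let $$\mathrm{CF}^{\pi}(s,a)=\sum_{z}\mu_c(z)\frac{\mu^\pi_{p(s)}(\sigma_{p(s)}(z))}{\mu^\pi(s,a)}\mu^\pi_{3-p(s)}(\sigma_{3-p(s)}(z))\,U_{p(s)}(z)-\tau\sum_{s'}\frac{\mu^\pi(\sigma(s'))}{\mu^\pi(s,a)}\psi_{s'}(\pi(\cdot|s'))$$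 be the counterfactual value in the regularized game; $z$ runs over the terminal nodes reached through $(s,a)$, and $s'$ over the infosets of player $p(s)$ below $(s,a)$. The feedback $q$ and its scaling $m_s$, with $\mathrm{CF}=m_sq$, are of one of three types: counterfactual value ($m_s=1$), trajectory Q-value ($m_s=1/\mu^\pi(\sigma(s))$), Q-value ($m_s=\mu^\pi_{-p(s)}(s)$). Write $q^{(t)},m^{(t)}_s$ for the values at $\pi^{(t)}$. **Lazy QFR.** Let $\eta_s>0$ and $T\in\mathbb N$. Start with $\pi^{(1)}(\cdot|s)=\bar\pi^{(1)}(\cdot|s)$ uniform (and feasible), and put $$\pi^{(t)}(\cdot|s)=\arg\min_{x\in\Delta_s}\ \langle x,-q^{(t-1)}(s,\cdot)\rangle+\tfrac{\tau}{m_s^{(t-1)}}\psi_s(x)+\tfrac1{\eta_s}D_{\psi_s}(x,\bar\pi^{(t)}(\cdot|s))\qquad(2\le t\le T),$$ $$\bar\pi^{(t+1)}(\cdot|s)=\arg\min_{x\in\Delta_s}\ \langle x,-q^{(t)}(s,\cdot)\rangle+\tfrac{\tau}{m_s^{(t)}}\psi_s(x)+\tfrac1{\eta_s}D_{\psi_s}(x,\bar\pi^{(t)}(\cdot|s))\qquad(1\le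 t\le T).$$ **Constants.** $\|q\|=\max_{1\le t\le T,\,s,\,a}|q^{(t)}(s,a)|$. $(M_1,M_2)=(1,1)$ for counterfactual values, $(1,1/\gamma)$ for trajectory Q-values, $(\gamma\min_s\sum_{h\in s}\mu_c(h),\,1)$ for Q-values. $\eta_s^{\rm anc}$ is the largest $\eta_{s'}$ over the infosets $s'$ of both players on the paths to the nodes of $s$ ($0$ if there is none). $C_s^{\rm diff}=\frac2{\alpha_s}\big(\|q\|+\frac{\tau\alpha_s}{M_1}\log\frac1\gamma\big)$ (entropy), $\frac{|\mathcal A_s|}{\alpha_s}\|q\|+\frac{2\sqrt{|\mathcal A_s|}\,\tau}{M_1}$ (Euclidean). With $X=\max_{s}\big(\frac{2\|q\|}{\alpha_s}+\frac\tau{M_1}\log\frac1\gamma\big)$ and $Y=\max_sC_s^{\rm diff}$, the pair $(C_s^-,C_s^/)$ is $(0,0)$ for counterfactual values; $(12X/\gamma,\,12X)$ (entropy) or $(6Y/\gamma^2,\,6Y/(\gamma^2M_1))$ (Euclidean) for trajectory Q-values; $(12M_2X,\,12X)$ (entropy) or $(6|s|Y,\,6|s|Y/M_1)$ (Euclidean)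 for Q-values. **Theorem (Lazy QFR, full information).** Assume $\frac{\eta_s^{\rm anc}}{\eta_s}\le\frac{\tau}{2C_s^-}$ for all $s$ (no condition if $C_s^-=0$) and, for all $s$, (A) the sum of $\eta_{s'}$ over the infosets $s'$ of player $i$ on the path to $h$ is at most $\eta_s$, for every $h\in s$ and $i\in\{1,2\}$; (B) $6\,\eta_s^{\rm anc}X\le1$; (C) $\eta_s\big(2\|q\|+\frac{\tau\alpha_s}{M_1}\log\frac1\gamma\big)\le1$. Then $$\sum_{t=2}^TD_{\psi^\Pi}\big(\mu^*,\mu^{\bar\pi^{(t)}}\big)\le2\sum_{s}C_s^/\,\eta_s^{\rm anc}\mu^*(\sigma(s))\sum_{t=1}^T\big|\psi_s(\pi^{(t)}(\cdot|s))-\psi_s(\bar\pi^{(t+1)}(\cdot|s))\big|+\frac4\tau\sum_sC_s^{\rm diff}\mu^*(\sigma(s))\|q\|\,\eta_sM_2T+\frac2\tau\sum_s\frac{M_2}{\eta_s}\mu^*(\sigma(s))D_{\psi_s}\big(\pi^*(\cdot|s),\bar\pi^{(1)}(\cdot|s)\big).$$ Moreover, for Q-value and counterfactual feedback the dependence on the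 size of the game is polynomial in the following sense. Let $n=|\mathcal S|$, $N=\max_s|\mathcal A_s|$, $L=\max_s|s|$, $\alpha_+=\max_s\alpha_s$, $\alpha_-=\min_s\alpha_s$, $B=\frac{1+\tau n\alpha_+N}{M_1}$ and $K=\frac{2NB}{\alpha_-}+\frac{2\tau}{M_1}\big(\log\frac1\gamma+N\big)$. Then $C_s^-\le12LK$ for all $s$, and $$\sum_{t=2}^TD_{\psi^\Pi}\big(\mu^*,\mu^{\bar\pi^{(t)}}\big)\le\frac{24\,nLK\alpha_+N}{M_1}\cdot\max_s\eta_s^{\rm anc}\,T+4nKB\cdot\frac{\max_s\eta_s\,T}{\tau}+2n\alpha_+N\cdot\frac1{\tau\min_s\eta_s}.$$ -/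

import Mathlib

open Finset

/-!
Two-player zero-sum extensive-form games, the dilated regularizer, and the lazy QFR dynamics.

`S` is the set of information sets of both players and `A s` the action set of `s`.
A strategy profile is a function `π : (s : S) → A s → ℝ`; the strategy of player `i` is its
restriction to the infosets `s` with `player s = i`. The two players are `0, 1 : Fin 2`
(player `0` is the maximizer), and the opponent of `i` is `1 - i`.
-/

noncomputable section

namespace LazyQFR

universe u v

/-- A finite game tree. Terminal nodes carry the payoff of the maximizer, chance nodes carry the
distribution of their outcome, decision nodes carry their infoset. -/
inductive GameTree (S : Type u) (A : S → Type v) : Type (max u v)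
  | terminal (payoff : ℝ) : GameTree S A
  | chance (n : ℕ) (p : Fin n → ℝ) (next : Fin n → GameTree S A) : GameTree S A
  | decision (s : S) (next : A s → GameTree S A) : GameTree S A

/-- What is used of a node `h`: the infoset-action pairs of both players on the path from the
root to `h` (in the order of play), and the contribution `μ_c(h)` of chance to reaching `h`. -/
structure Node (S : Type u) (A : S → Type v) where
  path : List (Σ s, A s)
  chance : ℝ

/-- The root: nothing has been played. -/
def Node.root {S : Type u} {A : S → Type v} : Node S A := ⟨[], 1⟩

/-- Contribution of player `i` to the probability of reaching `h`, that is `μ_i(σ_i(h))`. -/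
def Node.reach {S : Type u} {A : S → Type v} (player : S → Fin 2) (π : (s : S) → A s → ℝ)
    (i : Fin 2) (h : Node S A) : ℝ :=
  ((h.path.filter (fun x => player x.1 = i)).map (fun x => π x.1 x.2)).prod

namespace GameTree

variable {S : Type u} {A : S → Type v}

/-- Chance plays every outcome with positive probability, and the probabilities add up to 1. -/
def ChanceOK : GameTree S A → Prop
  | terminal _ => True
  | chance _ p next => (∀ i, 0 < p i) ∧ ∑ i, p i = 1 ∧ ∀ i, (next i).ChanceOK
  | decision _ next => ∀ a, (next a).ChanceOK

/-- The nodes of infoset `s` in the subtree whose root is `h`. It is a multiset because two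
different nodes may agree in all the data that `Node` records. -/
def nodesAt [DecidableEq S] [∀ s, Fintype (A s)] (s : S) :
    GameTree S A → Node S A → Multiset (Node S A)
  | terminal _, _ => 0
  | chance _ p next, h => ∑ i, (next i).nodesAt s ⟨h.path, h.chance * p i⟩
  | decision s' next, h =>
      (if s' = s then {h} else 0) + ∑ a, (next a).nodesAt s ⟨h.path ++ [⟨s', a⟩], h.chance⟩

/-- The terminal nodes, with their payoffs, of the subtree whose root is `h`. -/
def leaves [∀ s, Fintype (A s)] : GameTree S A → Node S A → Multiset (Node S A × ℝ)
  | terminal r, h => {(h, r)}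
  | chance _ p next, h => ∑ i, (next i).leaves ⟨h.path, h.chance * p i⟩
  | decision s' next, h => ∑ a, (next a).leaves ⟨h.path ++ [⟨s', a⟩], h.chance⟩

end GameTree

/-- A two-player zero-sum extensive-form game with perfect recall and payoffs in `[-1, 1]`. -/
structure EFG (S : Type u) (A : S → Type v) [DecidableEq S] [∀ s, Fintype (A s)] where
  tree : GameTree S A
  player : S → Fin 2
  chanceOK : tree.ChanceOK
  payoff_mem : ∀ z ∈ tree.leaves Node.root, z.2 ∈ Set.Icc (-1 : ℝ) 1
  infoset_nonempty : ∀ s, ∃ h, h ∈ tree.nodesAt s Node.root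
  /-- Perfect recall: all nodes of an infoset have the same sequence of own past infosets and
  own past actions. -/
  perfectRecall : ∀ s, ∀ h ∈ tree.nodesAt s Node.root, ∀ h' ∈ tree.nodesAt s Node.root,
    h.path.filter (fun x => player x.1 = player s) =
      h'.path.filter (fun x => player x.1 = player s)

/-- The Bregman divergence `D_f(x, y)`. -/
def bregman {ι : Type*} [Fintype ι] (f : (ι → ℝ) → ℝ) (x y : ι → ℝ) : ℝ :=
  f x - f y - fderiv ℝ f y (x - y)

/-- The two regularizers of a simplex. -/
inductive Reg
  | entropy
  | euclidean

/-- `ψ_s^Δ` with weight `α`. -/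
def Reg.psi {ι : Type*} [Fintype ι] (reg : Reg) (α : ℝ) (x : ι → ℝ) : ℝ :=
  match reg with
  | .entropy => α * (Real.log (Fintype.card ι) + ∑ a, x a * Real.log (x a))
  | .euclidean => α / 2 * ∑ a, x a ^ 2

/-- The perturbed simplex `Δ_{γ, ν}`. -/
def perturbedSimplex {ι : Type*} [Fintype ι] (γ : ℝ) (ν : ι → ℝ) : Set (ι → ℝ) :=
  {x | x ∈ stdSimplex ℝ ι ∧ ∀ a, γ * ν a ≤ x a}

/-- The feedback that is used to update the strategies. -/
inductive Feedback
  | counterfactual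
  | trajectoryQ
  | qValue

/-- `M₂`, the upper bound of the scaling `m_s` of the feedback. -/
def Feedback.M₂ (fb : Feedback) (γ : ℝ) : ℝ :=
  match fb with
  | .counterfactual => 1
  | .trajectoryQ => 1 / γ
  | .qValue => 1

namespace EFG

variable {S : Type u} {A : S → Type v} [Fintype S] [DecidableEq S] [∀ s, Fintype (A s)]
  [∀ s, DecidableEq (A s)] (G : EFG S A)

/-- The nodes of infoset `s`. -/
def nodes (s : S) : Multiset (Node S A) := G.tree.nodesAt s Node.root

/-- The terminal nodes of the game with their payoffs. -/
def leaves : Multiset (Node S A × ℝ) := G.tree.leaves Node.root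

/-- All infoset-action pairs of player `player s` on the way to `s`, in the order of play;
by perfect recall the node of `s` that is used is irrelevant. -/
def ownSeq (s : S) : List (Σ s, A s) :=
  (G.infoset_nonempty s).choose.path.filter (fun x => G.player x.1 = G.player s)

/-- The parent sequence `σ(s)`; `none` stands for the empty sequence. -/
def parentSeq (s : S) : Option (Σ s, A s) := (G.ownSeq s).getLast?

/-- `μ^π(σ(s))`: the contribution of player `player s` to reaching `s`. -/
def ownReach (π : (s : S) → A s → ℝ) (s : S) : ℝ :=
  ((G.ownSeq s).map (fun x => π x.1 x.2)).prod

/-- The sequence form `μ^π` of a profile (of both players). -/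
def seqForm (π : (s : S) → A s → ℝ) : (Σ s, A s) → ℝ := fun x => G.ownReach π x.1 * π x.1 x.2

/-- The entry `x(σ(s))` of a sequence-form vector, which is 1 at the empty sequence. -/
def atParent (x : (Σ s, A s) → ℝ) (s : S) : ℝ := (G.parentSeq s).elim 1 x

/-- `μ_{-p(s)}(s) = ∑_{h ∈ s} μ_c(h) μ_{3-p(s)}(σ_{3-p(s)}(h))`: the contribution of the opponent
and of chance to reaching `s`. -/
def oppReach (π : (s : S) → A s → ℝ) (s : S) : ℝ :=
  ((G.nodes s).map (fun h => h.chance * h.reach G.player π (1 - G.player s))).sum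

/-- The expected payoff of the maximizer, which is the bilinear form `μ₁ᵀ A μ₂`. -/
def utility (π : (s : S) → A s → ℝ) : ℝ :=
  (G.leaves.map (fun z => z.1.chance * z.1.reach G.player π 0 * z.1.reach G.player π 1 * z.2)).sum

/-- The payoff of player `i` when that of the maximizer is `r`. -/
def payoffOf (i : Fin 2) (r : ℝ) : ℝ := if i = 0 then r else -r

/-- The dilated regularizer of player `i`, as a function of sequence-form vectors. -/
def dilatedReg (reg : Reg) (α : S → ℝ) (i : Fin 2) (x : (Σ s, A s) → ℝ) : ℝ :=
  ∑ s ∈ univ.filter (fun s => G.player s = i),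
    G.atParent x s * reg.psi (α s) (fun a => x ⟨s, a⟩ / G.atParent x s)

/-- The dilated regularizer `ψ^Π` of both players together. -/
def dilatedRegTotal (reg : Reg) (α : S → ℝ) (x : (Σ s, A s) → ℝ) : ℝ :=
  G.dilatedReg reg α 0 x + G.dilatedReg reg α 1 x

/-- The objective of the regularized game (maximized by player `0`, minimized by player `1`). -/
def regObjective (reg : Reg) (α : S → ℝ) (τ : ℝ) (π : (s : S) → A s → ℝ) : ℝ :=
  G.utility π - τ * G.dilatedReg reg α 0 (G.seqForm π) + τ * G.dilatedReg reg α 1 (G.seqForm π)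

/-- `π` is a strategy profile of the perturbed game. -/
def Feasible (γs : S → ℝ) (ν π : (s : S) → A s → ℝ) : Prop :=
  ∀ s, π s ∈ perturbedSimplex (γs s) (ν s)

/-- `π` is a Nash equilibrium of the regularized and perturbed game. -/
def IsRegNE (reg : Reg) (α : S → ℝ) (τ : ℝ) (γs : S → ℝ) (ν π : (s : S) → A s → ℝ) : Prop :=
  Feasible γs ν π ∧
  (∀ π', Feasible γs ν π' → (∀ s, G.player s = 1 → π' s = π s) →
    G.regObjective reg α τ π' ≤ G.regObjective reg α τ π) ∧
  (∀ π', Feasible γs ν π' → (∀ s, G.player s = 0 → π' s = π s) →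
    G.regObjective reg α τ π ≤ G.regObjective reg α τ π')

/-- The counterfactual value of `a` at `s` (of the player who owns `s`), without regularization. -/
def cfValue (π : (s : S) → A s → ℝ) (s : S) (a : A s) : ℝ :=
  ((G.leaves.filter (fun z => (⟨s, a⟩ : Σ s, A s) ∈ z.1.path)).map (fun z =>
    z.1.chance * (z.1.reach G.player π (G.player s) / G.seqForm π ⟨s, a⟩) *
      z.1.reach G.player π (1 - G.player s) * payoffOf (G.player s) z.2)).sum

/-- The expected dilated regularizer at the infosets that player `player s` may reach later on,
after playing `a` at `s`. -/
def futureReg (reg : Reg) (α : S → ℝ) (π : (s : S) → A s → ℝ) (s : S) (a : A s) : ℝ :=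
  ∑ s' ∈ univ.filter (fun s' => (⟨s, a⟩ : Σ s, A s) ∈ G.ownSeq s'),
    G.ownReach π s' / G.seqForm π ⟨s, a⟩ * reg.psi (α s') (π s')

/-- The counterfactual value in the regularized game. -/
def regCfValue (reg : Reg) (α : S → ℝ) (τ : ℝ) (π : (s : S) → A s → ℝ) (s : S) (a : A s) : ℝ :=
  G.cfValue π s a - τ * G.futureReg reg α π s a

/-- The feedback vector `q(s, ·)` at the profile `π`, in the regularized game: the counterfactual
value, its product with the own reach probability (trajectory Q-value), or its quotient by the
reach probability of the opponent and chance (Q-value, i.e. conditional on reaching `s`). -/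
def feedback (fb : Feedback) (reg : Reg) (α : S → ℝ) (τ : ℝ) (π : (s : S) → A s → ℝ) (s : S)
    (a : A s) : ℝ :=
  match fb with
  | .counterfactual => G.regCfValue reg α τ π s a
  | .trajectoryQ => G.ownReach π s * G.regCfValue reg α τ π s a
  | .qValue => G.regCfValue reg α τ π s a / G.oppReach π s

/-- The scaling `m_s` between the feedback and the counterfactual value. -/
def scale (fb : Feedback) (π : (s : S) → A s → ℝ) (s : S) : ℝ :=
  match fb with
  | .counterfactual => 1
  | .trajectoryQ => 1 / G.ownReach π s
  | .qValue => G.oppReach π s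

/-- `M₁`, the lower bound of the scaling. -/
def M₁ (fb : Feedback) (γ : ℝ) : ℝ :=
  match fb with
  | .counterfactual => 1
  | .trajectoryQ => 1
  | .qValue => γ * ⨅ s, ((G.nodes s).map (fun h => h.chance)).sum

/-- `η_s^anc`: the largest learning rate of an infoset (of either player) on the way to a node of
`s`; it is `0` if there is none. -/
def etaAnc (η : S → ℝ) (s : S) : ℝ :=
  sSup {r | ∃ h ∈ G.nodes s, ∃ x ∈ h.path, r = η x.1}

/-- `‖q‖_∞`, the maximum of `|q^(t)(s, a)|` over `1 ≤ t ≤ T`, `s` and `a`. -/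
def qNorm (fb : Feedback) (reg : Reg) (α : S → ℝ) (τ : ℝ) (T : ℕ)
    (π : ℕ → (s : S) → A s → ℝ) : ℝ :=
  sSup {r | ∃ t ∈ Finset.Icc 1 T, ∃ s, ∃ a : A s, r = |G.feedback fb reg α τ (π t) s a|}

/-- The function of which an update step takes the minimizer over the perturbed simplex. The
feedback is taken at `π`, the proximal center is `y`. -/
def stepObjective (fb : Feedback) (reg : Reg) (α : S → ℝ) (τ : ℝ) (η : S → ℝ)
    (π : (s : S) → A s → ℝ) (s : S) (y x : A s → ℝ) : ℝ :=
  ∑ a, x a * (-G.feedback fb reg α τ π s a) + τ / G.scale fb π s * reg.psi (α s) x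
    + 1 / η s * bregman (reg.psi (α s)) x y

/-- `π^(t)` (`1 ≤ t ≤ T`) and `π̄^(t)` (`1 ≤ t ≤ T + 1`) are the iterates of lazy QFR with full
information, started at the uniform strategies, which are feasible. -/
structure IsLazyQFR (fb : Feedback) (reg : Reg) (α : S → ℝ) (τ : ℝ) (γs : S → ℝ)
    (ν : (s : S) → A s → ℝ) (η : S → ℝ) (T : ℕ) (π πbar : ℕ → (s : S) → A s → ℝ) : Prop where
  init : ∀ s a, π 1 s a = 1 / (Fintype.card (A s) : ℝ)
  init_bar : ∀ s a, πbar 1 s a = 1 / (Fintype.card (A s) : ℝ)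
  init_feasible : Feasible γs ν (π 1)
  step_mem : ∀ t, 2 ≤ t → t ≤ T → ∀ s, π t s ∈ perturbedSimplex (γs s) (ν s)
  step_min : ∀ t, 2 ≤ t → t ≤ T → ∀ s, IsMinOn
    (G.stepObjective fb reg α τ η (π (t - 1)) s (πbar t s))
    (perturbedSimplex (γs s) (ν s)) (π t s)
  step_bar_mem : ∀ t, 1 ≤ t → t ≤ T → ∀ s, πbar (t + 1) s ∈ perturbedSimplex (γs s) (ν s)
  step_bar_min : ∀ t, 1 ≤ t → t ≤ T → ∀ s, IsMinOn
    (G.stepObjective fb reg α τ η (π t) s (πbar t s))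
    (perturbedSimplex (γs s) (ν s)) (πbar (t + 1) s)

/-- `C_s^diff`, where `Q` stands for `‖q‖_∞`. -/
def Cdiff (fb : Feedback) (reg : Reg) (α : S → ℝ) (τ γ Q : ℝ) (s : S) : ℝ :=
  match reg with
  | .entropy => 2 / α s * (Q + τ * α s / G.M₁ fb γ * Real.log (1 / γ))
  | .euclidean => Fintype.card (A s) / α s * Q
      + 2 * Real.sqrt (Fintype.card (A s)) * τ / G.M₁ fb γ

/-- `max_s (2 ‖q‖_∞ / α_s + (τ / M₁) log (1 / γ))`, where `Q` stands for `‖q‖_∞`. -/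
def Cent (fb : Feedback) (α : S → ℝ) (τ γ Q : ℝ) : ℝ :=
  ⨆ s, (2 * Q / α s + τ / G.M₁ fb γ * Real.log (1 / γ))

/-- The constant `C_s^-` of additive stability of the scaling. -/
def Cminus (fb : Feedback) (reg : Reg) (α : S → ℝ) (τ γ Q : ℝ) (s : S) : ℝ :=
  match fb, reg with
  | .counterfactual, _ => 0
  | .trajectoryQ, .euclidean => 6 / γ ^ 2 * ⨆ s', G.Cdiff .trajectoryQ .euclidean α τ γ Q s'
  | .trajectoryQ, .entropy => 12 * G.Cent .trajectoryQ α τ γ Q / γ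
  | .qValue, .euclidean =>
      6 * Multiset.card (G.nodes s) * ⨆ s', G.Cdiff .qValue .euclidean α τ γ Q s'
  | .qValue, .entropy => 12 * Feedback.M₂ .qValue γ * G.Cent .qValue α τ γ Q

/-- The constant `C_s^/` of multiplicative stability of the scaling. -/
def Cslash (fb : Feedback) (reg : Reg) (α : S → ℝ) (τ γ Q : ℝ) (s : S) : ℝ :=
  match fb, reg with
  | .counterfactual, _ => 0
  | .trajectoryQ, .euclidean =>
      6 / (γ ^ 2 * G.M₁ .trajectoryQ γ) * ⨆ s', G.Cdiff .trajectoryQ .euclidean α τ γ Q s'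
  | .trajectoryQ, .entropy => 12 * G.Cent .trajectoryQ α τ γ Q
  | .qValue, .euclidean => 6 * Multiset.card (G.nodes s) / G.M₁ .qValue γ *
      ⨆ s', G.Cdiff .qValue .euclidean α τ γ Q s'
  | .qValue, .entropy => 12 * G.Cent .qValue α τ γ Q

/-- Condition (A) on the learning rates. -/
def CondA (η : S → ℝ) : Prop :=
  ∀ s, ∀ i : Fin 2, ∀ h ∈ G.nodes s,
    ((h.path.filter (fun x => G.player x.1 = i)).map (fun x => η x.1)).sum ≤ η s

/-- Condition (B) on the learning rates. -/
def CondB (fb : Feedback) (α : S → ℝ) (τ γ Q : ℝ) (η : S → ℝ) : Prop :=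
  ∀ s, 6 * G.etaAnc η s * G.Cent fb α τ γ Q ≤ 1

/-- Condition (C) on the learning rates. -/
def CondC (fb : Feedback) (α : S → ℝ) (τ γ Q : ℝ) (η : S → ℝ) : Prop :=
  ∀ s, η s * (2 * Q + τ * α s / G.M₁ fb γ * Real.log (1 / γ)) ≤ 1

/-- `max_s |A_s|`. -/
def maxActions (_G : EFG S A) : ℝ := ⨆ s : S, (Fintype.card (A s) : ℝ)

/-- `max_s |s|`, the largest number of nodes of an infoset. -/
def maxNodes : ℝ := ⨆ s : S, (Multiset.card (G.nodes s) : ℝ)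

/-- An upper bound for `‖q‖_∞`, polynomial in the size of the game and `1 / M₁`. -/
def sizeQ (fb : Feedback) (α : S → ℝ) (τ γ : ℝ) : ℝ :=
  (1 + τ * Fintype.card S * (⨆ s, α s) * G.maxActions) / G.M₁ fb γ

/-- An upper bound for `C_s^diff`, polynomial in the size of the game, `log (1 / γ)`
and `1 / M₁`. -/
def sizeC (fb : Feedback) (α : S → ℝ) (τ γ : ℝ) : ℝ :=
  2 * G.maxActions * G.sizeQ fb α τ γ / (⨅ s, α s)
    + 2 * τ * (Real.log (1 / γ) + G.maxActions) / G.M₁ fb γ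

end EFG

end LazyQFR

end

/-!
Write `μ*(s)` for the reach probability of the owner of `s` under the equilibrium. The Bregman
divergence of the dilated regularizer is the sum over `s` of the local divergences, weighted by
`μ*(s)` (`bregman_dilatedRegTotal`), so it suffices to follow the local divergences from
`πstar s` to the proximal centers `πbar t s`.

*Regret.* By the performance difference lemma (`performance_difference`), the regularized regret
of a profile against a deviation of one player is the sum of its local counterfactual regrets,
weighted by the reach probabilities of the deviation. Adding up the two players, the equilibrium
condition says that the `μ*`-weighted sum of the local regrets of any feasible profile against
`πstar` is nonnegative (`IsRegNE.regret_nonneg`). Both facts rest on perfect recall, in the form of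
`OwnPath`: the pairs of one player on a path are exactly the own sequences of their infosets, so
that differences of products along a path telescope.

*Recursion.* The three-point inequality of the step to `πbar (t + 1)`, multiplied by the scaling
`m` of the feedback, bounds `τ D (t + 1) + (m / η) (D (t + 1) - D t)` plus the local regret
(`local_recursion`). The proximal term of that step pays for the three-point inequality of the step
to `π t`, whose feedback is one step older. What is left is the product of the change of the
feedback with `πbar (t + 1) - π t`, minus a divergence, to which Young's inequality applies, and a
difference of regularizers times the relative change of the scaling (`step_gain_le`). When the
recursion is summed over time, the change of the weights `m / η` is absorbed by half of the
contraction `τ` (`sum_telescope_le`).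

*Stability.* The scaling is built from reach probabilities (`scale_stable`). Two consecutive
strategies are three proximal steps apart. An entropic step changes the logarithms of the
probabilities by at most `η` times a constant, since mass may be exchanged between an action that
gains and an action that loses; a Euclidean step changes the probabilities themselves by at most
`η` times a constant. By condition (A), applied at the last infoset of a path, the learning rates
on the path of a player add up to at most twice the largest one.

*Size of the game.* Counterfactual values are bounded because the reach probability of the
opponent and chance becomes a genuine probability once the owner of an infoset follows the path to
it with probability one (`oppReach_le_one`, `abs_cfValue_le_one`).
-/

set_option linter.unusedSectionVars false

namespace LazyQFR

universe u v

/-! ### Regularizers of a simplex -/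

section Simplex

variable {ι : Type*} [Fintype ι]

/-- The gradient of `reg.psi α` at a point with positive entries. -/
noncomputable def Reg.grad (reg : Reg) (α : ℝ) (y : ι → ℝ) (a : ι) : ℝ :=
  match reg with
  | .entropy => α * (Real.log (y a) + 1)
  | .euclidean => α * y a

theorem Reg.hasFDerivAt_psi (reg : Reg) (α : ℝ) {y : ι → ℝ} (hy : ∀ a, 0 < y a) :
    HasFDerivAt (reg.psi α)
      (∑ a, reg.grad α y a • (ContinuousLinearMap.proj a : (ι → ℝ) →L[ℝ] ℝ)) y := by
  cases reg with
  | entropy =>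
    have h : HasFDerivAt (fun x : ι → ℝ => ∑ a, x a * Real.log (x a))
        (∑ a, (Real.log (y a) + 1) • (ContinuousLinearMap.proj a : (ι → ℝ) →L[ℝ] ℝ)) y := by
      refine HasFDerivAt.fun_sum fun a _ => ?_
      have h0 : HasFDerivAt (fun x : ι → ℝ => x a) (ContinuousLinearMap.proj (R := ℝ) a) y :=
        hasFDerivAt_apply a y
      exact HasDerivAt.comp_hasFDerivAt (f := fun x : ι → ℝ => x a) y
        (Real.hasDerivAt_mul_log (hy a).ne') h0
    have h2 := (h.const_add (Real.log (Fintype.card ι))).const_mul α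
    refine h2.congr_fderiv ?_
    ext v
    simp [Reg.grad, Finset.mul_sum, mul_assoc]
  | euclidean =>
    have h : HasFDerivAt (fun x : ι → ℝ => ∑ a, x a ^ 2)
        (∑ a, (2 * y a) • (ContinuousLinearMap.proj a : (ι → ℝ) →L[ℝ] ℝ)) y := by
      refine HasFDerivAt.fun_sum fun a _ => ?_
      have h0 : HasFDerivAt (fun x : ι → ℝ => x a) (ContinuousLinearMap.proj (R := ℝ) a) y :=
        hasFDerivAt_apply a y
      refine (h0.pow 2).congr_fderiv ?_
      simp
    have h2 := h.const_mul (α / 2)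
    refine h2.congr_fderiv ?_
    ext v
    simp only [Reg.grad, smul_apply, _root_.sum_apply,
      ContinuousLinearMap.proj_apply, smul_eq_mul, Finset.mul_sum]
    exact Finset.sum_congr rfl fun a _ => by ring

theorem Reg.bregman_psi (reg : Reg) (α : ℝ) (x : ι → ℝ) {y : ι → ℝ} (hy : ∀ a, 0 < y a) :
    bregman (reg.psi α) x y =
      reg.psi α x - reg.psi α y - ∑ a, reg.grad α y a * (x a - y a) := by
  rw [bregman, (reg.hasFDerivAt_psi α hy).fderiv]
  simp

theorem convex_perturbedSimplex (γ : ℝ) (ν : ι → ℝ) : Convex ℝ (perturbedSimplex γ ν) := by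
  have : perturbedSimplex γ ν = stdSimplex ℝ ι ∩ ⋂ a, {x : ι → ℝ | γ * ν a ≤ x a} := by
    ext x; simp [perturbedSimplex]
  rw [this]
  refine (convex_stdSimplex ℝ ι).inter (convex_iInter fun a => ?_)
  exact convex_halfSpace_ge (LinearMap.proj a : (ι → ℝ) →ₗ[ℝ] ℝ).isLinear _

/-- The function minimized by a proximal step with linear loss `-q`, regularization weight `c₁`,
inverse step size `c₂` and center `c`. -/
noncomputable def proxObjective (reg : Reg) (α c₁ c₂ : ℝ) (q c x : ι → ℝ) : ℝ :=
  ∑ a, x a * (-q a) + c₁ * reg.psi α x + c₂ * bregman (reg.psi α) x c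

/-- First-order optimality of a proximal step. -/
theorem prox_variational (reg : Reg) (α c₁ c₂ : ℝ) {q c y x : ι → ℝ} {s : Set (ι → ℝ)}
    (hs : Convex ℝ s) (hy : y ∈ s) (hx : x ∈ s) (hy0 : ∀ a, 0 < y a) (hc0 : ∀ a, 0 < c a)
    (hmin : IsMinOn (proxObjective reg α c₁ c₂ q c) s y) :
    0 ≤ ∑ a, (-q a + c₁ * reg.grad α y a + c₂ * (reg.grad α y a - reg.grad α c a)) *
      (x a - y a) := by
  have hψ := reg.hasFDerivAt_psi α hy0
  have h1 : HasFDerivAt (fun x : ι → ℝ => ∑ a, x a * (-q a))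
      (∑ a, (-q a) • (ContinuousLinearMap.proj a : (ι → ℝ) →L[ℝ] ℝ)) y := by
    refine HasFDerivAt.fun_sum fun a _ => ?_
    exact ((hasFDerivAt_apply (𝕜 := ℝ) a y).mul_const' (-q a)).congr_fderiv
      (by ext v; simp [mul_comm])
  have h3 : HasFDerivAt (fun x : ι → ℝ => bregman (reg.psi α) x c)
      ((∑ a, reg.grad α y a • (ContinuousLinearMap.proj a : (ι → ℝ) →L[ℝ] ℝ)) -
        fderiv ℝ (reg.psi α) c) y := by
    unfold bregman
    have := ((fderiv ℝ (reg.psi α) c).hasFDerivAt (x := y - c)).comp y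
      ((hasFDerivAt_id (𝕜 := ℝ) y).sub_const c)
    exact ((hψ.sub_const _).sub this).congr_fderiv (by ext v; simp)
  have h := (h1.add (hψ.const_mul c₁)).add (h3.const_mul c₂)
  have key := (IsMinOn.localize hmin).hasFDerivWithinAt_nonneg h.hasFDerivWithinAt
    (sub_mem_posTangentConeAt_of_segment_subset (hs.segment_subset hy hx))
  rw [(reg.hasFDerivAt_psi α hc0).fderiv] at key
  refine key.trans_eq ?_
  simp only [add_apply, sub_apply,
    smul_apply, _root_.sum_apply, ContinuousLinearMap.proj_apply,
    smul_eq_mul, Pi.sub_apply, Finset.mul_sum, ← Finset.sum_add_distrib, ← Finset.sum_sub_distrib]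
  exact Finset.sum_congr rfl fun a _ => by ring

/-- The three-point inequality of a proximal step. -/
theorem prox_three_point (reg : Reg) (α c₁ c₂ : ℝ) {q c y x : ι → ℝ} {s : Set (ι → ℝ)}
    (hs : Convex ℝ s) (hy : y ∈ s) (hx : x ∈ s) (hy0 : ∀ a, 0 < y a) (hc0 : ∀ a, 0 < c a)
    (hmin : IsMinOn (proxObjective reg α c₁ c₂ q c) s y) :
    ∑ a, q a * (x a - y a) + c₂ * bregman (reg.psi α) y c
        + (c₁ + c₂) * bregman (reg.psi α) x y ≤
      c₁ * (reg.psi α x - reg.psi α y) + c₂ * bregman (reg.psi α) x c := by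
  have h := prox_variational reg α c₁ c₂ hs hy hx hy0 hc0 hmin
  rw [reg.bregman_psi α y hc0, reg.bregman_psi α x hy0, reg.bregman_psi α x hc0]
  have e : ∑ a, (-q a + c₁ * reg.grad α y a + c₂ * (reg.grad α y a - reg.grad α c a)) *
      (x a - y a) = -∑ a, q a * (x a - y a) + (c₁ + c₂) * ∑ a, reg.grad α y a * (x a - y a)
      - c₂ * (∑ a, reg.grad α c a * (x a - c a) - ∑ a, reg.grad α c a * (y a - c a)) := by
    simp only [Finset.mul_sum, ← Finset.sum_neg_distrib, ← Finset.sum_add_distrib,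
      ← Finset.sum_sub_distrib]
    exact Finset.sum_congr rfl fun a _ => by ring
  rw [e] at h
  linarith

/-- The constant `κ` such that `reg.psi α` is `α / κ`-strongly convex with respect to the 1-norm.
For the entropy `κ = 1` would be sharp, by Pinsker's inequality, but `κ = 2` has a shorter proof
and is small enough. -/
noncomputable def Reg.kappa (reg : Reg) (ι : Type*) [Fintype ι] : ℝ :=
  match reg with
  | .entropy => 2
  | .euclidean => Fintype.card ι

theorem Reg.kappa_pos (reg : Reg) [Nonempty ι] : 0 < reg.kappa ι := by
  cases reg <;> simp [Reg.kappa, Fintype.card_pos]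

/-- A weak form of Pinsker's inequality, through the Hellinger distance. -/
theorem sq_sum_abs_sub_le_four_mul_kl {x y : ι → ℝ} (hx : ∀ a, 0 < x a) (hy : ∀ a, 0 < y a)
    (hx1 : ∑ a, x a = 1) (hy1 : ∑ a, y a = 1) :
    (∑ a, |x a - y a|) ^ 2 ≤ 4 * ∑ a, x a * (Real.log (x a) - Real.log (y a)) := by
  -- the divergence dominates the squared Hellinger distance, because `log r ≤ r - 1` at
  -- `r = √(y a) / √(x a)`
  have hell : ∑ a, (√(x a) - √(y a)) ^ 2 ≤ ∑ a, x a * (Real.log (x a) - Real.log (y a)) := by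
    have : ∀ a, (√(x a) - √(y a)) ^ 2 + (x a - y a) ≤
        x a * (Real.log (x a) - Real.log (y a)) := by
      intro a
      have hsx := Real.sqrt_pos.2 (hx a)
      have hsy := Real.sqrt_pos.2 (hy a)
      have hl := Real.log_le_sub_one_of_pos (div_pos hsy hsx)
      rw [Real.log_div hsy.ne' hsx.ne', Real.log_sqrt (hx a).le, Real.log_sqrt (hy a).le] at hl
      have h2 := mul_le_mul_of_nonneg_left hl (hx a).le
      have e : x a * (√(y a) / √(x a) - 1) = √(x a) * √(y a) - x a := by
        have : x a = √(x a) * √(x a) := (Real.mul_self_sqrt (hx a).le).symm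
        have h3 : x a * (√(y a) / √(x a)) = √(x a) * √(y a) := by
          rw [mul_div_assoc', div_eq_iff hsx.ne']
          linear_combination √(y a) * this
        rw [mul_sub, h3, mul_one]
      rw [e] at h2
      have e1 := Real.sq_sqrt (hx a).le
      have e2 := Real.sq_sqrt (hy a).le
      nlinarith
    have h := Finset.sum_le_sum fun a (_ : a ∈ univ) => this a
    rw [Finset.sum_add_distrib, Finset.sum_sub_distrib, hx1, hy1] at h
    linarith
  -- Cauchy-Schwarz for `|x - y| = |√x - √y| (√x + √y)`
  have hcs := Finset.sum_mul_sq_le_sq_mul_sq univ (fun a => |√(x a) - √(y a)|)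
    (fun a => √(x a) + √(y a))
  have e : ∀ a, |√(x a) - √(y a)| * (√(x a) + √(y a)) = |x a - y a| := by
    intro a
    have e0 := abs_of_nonneg (add_nonneg (Real.sqrt_nonneg (x a)) (Real.sqrt_nonneg (y a)))
    rw [← congrArg (|√(x a) - √(y a)| * ·) e0, ← abs_mul]
    congr 1
    have e1 := Real.sq_sqrt (hx a).le
    have e2 := Real.sq_sqrt (hy a).le
    linear_combination e1 - e2
  simp only [e, sq_abs] at hcs
  have h4 : ∑ a, (√(x a) + √(y a)) ^ 2 ≤ 4 := by
    have : ∀ a, (√(x a) + √(y a)) ^ 2 ≤ 2 * x a + 2 * y a := by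
      intro a
      have e1 := Real.sq_sqrt (hx a).le
      have e2 := Real.sq_sqrt (hy a).le
      nlinarith [sq_nonneg (√(x a) - √(y a))]
    refine (Finset.sum_le_sum fun a (_ : a ∈ univ) => this a).trans ?_
    rw [Finset.sum_add_distrib, ← Finset.mul_sum, ← Finset.mul_sum, hx1, hy1]
    norm_num
  have h5 : 0 ≤ ∑ a, (√(x a) - √(y a)) ^ 2 := Finset.sum_nonneg fun a _ => sq_nonneg _
  nlinarith

theorem Reg.bregman_entropy {α : ℝ} {x y : ι → ℝ} (hy : ∀ a, 0 < y a)
    (hx1 : ∑ a, x a = 1) (hy1 : ∑ a, y a = 1) :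
    bregman (Reg.entropy.psi α) x y = α * ∑ a, x a * (Real.log (x a) - Real.log (y a)) := by
  rw [Reg.bregman_psi _ _ _ hy]
  have : ∑ a, α * (Real.log (y a) + 1) * (x a - y a) =
      α * (∑ a, x a * Real.log (y a) - ∑ a, y a * Real.log (y a))
        + α * (∑ a, x a - ∑ a, y a) := by
    simp only [Finset.mul_sum, ← Finset.sum_add_distrib, ← Finset.sum_sub_distrib]
    exact Finset.sum_congr rfl fun a _ => by ring
  simp only [Reg.psi, Reg.grad, this]
  simp only [mul_sub, Finset.sum_sub_distrib, hx1, hy1]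
  ring

theorem Reg.bregman_euclidean {α : ℝ} {x y : ι → ℝ} (hy : ∀ a, 0 < y a) :
    bregman (Reg.euclidean.psi α) x y = α / 2 * ∑ a, (x a - y a) ^ 2 := by
  rw [Reg.bregman_psi _ _ _ hy]
  simp only [Reg.psi, Reg.grad, Finset.mul_sum, ← Finset.sum_sub_distrib]
  exact Finset.sum_congr rfl fun a _ => by ring

/-- Strong convexity of the regularizers with respect to the 1-norm. -/
theorem Reg.bregman_lower_bound (reg : Reg) [Nonempty ι] {α : ℝ} (hα : 0 < α) {x y : ι → ℝ}
    (hx : ∀ a, 0 < x a) (hy : ∀ a, 0 < y a) (hx1 : ∑ a, x a = 1) (hy1 : ∑ a, y a = 1) :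
    α / (2 * reg.kappa ι) * (∑ a, |x a - y a|) ^ 2 ≤ bregman (reg.psi α) x y := by
  cases reg with
  | entropy =>
    rw [Reg.bregman_entropy hy hx1 hy1]
    have h := sq_sum_abs_sub_le_four_mul_kl hx hy hx1 hy1
    have : α / (2 * Reg.entropy.kappa ι) = α / 4 := by norm_num [Reg.kappa]
    rw [this]
    nlinarith
  | euclidean =>
    rw [Reg.bregman_euclidean hy]
    have h := sq_sum_le_card_mul_sum_sq (s := univ) (f := fun a => |x a - y a|)
    simp only [sq_abs, card_univ] at h
    have hn : (0 : ℝ) < Fintype.card ι := by exact_mod_cast Fintype.card_pos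
    simp only [Reg.kappa]
    rw [div_mul_eq_mul_div, div_le_iff₀ (by positivity)]
    nlinarith

theorem Reg.bregman_nonneg (reg : Reg) [Nonempty ι] {α : ℝ} (hα : 0 < α) {x y : ι → ℝ}
    (hx : ∀ a, 0 < x a) (hy : ∀ a, 0 < y a) (hx1 : ∑ a, x a = 1) (hy1 : ∑ a, y a = 1) :
    0 ≤ bregman (reg.psi α) x y :=
  le_trans (by have := reg.kappa_pos (ι := ι); positivity)
    (reg.bregman_lower_bound hα hx hy hx1 hy1)

theorem Reg.bregman_uniform (reg : Reg) [Nonempty ι] (α : ℝ) {x : ι → ℝ} (hx1 : ∑ a, x a = 1) :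
    bregman (reg.psi α) x (fun _ => 1 / (Fintype.card ι : ℝ)) =
      reg.psi α x - reg.psi α (fun _ : ι => 1 / (Fintype.card ι : ℝ)) := by
  have hn : (0 : ℝ) < Fintype.card ι := by exact_mod_cast Fintype.card_pos
  rw [Reg.bregman_psi _ _ _ (fun _ => by positivity)]
  have : ∀ g : ℝ, ∑ a, g * (x a - 1 / (Fintype.card ι : ℝ)) = 0 := by
    intro g
    rw [← Finset.mul_sum, Finset.sum_sub_distrib, hx1]
    simp [hn.ne']
  cases reg <;> simp only [Reg.grad, this, sub_zero]

theorem Reg.psi_uniform_le (reg : Reg) [Nonempty ι] {α : ℝ} (hα : 0 < α) {x : ι → ℝ}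
    (hx : ∀ a, 0 < x a) (hx1 : ∑ a, x a = 1) :
    reg.psi α (fun _ : ι => 1 / (Fintype.card ι : ℝ)) ≤ reg.psi α x := by
  have hn : (0 : ℝ) < Fintype.card ι := by exact_mod_cast Fintype.card_pos
  have h := reg.bregman_nonneg hα hx (y := fun _ => 1 / (Fintype.card ι : ℝ))
    (fun _ => by positivity) hx1 (by simp [hn.ne'])
  rw [reg.bregman_uniform α hx1] at h
  linarith

theorem Reg.psi_nonneg (reg : Reg) [Nonempty ι] {α : ℝ} (hα : 0 < α) {x : ι → ℝ}
    (hx : ∀ a, 0 < x a) (hx1 : ∑ a, x a = 1) : 0 ≤ reg.psi α x := by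
  have hn : (0 : ℝ) < Fintype.card ι := by exact_mod_cast Fintype.card_pos
  refine le_trans ?_ (reg.psi_uniform_le hα hx hx1)
  cases reg with
  | entropy => simp [Reg.psi, hn.ne']
  | euclidean => simp only [Reg.psi]; positivity

theorem Reg.psi_le (reg : Reg) [Nonempty ι] {α : ℝ} (hα : 0 < α) {x : ι → ℝ}
    (hx : ∀ a, 0 < x a) (hx1 : ∑ a, x a = 1) : reg.psi α x ≤ α * Fintype.card ι := by
  have hn : (1 : ℝ) ≤ Fintype.card ι := by exact_mod_cast Fintype.card_pos
  have hle : ∀ a, x a ≤ 1 := fun a => by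
    rw [← hx1]; exact Finset.single_le_sum (fun b _ => (hx b).le) (mem_univ a)
  cases reg with
  | entropy =>
    have h1 : Real.log (Fintype.card ι) ≤ Fintype.card ι - 1 :=
      Real.log_le_sub_one_of_pos (by linarith)
    have h2 : ∑ a, x a * Real.log (x a) ≤ 0 := Finset.sum_nonpos fun a _ =>
      mul_nonpos_of_nonneg_of_nonpos (hx a).le (Real.log_nonpos (hx a).le (hle a))
    exact mul_le_mul_of_nonneg_left (by linarith) hα.le
  | euclidean =>
    have h2 : ∑ a, x a ^ 2 ≤ 1 := by
      rw [← hx1]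
      exact Finset.sum_le_sum fun a _ => by nlinarith [hx a, hle a]
    simp only [Reg.psi]
    nlinarith

theorem Reg.abs_psi_sub_le (reg : Reg) [Nonempty ι] {α : ℝ} (hα : 0 < α) {x y : ι → ℝ}
    (hx : ∀ a, 0 < x a) (hx1 : ∑ a, x a = 1) (hy : ∀ a, 0 < y a) (hy1 : ∑ a, y a = 1) :
    |reg.psi α x - reg.psi α y| ≤ α * Fintype.card ι := by
  have h1 := reg.psi_nonneg hα hx hx1
  have h2 := reg.psi_nonneg hα hy hy1
  have h3 := reg.psi_le hα hx hx1
  have h4 := reg.psi_le hα hy hy1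
  rw [abs_le]; constructor <;> linarith

theorem Reg.bregman_uniform_le (reg : Reg) [Nonempty ι] {α : ℝ} (hα : 0 < α) {x : ι → ℝ}
    (hx : ∀ a, 0 < x a) (hx1 : ∑ a, x a = 1) :
    bregman (reg.psi α) x (fun _ => 1 / (Fintype.card ι : ℝ)) ≤ α * Fintype.card ι := by
  have hn : (0 : ℝ) < Fintype.card ι := by exact_mod_cast Fintype.card_pos
  rw [reg.bregman_uniform α hx1]
  have := reg.psi_nonneg (ι := ι) hα (x := fun _ => 1 / (Fintype.card ι : ℝ))
    (fun _ => by positivity) (by simp [hn.ne'])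
  linarith [reg.psi_le hα hx hx1]

/-- Young's inequality: the inner product with the change of a bounded vector, minus a multiple
of the Bregman divergence. -/
theorem Reg.inner_sub_bregman_le (reg : Reg) [Nonempty ι] {α η R : ℝ} (hα : 0 < α) (hη : 0 < η)
    {x y g : ι → ℝ} (hg : ∀ a, |g a| ≤ R)
    (hx : ∀ a, 0 < x a) (hy : ∀ a, 0 < y a) (hx1 : ∑ a, x a = 1) (hy1 : ∑ a, y a = 1) :
    ∑ a, g a * (x a - y a) - 1 / η * bregman (reg.psi α) x y ≤
      η * reg.kappa ι / (2 * α) * R ^ 2 := by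
  have hk := reg.kappa_pos (ι := ι)
  have h1 : ∑ a, g a * (x a - y a) ≤ R * ∑ a, |x a - y a| := by
    rw [Finset.mul_sum]
    refine Finset.sum_le_sum fun a _ => (le_abs_self _).trans ?_
    rw [abs_mul]
    exact mul_le_mul_of_nonneg_right (hg a) (abs_nonneg _)
  have h2 := mul_le_mul_of_nonneg_left (reg.bregman_lower_bound hα hx hy hx1 hy1)
    (by positivity : 0 ≤ 1 / η)
  set N := ∑ a, |x a - y a|
  -- the difference of the two sides is a complete square
  have h3 : η * reg.kappa ι / (2 * α) * R ^ 2 - (R * N - 1 / η * (α / (2 * reg.kappa ι) * N ^ 2))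
      = 1 / (2 * η * reg.kappa ι * α) * (η * reg.kappa ι * R - α * N) ^ 2 := by
    field_simp
    ring
  have h4 : 0 ≤ 1 / (2 * η * reg.kappa ι * α) * (η * reg.kappa ι * R - α * N) ^ 2 := by
    positivity
  linarith

end Simplex

/-! ### Stability of proximal steps -/

section Prox

variable {ι : Type*} [Fintype ι]

/-- Mass may be moved away from an action whose lower bound is not tight, so the gradient of the
proximal objective is smallest at such an action. -/
theorem prox_gradient_le [DecidableEq ι] (reg : Reg) (α c₁ c₂ : ℝ) {γ : ℝ} {ν q c y : ι → ℝ}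
    (hγν : ∀ a, 0 ≤ γ * ν a) (hy : y ∈ perturbedSimplex γ ν) (hy0 : ∀ a, 0 < y a)
    (hc0 : ∀ a, 0 < c a)
    (hmin : IsMinOn (proxObjective reg α c₁ c₂ q c) (perturbedSimplex γ ν) y)
    {a b : ι} (ha : γ * ν a < y a) :
    -q a + c₁ * reg.grad α y a + c₂ * (reg.grad α y a - reg.grad α c a) ≤
      -q b + c₁ * reg.grad α y b + c₂ * (reg.grad α y b - reg.grad α c b) := by
  set ε := y a - γ * ν a with hε
  have hε0 : 0 < ε := sub_pos.2 ha
  have hxge : ∀ i, γ * ν i ≤ y i + (Pi.single b ε - Pi.single a ε : ι → ℝ) i := by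
    intro i
    have h1 : (0 : ℝ) ≤ (Pi.single b ε : ι → ℝ) i := by
      by_cases h : i = b
      · subst h; simp [hε0.le]
      · simp [h]
    have h2 : (Pi.single a ε : ι → ℝ) i ≤ y i - γ * ν i := by
      by_cases h : i = a
      · subst h; simp [hε]
      · simpa [h] using hy.2 i
    simp only [Pi.sub_apply]
    linarith
  have hx : (y + (Pi.single b ε - Pi.single a ε) : ι → ℝ) ∈ perturbedSimplex γ ν := by
    refine ⟨⟨fun i => (hγν i).trans (hxge i), ?_⟩, hxge⟩
    simp only [Pi.add_apply, Pi.sub_apply, Finset.sum_add_distrib, Finset.sum_sub_distrib]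
    simp [hy.1.2]
  have h := prox_variational reg α c₁ c₂ (convex_perturbedSimplex γ ν) hy hx hy0 hc0 hmin
  have e : ∀ g : ι → ℝ, ∑ i, g i * ((y + (Pi.single b ε - Pi.single a ε) : ι → ℝ) i - y i) =
      g b * ε - g a * ε := by
    intro g
    simp [mul_sub, Finset.sum_sub_distrib, Pi.single_apply]
  rw [e fun i => -q i + c₁ * reg.grad α y i + c₂ * (reg.grad α y i - reg.grad α c i)] at h
  exact le_of_mul_le_mul_right (by linarith) hε0

/-- Multiplicative stability of an entropic proximal step. -/
theorem prox_entropy_abs_log_sub_le [DecidableEq ι] {α c₁ η Q γ₀ : ℝ} (hα : 0 < α) (hc₁ : 0 ≤ c₁)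
    (hη : 0 < η) (hγ₀ : 0 < γ₀) {γ : ℝ} {ν q c y : ι → ℝ} (hγν : ∀ a, 0 ≤ γ * ν a)
    (hq : ∀ a, |q a| ≤ Q) (hy : y ∈ perturbedSimplex γ ν) (hc : c ∈ perturbedSimplex γ ν)
    (hy0 : ∀ a, γ₀ ≤ y a) (hc0 : ∀ a, 0 < c a)
    (hmin : IsMinOn (proxObjective .entropy α c₁ (1 / η) q c) (perturbedSimplex γ ν) y) (a : ι) :
    |Real.log (y a) - Real.log (c a)| ≤ η * (2 * Q / α + c₁ * Real.log (1 / γ₀)) := by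
  have hypos : ∀ a, 0 < y a := fun a => hγ₀.trans_le (hy0 a)
  have hy1 : ∀ a, y a ≤ 1 := fun a => by
    rw [← hy.1.2]; exact Finset.single_le_sum (fun b _ => (hypos b).le) (mem_univ a)
  -- an action that gains is compared with any other action; below, one that loses, which exists
  -- because the entries of both strategies add up to one
  have core : ∀ a b, c a < y a → Real.log (y a) - Real.log (c a) ≤
      Real.log (y b) - Real.log (c b) + η * (2 * Q / α + c₁ * Real.log (1 / γ₀)) := by
    intro a b hab
    have h := prox_gradient_le .entropy α c₁ (1 / η) hγν hy hypos hc0 hmin (b := b)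
      ((hc.2 a).trans_lt hab)
    simp only [Reg.grad] at h
    have h1 : -Real.log (1 / γ₀) ≤ Real.log (y a) := by
      rw [one_div, Real.log_inv, neg_neg]
      exact Real.log_le_log hγ₀ (hy0 a)
    have h2 : Real.log (y b) ≤ 0 := Real.log_nonpos (hypos b).le (hy1 b)
    have h3 := abs_le.1 (hq a)
    have h4 := abs_le.1 (hq b)
    have h5 : α * (c₁ * (Real.log (y b) - Real.log (y a))) ≤ α * (c₁ * Real.log (1 / γ₀)) := by
      gcongr; linarith
    have h6 : 1 / η * (α * (Real.log (y a) - Real.log (c a) - (Real.log (y b) - Real.log (c b))))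
        ≤ 2 * Q + α * (c₁ * Real.log (1 / γ₀)) := by nlinarith
    rw [one_div, inv_mul_le_iff₀ hη, ← le_div_iff₀' hα] at h6
    have h7 : η * (2 * Q + α * (c₁ * Real.log (1 / γ₀))) / α =
        η * (2 * Q / α + c₁ * Real.log (1 / γ₀)) := by field_simp
    linarith
  have hsum : ∑ a, y a = ∑ a, c a := by rw [hy.1.2, hc.1.2]
  have hX : 0 ≤ η * (2 * Q / α + c₁ * Real.log (1 / γ₀)) := by
    have hQ : 0 ≤ Q := (abs_nonneg _).trans (hq a)
    have := Real.log_nonneg (one_le_one_div hγ₀ ((hy0 a).trans (hy1 a)))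
    positivity
  rcases lt_trichotomy (y a) (c a) with h | h | h
  · obtain ⟨b, hb⟩ : ∃ b, c b < y b := by
      by_contra! hcon
      exact (Finset.sum_lt_sum (fun i _ => hcon i) ⟨a, mem_univ a, h⟩).ne hsum
    have h1 := Real.log_le_log (hypos a) h.le
    have h2 := Real.log_le_log (hc0 b) hb.le
    have h3 := core b a hb
    rw [abs_le]; constructor <;> linarith
  · simpa [h] using hX
  · obtain ⟨b, hb⟩ : ∃ b, y b < c b := by
      by_contra! hcon
      exact (Finset.sum_lt_sum (fun i _ => hcon i) ⟨a, mem_univ a, h⟩).ne' hsum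
    have h1 := Real.log_le_log (hypos b) hb.le
    have h2 := Real.log_le_log (hc0 a) h.le
    have h3 := core a b h
    rw [abs_le]; constructor <;> linarith

/-- Additive stability of a Euclidean proximal step. -/
theorem prox_euclidean_abs_sub_le {α c₁ η Q : ℝ} (hα : 0 < α) (hc₁ : 0 ≤ c₁)
    (hη : 0 < η) {γ : ℝ} {ν q c y : ι → ℝ}
    (hq : ∀ a, |q a| ≤ Q) (hy : y ∈ perturbedSimplex γ ν) (hc : c ∈ perturbedSimplex γ ν)
    (hy0 : ∀ a, 0 < y a) (hc0 : ∀ a, 0 < c a)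
    (hmin : IsMinOn (proxObjective .euclidean α c₁ (1 / η) q c) (perturbedSimplex γ ν) y) (a : ι) :
    |y a - c a| ≤ η * (Fintype.card ι / α * Q + 2 * √(Fintype.card ι) * c₁) := by
  have hQ : 0 ≤ Q := (abs_nonneg _).trans (hq a)
  have hn : (1 : ℝ) ≤ Fintype.card ι := by
    exact_mod_cast Fintype.card_pos_iff.2 ⟨a⟩
  have hy1 : ∀ a, y a ≤ 1 := fun a => by
    rw [← hy.1.2]; exact Finset.single_le_sum (fun b _ => (hy0 b).le) (mem_univ a)
  have h := prox_variational .euclidean α c₁ (1 / η) (convex_perturbedSimplex γ ν) hy hc hy0 hc0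
    hmin
  simp only [Reg.grad] at h
  set N := ∑ b, |y b - c b|
  have hN : 0 ≤ N := Finset.sum_nonneg fun _ _ => abs_nonneg _
  set V := ∑ b, (y b - c b) ^ 2
  have hNV : N ^ 2 ≤ Fintype.card ι * V := by
    simpa [sq_abs, N, V] using sq_sum_le_card_mul_sum_sq (s := univ) (f := fun a => |y a - c a|)
  have haV : |y a - c a| ^ 2 ≤ V := by
    rw [sq_abs]
    exact Finset.single_le_sum (f := fun b => (y b - c b) ^ 2) (fun b _ => sq_nonneg _)
      (mem_univ a)
  have hterm : ∀ b, (-q b + c₁ * (α * y b) + 1 / η * (α * y b - α * c b)) * (c b - y b) ≤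
      Q * |y b - c b| + c₁ * α * |y b - c b| - α / η * (y b - c b) ^ 2 := by
    intro b
    have h1 : q b * (y b - c b) ≤ Q * |y b - c b| := by
      refine (le_abs_self _).trans ?_
      rw [abs_mul]; exact mul_le_mul_of_nonneg_right (hq b) (abs_nonneg _)
    have h2 : y b * (c b - y b) ≤ |y b - c b| := by
      refine (le_abs_self _).trans ?_
      rw [abs_mul, abs_of_pos (hy0 b), abs_sub_comm]
      exact mul_le_of_le_one_left (abs_nonneg _) (hy1 b)
    have h3 := mul_le_mul_of_nonneg_left h2 (by positivity : 0 ≤ c₁ * α)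
    have : 1 / η * (α * y b - α * c b) = α / η * (y b - c b) := by ring
    rw [this]
    linarith
  have h' := h.trans (Finset.sum_le_sum fun b _ => hterm b)
  rw [Finset.sum_sub_distrib, Finset.sum_add_distrib, ← Finset.mul_sum, ← Finset.mul_sum,
    ← Finset.mul_sum] at h'
  change 0 ≤ Q * N + c₁ * α * N - α / η * V at h'
  set W := √V
  have hV : 0 ≤ V := Finset.sum_nonneg fun _ _ => sq_nonneg _
  have hWW : W ^ 2 = V := Real.sq_sqrt hV
  have hW : 0 ≤ W := Real.sqrt_nonneg V
  set R := √(Fintype.card ι : ℝ)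
  have hR : 1 ≤ R := Real.one_le_sqrt.2 hn
  have hRR : R ^ 2 = Fintype.card ι := Real.sq_sqrt (by linarith)
  have hNW : N ≤ R * W := by
    refine abs_le_of_sq_le_sq' ?_ (by positivity) |>.2
    rw [mul_pow, hRR, hWW]; exact hNV
  have haW : |y a - c a| ≤ W := Real.le_sqrt_of_sq_le haV
  have hWle : W ≤ η * (R / α * Q + R * c₁) := by
    rcases hW.eq_or_lt with h0 | h0
    · rw [← h0]; positivity
    have h1 : α / η * W ^ 2 ≤ (Q + c₁ * α) * (R * W) := by
      rw [hWW]
      have := mul_le_mul_of_nonneg_left hNW (by positivity : 0 ≤ Q + c₁ * α)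
      linarith
    have h2 : α / η * W ≤ (Q + c₁ * α) * R := by
      refine le_of_mul_le_mul_right ?_ h0
      linarith
    rw [div_mul_eq_mul_div, div_le_iff₀ hη, ← le_div_iff₀' hα] at h2
    refine h2.trans_eq ?_
    field_simp
  refine haW.trans (hWle.trans ?_)
  rw [← hRR]
  gcongr
  · nlinarith
  · nlinarith

end Prox

/-! ### Products along the paths of a game tree -/

section Tree

variable {S : Type u} {A : S → Type v}

/-- The product of the probabilities of the infoset-action pairs in `l`. -/
noncomputable def pathProd (π : (s : S) → A s → ℝ) (l : List (Σ s, A s)) : ℝ :=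
  (l.map (fun x => π x.1 x.2)).prod

@[simp] theorem pathProd_nil (π : (s : S) → A s → ℝ) : pathProd π [] = 1 := rfl

@[simp] theorem pathProd_append (π : (s : S) → A s → ℝ) (l l' : List (Σ s, A s)) :
    pathProd π (l ++ l') = pathProd π l * pathProd π l' := by
  simp [pathProd]

@[simp] theorem pathProd_cons (π : (s : S) → A s → ℝ) (x : Σ s, A s) (l : List (Σ s, A s)) :
    pathProd π (x :: l) = π x.1 x.2 * pathProd π l := by
  simp [pathProd]

theorem pathProd_congr {π π' : (s : S) → A s → ℝ} {l : List (Σ s, A s)}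
    (h : ∀ x ∈ l, π x.1 x.2 = π' x.1 x.2) : pathProd π l = pathProd π' l := by
  unfold pathProd
  rw [List.map_congr_left h]

theorem pathProd_nonneg {π : (s : S) → A s → ℝ} (hπ : ∀ s a, 0 ≤ π s a)
    (l : List (Σ s, A s)) : 0 ≤ pathProd π l := by
  induction l with
  | nil => simp
  | cons x l ih => rw [pathProd_cons]; exact mul_nonneg (hπ _ _) ih

theorem pathProd_pos {π : (s : S) → A s → ℝ} (hπ : ∀ s a, 0 < π s a)
    (l : List (Σ s, A s)) : 0 < pathProd π l := by
  induction l with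
  | nil => simp
  | cons x l ih => rw [pathProd_cons]; exact mul_pos (hπ _ _) ih

theorem pathProd_le_one {π : (s : S) → A s → ℝ} (hπ : ∀ s a, 0 ≤ π s a)
    (hπ1 : ∀ s a, π s a ≤ 1) (l : List (Σ s, A s)) : pathProd π l ≤ 1 := by
  induction l with
  | nil => simp
  | cons x l ih =>
    rw [pathProd_cons]; exact mul_le_one₀ (hπ1 _ _) (pathProd_nonneg hπ _) ih

theorem reach_eq_pathProd (player : S → Fin 2) (π : (s : S) → A s → ℝ) (i : Fin 2)
    (h : Node S A) :
    h.reach player π i = pathProd π (h.path.filter (fun x => player x.1 = i)) := rfl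

theorem reach_mul_reach_compl (player : S → Fin 2) (π : (s : S) → A s → ℝ) (i : Fin 2)
    (h : Node S A) : h.reach player π i * h.reach player π (1 - i) = pathProd π h.path := by
  simp only [reach_eq_pathProd]
  induction h.path with
  | nil => simp
  | cons x l ih =>
    have key : ∀ p i : Fin 2, ¬ p = i ↔ p = 1 - i := by decide
    by_cases hx : player x.1 = i
    · rw [List.filter_cons_of_pos (by simpa using hx),
        List.filter_cons_of_neg (by simpa using fun h' => (key _ _).2 h' hx),
        pathProd_cons, pathProd_cons, ← ih, mul_assoc]
    · rw [List.filter_cons_of_neg (by simpa using hx),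
        List.filter_cons_of_pos (by simpa using (key _ _).1 hx),
        pathProd_cons, pathProd_cons, ← ih, mul_left_comm]

theorem sum_map_finset_sum {β γ : Type*} (s : Finset γ) (m : γ → Multiset β)
    (f : β → ℝ) : ((∑ i ∈ s, m i).map f).sum = ∑ i ∈ s, ((m i).map f).sum := by
  exact map_sum (Multiset.sumAddMonoidHom.comp (Multiset.mapAddMonoidHom f)) m s

namespace GameTree

variable [DecidableEq S] [∀ s, Fintype (A s)]

/-- In the subtree `t` with root `h`, every pair on the path `r` is played at a node of its
infoset. -/
def Along (t : GameTree S A) (h : Node S A) (r : List (Σ s, A s)) : Prop :=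
  ∀ p x r', r = p ++ x :: r' → ∃ h' ∈ t.nodesAt x.1 h, h'.path = h.path ++ p

theorem along_nil (t : GameTree S A) (h : Node S A) : t.Along h [] := by
  intro p x r' e
  simp at e

theorem Along.chance {n : ℕ} {p : Fin n → ℝ} {next : Fin n → GameTree S A} {h : Node S A}
    {r : List (Σ s, A s)} (i : Fin n) (hr : (next i).Along ⟨h.path, h.chance * p i⟩ r) :
    (GameTree.chance n p next).Along h r := by
  intro l x r' e
  obtain ⟨h', hm, hp⟩ := hr l x r' e
  refine ⟨h', ?_, hp⟩
  simp only [nodesAt]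
  exact Multiset.mem_sum.2 ⟨i, mem_univ i, hm⟩

theorem Along.decision {s : S} {next : A s → GameTree S A} {h : Node S A}
    {r : List (Σ s, A s)} (a : A s) (hr : (next a).Along ⟨h.path ++ [⟨s, a⟩], h.chance⟩ r) :
    (GameTree.decision s next).Along h (⟨s, a⟩ :: r) := by
  intro l x r' e
  cases l with
  | nil =>
    obtain ⟨rfl, rfl⟩ : (⟨s, a⟩ : Σ s, A s) = x ∧ r = r' := by simpa using e
    exact ⟨h, by simp [nodesAt], by simp⟩
  | cons y l =>
    obtain ⟨rfl, rfl⟩ : (⟨s, a⟩ : Σ s, A s) = y ∧ r = l ++ x :: r' := by simpa using e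
    obtain ⟨h', hm, hp⟩ := hr l x r' rfl
    refine ⟨h', ?_, by simpa using hp⟩
    simp only [nodesAt]
    exact Multiset.mem_add.2 (Or.inr (Multiset.mem_sum.2 ⟨a, mem_univ a, hm⟩))

theorem along_of_mem_nodesAt (s : S) (t : GameTree S A) : ∀ h₀ h : Node S A,
    h ∈ t.nodesAt s h₀ → ∃ r, h.path = h₀.path ++ r ∧ t.Along h₀ r := by
  induction t with
  | terminal r => intro h₀ h hh; simp [nodesAt] at hh
  | chance n p next ih =>
    intro h₀ h hh
    simp only [nodesAt] at hh
    obtain ⟨i, -, hi⟩ := Multiset.mem_sum.1 hh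
    obtain ⟨r, hr, ha⟩ := ih i _ _ hi
    exact ⟨r, hr, ha.chance i⟩
  | decision s' next ih =>
    intro h₀ h hh
    simp only [nodesAt] at hh
    rcases Multiset.mem_add.1 hh with hh | hh
    · split_ifs at hh with hs
      · rw [Multiset.mem_singleton] at hh
        exact ⟨[], by simp [hh], along_nil _ _⟩
      · simp at hh
    · obtain ⟨a, -, hi⟩ := Multiset.mem_sum.1 hh
      obtain ⟨r, hr, ha⟩ := ih a _ _ hi
      exact ⟨⟨s', a⟩ :: r, by simpa using hr, ha.decision a⟩

theorem along_of_mem_leaves (t : GameTree S A) : ∀ (h₀ : Node S A) (z : Node S A × ℝ),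
    z ∈ t.leaves h₀ → ∃ r, z.1.path = h₀.path ++ r ∧ t.Along h₀ r := by
  induction t with
  | terminal r =>
    intro h₀ h hh
    rw [leaves, Multiset.mem_singleton] at hh
    exact ⟨[], by simp [hh], along_nil _ _⟩
  | chance n p next ih =>
    intro h₀ h hh
    simp only [leaves] at hh
    obtain ⟨i, -, hi⟩ := Multiset.mem_sum.1 hh
    obtain ⟨r, hr, ha⟩ := ih i _ _ hi
    exact ⟨r, hr, ha.chance i⟩
  | decision s' next ih =>
    intro h₀ h hh
    simp only [leaves] at hh
    obtain ⟨a, -, hi⟩ := Multiset.mem_sum.1 hh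
    obtain ⟨r, hr, ha⟩ := ih a _ _ hi
    exact ⟨⟨s', a⟩ :: r, by simpa using hr, ha.decision a⟩

theorem ChanceOK.chance_mem_nodesAt (s : S) {t : GameTree S A} (ht : t.ChanceOK) :
    ∀ h₀ h : Node S A, 0 < h₀.chance → h ∈ t.nodesAt s h₀ →
      0 < h.chance ∧ h.chance ≤ h₀.chance := by
  induction t with
  | terminal r => intro h₀ h _ hh; simp [nodesAt] at hh
  | chance n p next ih =>
    intro h₀ h h0 hh
    simp only [nodesAt] at hh
    obtain ⟨i, -, hi⟩ := Multiset.mem_sum.1 hh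
    obtain ⟨h1, h2⟩ := ih i (ht.2.2 i) _ _ (mul_pos h0 (ht.1 i)) hi
    refine ⟨h1, h2.trans (mul_le_of_le_one_right h0.le ?_)⟩
    rw [← ht.2.1]
    exact Finset.single_le_sum (fun j _ => (ht.1 j).le) (mem_univ i)
  | decision s' next ih =>
    intro h₀ h h0 hh
    simp only [nodesAt] at hh
    rcases Multiset.mem_add.1 hh with hh | hh
    · split_ifs at hh with hs
      · rw [Multiset.mem_singleton] at hh
        subst hh; exact ⟨h0, le_rfl⟩
      · simp at hh
    · obtain ⟨a, -, hi⟩ := Multiset.mem_sum.1 hh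
      exact ih a (ht a) ⟨h₀.path ++ [⟨s', a⟩], h₀.chance⟩ _ h0 hi

theorem ChanceOK.chance_mem_leaves {t : GameTree S A} (ht : t.ChanceOK) :
    ∀ (h₀ : Node S A) (z : Node S A × ℝ), 0 < h₀.chance → z ∈ t.leaves h₀ → 0 < z.1.chance := by
  induction t with
  | terminal r =>
    intro h₀ h h0 hh
    rw [leaves, Multiset.mem_singleton] at hh
    subst hh; exact h0
  | chance n p next ih =>
    intro h₀ h h0 hh
    simp only [leaves] at hh
    obtain ⟨i, -, hi⟩ := Multiset.mem_sum.1 hh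
    exact ih i (ht.2.2 i) _ _ (mul_pos h0 (ht.1 i)) hi
  | decision s' next ih =>
    intro h₀ h h0 hh
    simp only [leaves] at hh
    obtain ⟨a, -, hi⟩ := Multiset.mem_sum.1 hh
    exact ih a (ht a) ⟨h₀.path ++ [⟨s', a⟩], h₀.chance⟩ _ h0 hi

/-- The probabilities of the terminal nodes add up to at most that of the root. -/
theorem ChanceOK.sum_leaves_le {ρ : (s : S) → A s → ℝ} (hρ : ∀ s a, 0 ≤ ρ s a)
    (hρ1 : ∀ s, ∑ a, ρ s a ≤ 1) {t : GameTree S A} (ht : t.ChanceOK) :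
    ∀ h₀ : Node S A, 0 < h₀.chance →
      ((t.leaves h₀).map (fun z => z.1.chance * pathProd ρ z.1.path)).sum ≤
        h₀.chance * pathProd ρ h₀.path := by
  induction t with
  | terminal r => intro h₀ _; simp [leaves]
  | chance n p next ih =>
    intro h₀ h0
    simp only [leaves, sum_map_finset_sum]
    refine (Finset.sum_le_sum fun i _ => ih i (ht.2.2 i) _ (mul_pos h0 (ht.1 i))).trans_eq ?_
    simp only [mul_right_comm _ _ (pathProd ρ _), ← Finset.mul_sum, ht.2.1, mul_one]
  | decision s' next ih =>
    intro h₀ h0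
    simp only [leaves, sum_map_finset_sum]
    refine (Finset.sum_le_sum fun a _ => ih a (ht a) ⟨h₀.path ++ [⟨s', a⟩], h₀.chance⟩ h0).trans ?_
    simp only [pathProd_append, pathProd_cons, pathProd_nil, mul_one, ← mul_assoc,
      ← Finset.mul_sum]
    exact mul_le_of_le_one_right (mul_nonneg h0.le (pathProd_nonneg hρ _)) (hρ1 s')

/-- The probabilities of the nodes of an infoset add up to at most that of the root, if no node of
the infoset lies below another one. -/
theorem ChanceOK.sum_nodesAt_le {ρ : (s : S) → A s → ℝ} (hρ : ∀ s a, 0 ≤ ρ s a)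
    (hρ1 : ∀ s, ∑ a, ρ s a ≤ 1) (s : S) (f : (Σ s, A s) → Bool) (hf : ∀ a, f ⟨s, a⟩ = true)
    (L : List (Σ s, A s)) {t : GameTree S A} (ht : t.ChanceOK) :
    ∀ h₀ : Node S A, 0 < h₀.chance → (∀ h ∈ t.nodesAt s h₀, h.path.filter f = L) →
      ((t.nodesAt s h₀).map (fun h => h.chance * pathProd ρ h.path)).sum ≤
        h₀.chance * pathProd ρ h₀.path := by
  induction t with
  | terminal r =>
    intro h₀ h0 _
    simpa [nodesAt] using mul_nonneg h0.le (pathProd_nonneg hρ _)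
  | chance n p next ih =>
    intro h₀ h0 hL
    simp only [nodesAt, sum_map_finset_sum]
    refine (Finset.sum_le_sum fun i _ => ih i (ht.2.2 i) _ (mul_pos h0 (ht.1 i))
      fun h hh => hL h ?_).trans_eq ?_
    · simp only [nodesAt]
      exact Multiset.mem_sum.2 ⟨i, mem_univ i, hh⟩
    · simp only [mul_right_comm _ _ (pathProd ρ _), ← Finset.mul_sum, ht.2.1, mul_one]
  | decision s' next ih =>
    intro h₀ h0 hL
    have hmem : ∀ a, ∀ h ∈ (next a).nodesAt s ⟨h₀.path ++ [⟨s', a⟩], h₀.chance⟩,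
        h ∈ (GameTree.decision s' next).nodesAt s h₀ := fun a h hh => by
      simp only [nodesAt]
      exact Multiset.mem_add.2 (Or.inr (Multiset.mem_sum.2 ⟨a, mem_univ a, hh⟩))
    by_cases hs : s' = s
    · subst hs
      have h1 : h₀.path.filter f = L := hL h₀ (by simp [nodesAt])
      have h2 : ∀ a, (next a).nodesAt s' ⟨h₀.path ++ [⟨s', a⟩], h₀.chance⟩ = 0 := by
        intro a
        refine Multiset.eq_zero_of_forall_notMem fun h hh => ?_
        have h3 := hL h (hmem a h hh)
        obtain ⟨r, hr, -⟩ := along_of_mem_nodesAt s' _ _ _ hh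
        rw [hr, ← h1] at h3
        have := congrArg List.length h3
        simp [List.filter_append, hf] at this
      simp [nodesAt, h2]
    · simp only [nodesAt, if_neg hs, zero_add, sum_map_finset_sum]
      refine (Finset.sum_le_sum fun a _ => ih a (ht a) ⟨h₀.path ++ [⟨s', a⟩], h₀.chance⟩ h0
        fun h hh => hL h (hmem a h hh)).trans ?_
      simp only [pathProd_append, pathProd_cons, pathProd_nil, mul_one, ← mul_assoc,
        ← Finset.mul_sum]
      exact mul_le_of_le_one_right (mul_nonneg h0.le (pathProd_nonneg hρ _)) (hρ1 s')

end GameTree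

end Tree

/-! ### Consequences of perfect recall -/

namespace EFG

variable {S : Type u} {A : S → Type v} [DecidableEq S] [∀ s, Fintype (A s)]
  (G : EFG S A)

theorem ownSeq_eq {s : S} {h : Node S A} (hh : h ∈ G.nodes s) :
    h.path.filter (fun x => G.player x.1 = G.player s) = G.ownSeq s :=
  G.perfectRecall s h hh _ (G.infoset_nonempty s).choose_spec

/-- Every pair of `l` is preceded in `l` by exactly the own sequence of its infoset. By perfect
recall, this holds for the pairs of one player on any path of the tree. -/
def OwnPath (l : List (Σ s, A s)) : Prop :=
  ∀ l₁ x l₂, l = l₁ ++ x :: l₂ → l₁ = G.ownSeq x.1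

variable {G}

theorem OwnPath.left {l l' : List (Σ s, A s)} (h : G.OwnPath (l ++ l')) : G.OwnPath l := by
  intro l₁ x l₂ e
  exact h l₁ x (l₂ ++ l') (by simp [e])

/-- An infoset occurs at most once on a path of its owner: its own sequence has only one length. -/
theorem OwnPath.eq_of_fst_eq {l : List (Σ s, A s)} (h : G.OwnPath l) {x y : Σ s, A s}
    (hx : x ∈ l) (hy : y ∈ l) (hxy : x.1 = y.1) : x = y := by
  obtain ⟨l₁, l₂, e⟩ := List.append_of_mem hx
  obtain ⟨l₁', l₂', e'⟩ := List.append_of_mem hy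
  have h1 := h _ _ _ e
  have h2 := h _ _ _ e'
  rw [hxy] at h1
  rw [e, h1, h2] at e'
  have := List.append_cancel_left e'
  simpa using (List.cons.inj this).1

theorem OwnPath.fst_ne {l r : List (Σ s, A s)} (h : G.OwnPath (l ++ r)) {x y : Σ s, A s}
    (hx : x ∈ l) (hy : y ∈ r) : x.1 ≠ y.1 := by
  intro hxy
  obtain ⟨l₁, l₂, rfl⟩ := List.append_of_mem hx
  obtain ⟨r₁, r₂, rfl⟩ := List.append_of_mem hy
  have h1 := h l₁ x (l₂ ++ (r₁ ++ y :: r₂)) (by simp)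
  have h2 := h (l₁ ++ x :: l₂ ++ r₁) y r₂ (by simp)
  rw [← hxy, ← h1] at h2
  have := congrArg List.length h2
  simp at this

variable (G)

theorem ownPath_filter {l : List (Σ s, A s)} (h : G.tree.Along Node.root l) (i : Fin 2) :
    G.OwnPath (l.filter (fun x => G.player x.1 = i)) := by
  intro l₁ x l₂ e
  obtain ⟨m₁, m₂, rfl, h1, h2⟩ := List.filter_eq_append_iff.1 e
  obtain ⟨n₁, n₂, rfl, h3, h4, h5⟩ := List.filter_eq_cons_iff.1 h2
  obtain ⟨h', hm, hp⟩ := h (m₁ ++ n₁) x n₂ (by simp)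
  have h6 : G.player x.1 = i := by simpa using h4
  rw [← G.ownSeq_eq hm, hp, h6, ← h1]
  simp only [Node.root, List.nil_append, List.filter_append]
  rw [List.filter_eq_nil_iff.2 h3, List.append_nil]

theorem along_of_mem_nodes {s : S} {h : Node S A} (hh : h ∈ G.nodes s) :
    G.tree.Along Node.root h.path := by
  obtain ⟨r, hr, ha⟩ := GameTree.along_of_mem_nodesAt s _ _ _ hh
  rw [hr]; simpa [Node.root] using ha

theorem along_of_mem_leaves {z : Node S A × ℝ} (hz : z ∈ G.leaves) :
    G.tree.Along Node.root z.1.path := by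
  obtain ⟨r, hr, ha⟩ := GameTree.along_of_mem_leaves _ _ _ hz
  rw [hr]; simpa [Node.root] using ha

theorem ownPath_ownSeq (s : S) : G.OwnPath (G.ownSeq s) :=
  G.ownPath_filter (G.along_of_mem_nodes (G.infoset_nonempty s).choose_spec) _

theorem player_of_mem_ownSeq {s : S} {x : Σ s, A s} (hx : x ∈ G.ownSeq s) :
    G.player x.1 = G.player s := by
  have := (List.mem_filter.1 hx).2
  simpa using this

theorem ownPath_ownSeq_append (s : S) (a : A s) : G.OwnPath (G.ownSeq s ++ [⟨s, a⟩]) := by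
  intro l₁ x l₂ e
  rcases List.eq_nil_or_concat l₂ with rfl | ⟨l₃, y, rfl⟩
  · obtain ⟨h1, h2⟩ := List.append_inj' e rfl
    obtain rfl : (⟨s, a⟩ : Σ s, A s) = x := by simpa using h2
    exact h1.symm
  · have e' : G.ownSeq s ++ [⟨s, a⟩] = (l₁ ++ x :: l₃) ++ [y] := by simpa using e
    exact G.ownPath_ownSeq s l₁ x l₃ (List.append_inj' e' rfl).1

theorem ownReach_eq (π : (s : S) → A s → ℝ) (s : S) : G.ownReach π s = pathProd π (G.ownSeq s) :=
  rfl

theorem seqForm_eq (π : (s : S) → A s → ℝ) (s : S) (a : A s) :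
    G.seqForm π ⟨s, a⟩ = pathProd π (G.ownSeq s ++ [⟨s, a⟩]) := by
  simp [seqForm, ownReach_eq]

variable {G} in
theorem OwnPath.pathProd_concat {l : List (Σ s, A s)} {x : Σ s, A s} (h : G.OwnPath (l ++ [x]))
    (π : (s : S) → A s → ℝ) : pathProd π (l ++ [x]) = G.seqForm π x := by
  rw [h l x [] rfl, G.seqForm_eq]

/-- `μ^π(σ(s))` as an entry of the sequence form. -/
theorem atParent_seqForm (π : (s : S) → A s → ℝ) (s : S) :
    G.atParent (G.seqForm π) s = G.ownReach π s := by
  rw [atParent, parentSeq, ownReach_eq]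
  have h := G.ownPath_ownSeq s
  rcases List.eq_nil_or_concat (G.ownSeq s) with e | ⟨l, x, e⟩
  · simp [e]
  · rw [List.concat_eq_append] at e
    rw [e] at h ⊢
    rw [h.pathProd_concat]
    simp

section Feasible

variable {G}
variable {γs : S → ℝ} {ν π : (s : S) → A s → ℝ}

theorem Feasible.pos (hπ : Feasible γs ν π) (hγs : ∀ s, 0 < γs s) (hνpos : ∀ s a, 0 < ν s a)
    (s : S) (a : A s) : 0 < π s a :=
  (mul_pos (hγs s) (hνpos s a)).trans_le ((hπ s).2 a)

theorem Feasible.nonneg (hπ : Feasible γs ν π) (s : S) (a : A s) : 0 ≤ π s a := (hπ s).1.1 a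

theorem Feasible.sum_eq_one (hπ : Feasible γs ν π) (s : S) : ∑ a, π s a = 1 := (hπ s).1.2

theorem Feasible.le_one (hπ : Feasible γs ν π) (s : S) (a : A s) : π s a ≤ 1 := by
  rw [← hπ.sum_eq_one s]
  exact Finset.single_le_sum (fun b _ => hπ.nonneg s b) (mem_univ a)

theorem Feasible.seqForm_le (hπ : Feasible γs ν π) (x : Σ s, A s) : G.seqForm π x ≤ π x.1 x.2 :=
  mul_le_of_le_one_left (hπ.nonneg _ _) (pathProd_le_one hπ.nonneg hπ.le_one _)

theorem OwnPath.le_pathProd {l : List (Σ s, A s)} (h : G.OwnPath l) {γ : ℝ} (hγ1 : γ ≤ 1)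
    (hγ : ∀ x, γ ≤ G.seqForm π x) : γ ≤ pathProd π l := by
  rcases List.eq_nil_or_concat l with rfl | ⟨l', x, rfl⟩
  · simpa using hγ1
  · rw [List.concat_eq_append] at h ⊢
    rw [h.pathProd_concat]; exact hγ x

end Feasible

section Follow

variable {A : S → Type v} [∀ s, DecidableEq (A s)]

open Classical in
/-- The profile that plays the pairs of `L` at their infosets and agrees with `π` elsewhere. -/
noncomputable def follow (L : List (Σ s, A s)) (π : (s : S) → A s → ℝ) (s : S) (a : A s) : ℝ :=
  if ∃ x ∈ L, x.1 = s then (if (⟨s, a⟩ : Σ s, A s) ∈ L then 1 else 0) else π s a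

theorem follow_nonneg {L : List (Σ s, A s)} {π : (s : S) → A s → ℝ} (hπ : ∀ s a, 0 ≤ π s a)
    (s : S) (a : A s) : 0 ≤ follow L π s a := by
  unfold follow
  split_ifs
  · exact zero_le_one
  · exact le_rfl
  · exact hπ s a

theorem sum_follow_le [∀ s, Fintype (A s)] {L : List (Σ s, A s)} {π : (s : S) → A s → ℝ}
    (hπ : ∀ s, ∑ a, π s a = 1)
    (hL : ∀ x ∈ L, ∀ y ∈ L, x.1 = y.1 → x = y) (s : S) : ∑ a, follow L π s a ≤ 1 := by
  unfold follow
  split_ifs with h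
  · obtain ⟨⟨s', b⟩, hb, rfl⟩ := h
    have : ∀ a, (⟨s', a⟩ : Σ s, A s) ∈ L → a = b := by
      intro a ha
      have := hL _ ha _ hb rfl
      simpa using this
    rw [Finset.sum_eq_single b (fun a _ hab => if_neg fun ha => hab (this a ha)) (by simp)]
    simp [hb]
  · exact (hπ s).le

theorem pathProd_follow_self (L : List (Σ s, A s)) (π : (s : S) → A s → ℝ) :
    pathProd (follow L π) L = 1 := by
  have : ∀ x ∈ L, follow L π x.1 x.2 = (fun _ _ => 1 : (s : S) → A s → ℝ) x.1 x.2 := by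
    intro x hx
    rw [follow, if_pos ⟨x, hx, rfl⟩, if_pos hx]
  rw [pathProd_congr (π' := fun _ _ => 1) this]
  simp [pathProd]

theorem pathProd_follow_of_ne {L l : List (Σ s, A s)} (π : (s : S) → A s → ℝ)
    (h : ∀ x ∈ L, ∀ y ∈ l, x.1 ≠ y.1) : pathProd (follow L π) l = pathProd π l := by
  refine pathProd_congr fun y hy => ?_
  rw [follow, if_neg]
  rintro ⟨x, hx, hxy⟩
  exact h x hx y hy hxy

end Follow

section Mass

variable [∀ s, DecidableEq (A s)] {γs : S → ℝ} {ν π : (s : S) → A s → ℝ}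

theorem ne_one_sub (i : Fin 2) : i ≠ 1 - i := by revert i; decide

/-- The own sequence followed with probability one turns the reach probability of the opponent
and chance into a probability. -/
theorem oppReach_le_one (hπ : Feasible γs ν π) (s : S) : G.oppReach π s ≤ 1 := by
  have h := G.chanceOK.sum_nodesAt_le (ρ := follow (G.ownSeq s) π) (follow_nonneg hπ.nonneg)
    (sum_follow_le hπ.sum_eq_one fun x hx y hy => (G.ownPath_ownSeq s).eq_of_fst_eq hx hy) s
    (fun x => G.player x.1 = G.player s) (by simp) (G.ownSeq s) Node.root (by simp [Node.root])
    (fun h hh => G.ownSeq_eq hh)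
  simp only [Node.root, pathProd_nil, mul_one] at h
  refine le_trans (le_of_eq ?_) h
  unfold oppReach
  refine congrArg Multiset.sum (Multiset.map_congr rfl fun h hh => ?_)
  rw [← reach_mul_reach_compl G.player _ (G.player s), reach_eq_pathProd, reach_eq_pathProd,
    G.ownSeq_eq hh, pathProd_follow_self, one_mul, reach_eq_pathProd, pathProd_follow_of_ne]
  intro x hx y hy hxy
  have h1 := G.player_of_mem_ownSeq hx
  have h2 : G.player y.1 = 1 - G.player s := by simpa using (List.mem_filter.1 hy).2
  rw [hxy, h2] at h1
  exact ne_one_sub _ h1.symm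

theorem chance_pos_of_mem_nodes {s : S} {h : Node S A} (hh : h ∈ G.nodes s) : 0 < h.chance :=
  (G.chanceOK.chance_mem_nodesAt s Node.root h (by simp [Node.root]) hh).1

theorem chance_le_one_of_mem_nodes {s : S} {h : Node S A} (hh : h ∈ G.nodes s) : h.chance ≤ 1 :=
  (G.chanceOK.chance_mem_nodesAt s Node.root h (by simp [Node.root]) hh).2

theorem chance_pos_of_mem_leaves {z : Node S A × ℝ} (hz : z ∈ G.leaves) : 0 < z.1.chance :=
  G.chanceOK.chance_mem_leaves Node.root z (by simp [Node.root]) hz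

/-- The pairs of the owner of `s` on the path to a terminal node below `(s, a)`. -/
theorem exists_filter_path_eq {z : Node S A × ℝ} (hz : z ∈ G.leaves) {s : S} {a : A s}
    (hza : (⟨s, a⟩ : Σ s, A s) ∈ z.1.path) :
    ∃ r, z.1.path.filter (fun x => G.player x.1 = G.player s) =
      (G.ownSeq s ++ [⟨s, a⟩]) ++ r := by
  have ho := G.ownPath_filter (G.along_of_mem_leaves hz) (G.player s)
  have hm : (⟨s, a⟩ : Σ s, A s) ∈ z.1.path.filter (fun x => G.player x.1 = G.player s) :=
    List.mem_filter.2 ⟨hza, by simp⟩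
  obtain ⟨l₁, l₂, e⟩ := List.append_of_mem hm
  exact ⟨l₂, by rw [e, ho _ _ _ e]; simp⟩

theorem abs_payoffOf (i : Fin 2) (r : ℝ) : |payoffOf i r| = |r| := by
  unfold payoffOf; split_ifs <;> simp

/-- The own reach probability below `(s, a)` is that of the profile that plays the path to
`(s, a)` with probability one, so the weights of the payoffs are probabilities. -/
theorem abs_cfValue_le_one (hπ : Feasible γs ν π) (hpos : ∀ s a, 0 < π s a) (s : S) (a : A s) :
    |G.cfValue π s a| ≤ 1 := by
  have h := G.chanceOK.sum_leaves_le (ρ := follow (G.ownSeq s ++ [⟨s, a⟩]) π)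
    (follow_nonneg hπ.nonneg)
    (sum_follow_le hπ.sum_eq_one fun x hx y hy =>
      (G.ownPath_ownSeq_append s a).eq_of_fst_eq hx hy) Node.root (by simp [Node.root])
  simp only [Node.root, pathProd_nil, mul_one] at h
  refine le_trans ?_ h
  change _ ≤ (G.leaves.map _).sum
  unfold cfValue
  refine Multiset.abs_sum_le_sum_abs.trans ?_
  rw [Multiset.map_map]
  set F : Node S A × ℝ → ℝ := fun z =>
    z.1.chance * pathProd (follow (G.ownSeq s ++ [⟨s, a⟩]) π) z.1.path with hF
  have hF0 : ∀ z ∈ G.leaves, 0 ≤ F z := fun z hz =>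
    mul_nonneg (G.chance_pos_of_mem_leaves hz).le (pathProd_nonneg (follow_nonneg hπ.nonneg) _)
  -- the terminal nodes that are not below `(s, a)` may be added, as `F` is nonnegative
  have hsub : ((G.leaves.filter (fun z => (⟨s, a⟩ : Σ s, A s) ∈ z.1.path)).map F).sum ≤
      (G.leaves.map F).sum := by
    conv_rhs => rw [← Multiset.filter_add_not (fun z => (⟨s, a⟩ : Σ s, A s) ∈ z.1.path) G.leaves]
    rw [Multiset.map_add, Multiset.sum_add]
    refine le_add_of_nonneg_right (Multiset.sum_nonneg fun r hr => ?_)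
    obtain ⟨z, hz, rfl⟩ := Multiset.mem_map.1 hr
    exact hF0 z (Multiset.mem_filter.1 hz).1
  refine le_trans (Multiset.sum_map_le_sum_map _ _ fun z hz => ?_) hsub
  obtain ⟨hz, hza⟩ := Multiset.mem_filter.1 hz
  obtain ⟨r, hr⟩ := G.exists_filter_path_eq hz hza
  have ho := G.ownPath_filter (G.along_of_mem_leaves hz) (G.player s)
  rw [hr] at ho
  have hL := pathProd_pos hpos (G.ownSeq s ++ [⟨s, a⟩])
  have h1 : z.1.reach G.player π (G.player s) / G.seqForm π ⟨s, a⟩ = pathProd π r := by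
    rw [reach_eq_pathProd, hr, G.seqForm_eq, pathProd_append, mul_div_cancel_left₀ _ hL.ne']
  have h2 : pathProd (follow (G.ownSeq s ++ [⟨s, a⟩]) π) z.1.path =
      pathProd π r * z.1.reach G.player π (1 - G.player s) := by
    rw [← reach_mul_reach_compl G.player _ (G.player s), reach_eq_pathProd, hr,
      pathProd_append, pathProd_follow_self, one_mul,
      pathProd_follow_of_ne _ fun x hx y hy => ho.fst_ne hx hy, reach_eq_pathProd,
      pathProd_follow_of_ne, reach_eq_pathProd]
    intro x hx y hy hxy
    have h1 : G.player x.1 = G.player s := by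
      rcases List.mem_append.1 hx with hx | hx
      · exact G.player_of_mem_ownSeq hx
      · rw [List.mem_singleton.1 hx]
    have h2 : G.player y.1 = 1 - G.player s := by simpa using (List.mem_filter.1 hy).2
    rw [hxy, h2] at h1
    exact ne_one_sub _ h1.symm
  have hzp : |payoffOf (G.player s) z.2| ≤ 1 := by
    rw [abs_payoffOf]; exact abs_le.2 (G.payoff_mem z hz)
  simp only [Function.comp, h1, hF, h2]
  rw [abs_mul, ← mul_assoc]
  have h0 : 0 ≤ z.1.chance * pathProd π r * z.1.reach G.player π (1 - G.player s) :=
    mul_nonneg (mul_nonneg (G.chance_pos_of_mem_leaves hz).le (pathProd_nonneg hπ.nonneg _))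
      (pathProd_nonneg hπ.nonneg _)
  rw [abs_of_nonneg h0]
  exact mul_le_of_le_one_right h0 hzp

end Mass

end EFG

/-! ### Performance difference and the dilated regularizer -/

theorem sum_map_filter_ite {β : Type*} (m : Multiset β) (p : β → Prop) [DecidablePred p]
    (f : β → ℝ) : ((m.filter p).map f).sum = (m.map fun z => if p z then f z else 0).sum := by
  induction m using Multiset.induction with
  | empty => simp
  | cons z m ih =>
    by_cases hz : p z <;> simp [hz, ih]

theorem finset_sum_multiset_comm {β γ : Type*} (s : Finset γ) (m : Multiset β) (f : γ → β → ℝ) :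
    ∑ x ∈ s, (m.map (f x)).sum = (m.map fun z => ∑ x ∈ s, f x z).sum := by
  induction m using Multiset.induction with
  | empty => simp
  | cons z m ih => simp [Finset.sum_add_distrib, ih]

namespace EFG

variable {S : Type u} {A : S → Type v} [Fintype S] [DecidableEq S] [∀ s, Fintype (A s)]
  [∀ s, DecidableEq (A s)] (G : EFG S A)

/-- The difference of two products along an own path, decomposed according to the first pair at
which the second profile is followed. -/
theorem OwnPath.pathProd_sub {G : EFG S A} {l : List (Σ s, A s)} (hl : G.OwnPath l)
    {π : (s : S) → A s → ℝ} (hπ : ∀ s a, 0 < π s a) (π' : (s : S) → A s → ℝ) :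
    pathProd π' l - pathProd π l = ∑ x : Σ s, A s, if x ∈ l then
      G.ownReach π' x.1 * (π' x.1 x.2 - π x.1 x.2) * (pathProd π l / G.seqForm π x) else 0 := by
  induction l using List.reverseRecOn with
  | nil => simp
  | append_singleton l x ih =>
    have ih := ih hl.left
    have hx : x ∉ l := fun h => hl.fst_ne h (List.mem_singleton.2 rfl) rfl
    have hsx : 0 < G.seqForm π x := by
      rw [← hl.pathProd_concat]; exact pathProd_pos hπ _
    have hlx : l = G.ownSeq x.1 := hl l x [] rfl
    have hsplit : ∀ y : Σ s, A s, (if y ∈ l ++ [x] then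
        G.ownReach π' y.1 * (π' y.1 y.2 - π y.1 y.2) *
          (pathProd π (l ++ [x]) / G.seqForm π y) else 0) =
        (if y ∈ l then G.ownReach π' y.1 * (π' y.1 y.2 - π y.1 y.2) *
          (pathProd π l / G.seqForm π y) else 0) * π x.1 x.2 +
        (if y = x then G.ownReach π' x.1 * (π' x.1 x.2 - π x.1 x.2) else 0) := by
      intro y
      by_cases hy : y = x
      · subst hy
        rw [hl.pathProd_concat, div_self hsx.ne']
        simp [hx]
      · by_cases hyl : y ∈ l
        · simp [hy, hyl]; ring
        · simp [hy, hyl]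
    rw [Finset.sum_congr rfl fun y _ => hsplit y, Finset.sum_add_distrib, ← Finset.sum_mul, ← ih,
      Finset.sum_ite_eq' univ x]
    simp only [mem_univ, if_true, pathProd_append, pathProd_cons, pathProd_nil, mul_one,
      ownReach_eq, ← hlx]
    ring

/-- The expected payoff of player `i`. -/
noncomputable def playerValue (i : Fin 2) (π : (s : S) → A s → ℝ) : ℝ :=
  (G.leaves.map (fun z => z.1.chance * z.1.reach G.player π i * z.1.reach G.player π (1 - i) *
    payoffOf i z.2)).sum

theorem playerValue_zero (π : (s : S) → A s → ℝ) : G.playerValue 0 π = G.utility π := by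
  simp [playerValue, utility, payoffOf]

theorem playerValue_one (π : (s : S) → A s → ℝ) : G.playerValue 1 π = -G.utility π := by
  rw [playerValue, utility, ← Multiset.sum_map_neg', Multiset.map_map]
  refine congrArg Multiset.sum (Multiset.map_congr rfl fun z _ => ?_)
  simp only [Function.comp, payoffOf, sub_self, one_ne_zero, if_false]
  ring

/-- The dilated regularizer of player `i` in terms of the strategies. -/
noncomputable def treeReg (reg : Reg) (α : S → ℝ) (i : Fin 2) (π : (s : S) → A s → ℝ) : ℝ :=
  ∑ s ∈ univ.filter (fun s => G.player s = i), G.ownReach π s * reg.psi (α s) (π s)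

theorem ownReach_congr {π π' : (s : S) → A s → ℝ} {s : S}
    (h : ∀ s', G.player s' = G.player s → π s' = π' s') : G.ownReach π s = G.ownReach π' s :=
  pathProd_congr fun x hx => by rw [h x.1 (G.player_of_mem_ownSeq hx)]

theorem reach_congr {π π' : (s : S) → A s → ℝ} {i : Fin 2}
    (h : ∀ s, G.player s = i → π s = π' s) (z : Node S A) :
    z.reach G.player π i = z.reach G.player π' i :=
  pathProd_congr fun x hx => by rw [h x.1 (by simpa using (List.mem_filter.1 hx).2)]

theorem treeReg_congr (reg : Reg) (α : S → ℝ) {π π' : (s : S) → A s → ℝ} {i : Fin 2}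
    (h : ∀ s, G.player s = i → π s = π' s) : G.treeReg reg α i π = G.treeReg reg α i π' := by
  refine Finset.sum_congr rfl fun s hs => ?_
  have hs' : G.player s = i := (Finset.mem_filter.1 hs).2
  rw [G.ownReach_congr fun s' h' => h s' (h'.trans hs'), h s hs']

theorem ownReach_pos {π : (s : S) → A s → ℝ} (hπ : ∀ s a, 0 < π s a) (s : S) :
    0 < G.ownReach π s := pathProd_pos hπ _

theorem seqForm_pos {π : (s : S) → A s → ℝ} (hπ : ∀ s a, 0 < π s a) (x : Σ s, A s) :
    0 < G.seqForm π x := mul_pos (G.ownReach_pos hπ _) (hπ _ _)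

theorem seqForm_div_atParent {π : (s : S) → A s → ℝ} (hπ : ∀ s a, 0 < π s a) (s : S) :
    (fun a => G.seqForm π ⟨s, a⟩ / G.atParent (G.seqForm π) s) = π s := by
  funext a
  rw [G.atParent_seqForm, seqForm, mul_div_cancel_left₀ _ (G.ownReach_pos hπ s).ne']

theorem dilatedReg_seqForm (reg : Reg) (α : S → ℝ) (i : Fin 2) {π : (s : S) → A s → ℝ}
    (hπ : ∀ s a, 0 < π s a) : G.dilatedReg reg α i (G.seqForm π) = G.treeReg reg α i π := by
  refine Finset.sum_congr rfl fun s _ => ?_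
  rw [G.seqForm_div_atParent hπ, G.atParent_seqForm]

theorem playerValue_sub {π π' : (s : S) → A s → ℝ} (hπ : ∀ s a, 0 < π s a) {i : Fin 2}
    (h : ∀ s, G.player s ≠ i → π' s = π s) :
    G.playerValue i π' - G.playerValue i π = ∑ x : Σ s, A s, if G.player x.1 = i then
      G.ownReach π' x.1 * (π' x.1 x.2 - π x.1 x.2) * G.cfValue π x.1 x.2 else 0 := by
  have h1 : ∀ x : Σ s, A s, (if G.player x.1 = i then
      G.ownReach π' x.1 * (π' x.1 x.2 - π x.1 x.2) * G.cfValue π x.1 x.2 else 0) =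
      (G.leaves.map fun z => z.1.chance * z.1.reach G.player π (1 - i) * payoffOf i z.2 *
        if x ∈ z.1.path.filter (fun x => G.player x.1 = i) then
          G.ownReach π' x.1 * (π' x.1 x.2 - π x.1 x.2) *
            (z.1.reach G.player π i / G.seqForm π x) else 0).sum := by
    rintro ⟨s, a⟩
    by_cases hs : G.player s = i
    · subst hs
      rw [if_pos rfl, cfValue, sum_map_filter_ite, ← Multiset.sum_map_mul_left]
      refine congrArg Multiset.sum (Multiset.map_congr rfl fun z _ => ?_)
      by_cases hz : (⟨s, a⟩ : Σ s, A s) ∈ z.1.path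
      · rw [if_pos hz, if_pos (List.mem_filter.2 ⟨hz, by simp⟩)]
        ring
      · rw [if_neg hz, if_neg fun h' => hz (List.mem_filter.1 h').1]
        simp
    · rw [if_neg hs]
      symm
      refine Multiset.sum_eq_zero fun r hr => ?_
      obtain ⟨z, -, rfl⟩ := Multiset.mem_map.1 hr
      rw [if_neg fun h' => hs (by simpa using (List.mem_filter.1 h').2), mul_zero]
  rw [Finset.sum_congr rfl fun x _ => h1 x, finset_sum_multiset_comm, playerValue, playerValue,
    ← Multiset.sum_map_sub]
  refine congrArg Multiset.sum (Multiset.map_congr rfl fun z hz => ?_)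
  rw [← Finset.mul_sum]
  have h2 := (G.ownPath_filter (G.along_of_mem_leaves hz) i).pathProd_sub hπ π'
  rw [G.reach_congr (π := π') (π' := π) (i := 1 - i) fun s hs =>
    h s (by rw [hs]; exact (ne_one_sub i).symm)]
  simp only [reach_eq_pathProd] at h2 ⊢
  rw [← h2]
  ring

theorem treeReg_sub (reg : Reg) (α : S → ℝ) {π π' : (s : S) → A s → ℝ}
    (hπ : ∀ s a, 0 < π s a) (i : Fin 2) :
    G.treeReg reg α i π' - G.treeReg reg α i π =
      ∑ s ∈ univ.filter (fun s => G.player s = i),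
        G.ownReach π' s * (reg.psi (α s) (π' s) - reg.psi (α s) (π s)) +
      ∑ x : Σ s, A s, if G.player x.1 = i then
        G.ownReach π' x.1 * (π' x.1 x.2 - π x.1 x.2) * G.futureReg reg α π x.1 x.2 else 0 := by
  have h1 : ∀ x : Σ s, A s, (if G.player x.1 = i then
      G.ownReach π' x.1 * (π' x.1 x.2 - π x.1 x.2) * G.futureReg reg α π x.1 x.2 else 0) =
      ∑ s ∈ univ.filter (fun s => G.player s = i), if x ∈ G.ownSeq s then
        G.ownReach π' x.1 * (π' x.1 x.2 - π x.1 x.2) * (G.ownReach π s / G.seqForm π x) *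
          reg.psi (α s) (π s) else 0 := by
    rintro ⟨s, a⟩
    by_cases hs : G.player s = i
    · rw [if_pos hs, futureReg, Finset.sum_filter, Finset.sum_filter, Finset.mul_sum]
      refine Finset.sum_congr rfl fun s' _ => ?_
      by_cases hz : (⟨s, a⟩ : Σ s, A s) ∈ G.ownSeq s'
      · have : G.player s' = i := (G.player_of_mem_ownSeq hz).symm.trans hs
        rw [if_pos hz, if_pos this, if_pos hz]; ring
      · simp [hz]
    · rw [if_neg hs]
      symm
      refine Finset.sum_eq_zero fun s' hs' => if_neg fun h' => hs ?_
      exact (G.player_of_mem_ownSeq h').trans (Finset.mem_filter.1 hs').2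
  rw [Finset.sum_congr rfl fun x _ => h1 x, Finset.sum_comm, ← Finset.sum_add_distrib, treeReg,
    treeReg, ← Finset.sum_sub_distrib]
  refine Finset.sum_congr rfl fun s _ => ?_
  have h2 := (G.ownPath_ownSeq s).pathProd_sub hπ π'
  have h3 : ∀ x : Σ s, A s, (if x ∈ G.ownSeq s then
        G.ownReach π' x.1 * (π' x.1 x.2 - π x.1 x.2) * (G.ownReach π s / G.seqForm π x) *
          reg.psi (α s) (π s) else 0) = (if x ∈ G.ownSeq s then
        G.ownReach π' x.1 * (π' x.1 x.2 - π x.1 x.2) * (G.ownReach π s / G.seqForm π x) else 0) *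
          reg.psi (α s) (π s) := fun x => by split_ifs <;> simp
  rw [Finset.sum_congr rfl fun x _ => h3 x, ← Finset.sum_mul]
  simp only [ownReach_eq] at h2 ⊢
  rw [← h2]
  ring

/-- The difference of the regularized values of two strategies of a player, expressed through the
counterfactual values of one of them. -/
theorem performance_difference (reg : Reg) (α : S → ℝ) (τ : ℝ) {π π' : (s : S) → A s → ℝ}
    (hπ : ∀ s a, 0 < π s a) {i : Fin 2} (h : ∀ s, G.player s ≠ i → π' s = π s) :
    (G.playerValue i π' - G.playerValue i π)
        - τ * (G.treeReg reg α i π' - G.treeReg reg α i π) =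
      ∑ s ∈ univ.filter (fun s => G.player s = i), G.ownReach π' s *
        (∑ a, G.regCfValue reg α τ π s a * (π' s a - π s a)
          - τ * (reg.psi (α s) (π' s) - reg.psi (α s) (π s))) := by
  rw [G.playerValue_sub hπ h, G.treeReg_sub reg α hπ i, Fintype.sum_sigma, Fintype.sum_sigma]
  have e : ∀ g : (s : S) → A s → ℝ, ∑ s, ∑ a, (if G.player s = i then g s a else 0) =
      ∑ s ∈ univ.filter (fun s => G.player s = i), ∑ a, g s a := by
    intro g
    rw [Finset.sum_filter]
    exact Finset.sum_congr rfl fun s _ => by split_ifs <;> simp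
  dsimp only
  rw [e, e, mul_add, Finset.mul_sum, Finset.mul_sum, ← Finset.sum_add_distrib,
    ← Finset.sum_sub_distrib]
  refine Finset.sum_congr rfl fun s _ => ?_
  rw [add_comm, ← sub_sub, Finset.mul_sum, ← Finset.sum_sub_distrib,
    mul_sub _ (∑ a, G.regCfValue reg α τ π s a * (π' s a - π s a)), Finset.mul_sum]
  congr 1
  · exact Finset.sum_congr rfl fun a _ => by rw [regCfValue]; ring
  · ring

theorem Feasible.ite {γs : S → ℝ} {ν π π' : (s : S) → A s → ℝ} (h : Feasible γs ν π)
    (h' : Feasible γs ν π') (p : S → Prop) [DecidablePred p] :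
    Feasible γs ν (fun s => if p s then π s else π' s) := by
  intro s
  by_cases hp : p s
  · simpa [hp] using h s
  · simpa [hp] using h' s

/-- No feasible profile has a negative total regret against an equilibrium. -/
theorem IsRegNE.regret_nonneg {reg : Reg} {α : S → ℝ} {τ : ℝ} {γs : S → ℝ}
    {ν πs π : (s : S) → A s → ℝ} (hs : G.IsRegNE reg α τ γs ν πs) (hπ : Feasible γs ν π)
    (hγs : ∀ s, 0 < γs s) (hνpos : ∀ s a, 0 < ν s a) :
    0 ≤ ∑ s, G.ownReach πs s *
        (∑ a, G.regCfValue reg α τ π s a * (πs s a - π s a)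
          - τ * (reg.psi (α s) (πs s) - reg.psi (α s) (π s))) := by
  have hfin : ∀ p : Fin 2, ¬ p = 0 ↔ p = 1 := by decide
  have hpos := hπ.pos hγs hνpos
  set π₀ : (s : S) → A s → ℝ := fun s => if G.player s = 0 then πs s else π s with hπ₀
  set π₁ : (s : S) → A s → ℝ := fun s => if G.player s = 1 then πs s else π s with hπ₁
  have hf0 : Feasible γs ν π₀ := hs.1.ite hπ _
  have hf1 : Feasible γs ν π₁ := hs.1.ite hπ _
  have h1 := (hs.2.1 π₁ hf1 fun s h => by simp [hπ₁, h]).trans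
    (hs.2.2 π₀ hf0 fun s h => by simp [hπ₀, h])
  simp only [regObjective, G.dilatedReg_seqForm reg α _ (hf0.pos hγs hνpos),
    G.dilatedReg_seqForm reg α _ (hf1.pos hγs hνpos)] at h1
  have d0 := G.performance_difference reg α τ (π' := π₀) hpos (i := 0)
    fun s h => by simp [hπ₀, h]
  have d1 := G.performance_difference reg α τ (π' := π₁) hpos (i := 1)
    fun s h => by simp [hπ₁, h]
  rw [playerValue_zero, playerValue_zero] at d0
  rw [playerValue_one, playerValue_one] at d1
  have r0 : G.treeReg reg α 0 π₁ = G.treeReg reg α 0 π :=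
    G.treeReg_congr reg α fun s h => by simp [hπ₁, h]
  have r1 : G.treeReg reg α 1 π₀ = G.treeReg reg α 1 π :=
    G.treeReg_congr reg α fun s h => by simp [hπ₀, h]
  rw [r0, r1] at h1
  rw [← Finset.sum_filter_add_sum_filter_not univ (fun s => G.player s = 0)]
  simp only [hfin]
  have e0 : ∀ i : Fin 2, ∀ πi : (s : S) → A s → ℝ, (∀ s, G.player s = i → πi s = πs s) →
      ∑ s ∈ univ.filter (fun s => G.player s = i), G.ownReach πi s *
        (∑ a, G.regCfValue reg α τ π s a * (πi s a - π s a)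
          - τ * (reg.psi (α s) (πi s) - reg.psi (α s) (π s))) =
      ∑ s ∈ univ.filter (fun s => G.player s = i), G.ownReach πs s *
        (∑ a, G.regCfValue reg α τ π s a * (πs s a - π s a)
          - τ * (reg.psi (α s) (πs s) - reg.psi (α s) (π s))) := by
    intro i πi hi
    refine Finset.sum_congr rfl fun s hsi => ?_
    have hsi' : G.player s = i := (Finset.mem_filter.1 hsi).2
    rw [G.ownReach_congr fun s' h' => hi s' (h'.trans hsi'), hi s hsi']
  rw [e0 0 π₀ fun s h => by simp [hπ₀, h]] at d0
  rw [e0 1 π₁ fun s h => by simp [hπ₁, h]] at d1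
  rw [← d0, ← d1]
  linarith

/-- The Bregman divergence of the dilated regularizer is the sum of the local ones, weighted by
the reach probabilities: each summand of the regularizer is a perspective `r * psi (x / r)`, and
its divergence at `(x, r)`, `(y, r')` is `r` times that of `psi` at `x / r`, `y / r'`. -/
theorem bregman_dilatedRegTotal (reg : Reg) (α : S → ℝ) {π π' : (s : S) → A s → ℝ}
    (hπ : ∀ s a, 0 < π s a) (hπ' : ∀ s a, 0 < π' s a) :
    bregman (G.dilatedRegTotal reg α) (G.seqForm π') (G.seqForm π) =
      ∑ s, G.ownReach π' s * bregman (reg.psi (α s)) (π' s) (π s) := by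
  have hfin : ∀ p : Fin 2, ¬ p = 0 ↔ p = 1 := by decide
  have hsum : G.dilatedRegTotal reg α = fun x => ∑ s,
      G.atParent x s * reg.psi (α s) (fun a => x ⟨s, a⟩ / G.atParent x s) := by
    funext x
    rw [dilatedRegTotal, dilatedReg, dilatedReg,
      ← Finset.sum_filter_add_sum_filter_not univ (fun s => G.player s = 0)]
    simp only [hfin]
  set y := G.seqForm π with hy
  -- the derivative of the entry at the parent sequence
  let P : S → ((Σ s, A s) → ℝ) →L[ℝ] ℝ := fun s =>
    (G.parentSeq s).elim 0 (fun x => ContinuousLinearMap.proj x)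
  have hP : ∀ s, HasFDerivAt (fun x => G.atParent x s) (P s) y := by
    intro s
    simp only [atParent, P]
    cases G.parentSeq s with
    | none => exact hasFDerivAt_const _ _
    | some x => exact hasFDerivAt_apply x y
  have hPsub : ∀ s x, P s (x - y) = G.atParent x s - G.atParent y s := by
    intro s x
    simp only [atParent, P]
    cases G.parentSeq s <;> simp
  have hp : ∀ s, 0 < G.atParent y s := fun s => by
    rw [hy, G.atParent_seqForm]; exact G.ownReach_pos hπ s
  have hq : ∀ s a, HasFDerivAt (fun x : (Σ s, A s) → ℝ => x ⟨s, a⟩ / G.atParent x s)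
      ((G.atParent y s)⁻¹ • (ContinuousLinearMap.proj (⟨s, a⟩ : Σ s, A s) -
        π s a • P s)) y := by
    intro s a
    have h0 : HasFDerivAt (fun x : (Σ s, A s) → ℝ => x ⟨s, a⟩)
      (ContinuousLinearMap.proj (R := ℝ) (⟨s, a⟩ : Σ s, A s)) y := hasFDerivAt_apply _ y
    have h0' : HasFDerivAt (fun x => (G.atParent x s)⁻¹) (-(G.atParent y s ^ 2)⁻¹ • P s) y :=
      HasDerivAt.comp_hasFDerivAt (f := fun x => G.atParent x s) y (hasDerivAt_inv (hp s).ne')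
        (hP s)
    have h1 := h0.fun_mul h0'
    refine (h1.congr_fderiv ?_)
    have e : π s a = y ⟨s, a⟩ / G.atParent y s := by
      rw [hy, ← congrFun (G.seqForm_div_atParent hπ s) a]
    ext v
    simp only [e, add_apply, smul_apply, sub_apply, smul_eq_mul, ContinuousLinearMap.proj_apply]
    have := (hp s).ne'
    field_simp
    ring
  have hterm : ∀ s, HasFDerivAt (fun x : (Σ s, A s) → ℝ =>
      G.atParent x s * reg.psi (α s) (fun a => x ⟨s, a⟩ / G.atParent x s))
      (reg.psi (α s) (π s) • P s + ∑ a, reg.grad (α s) (π s) a •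
        (ContinuousLinearMap.proj (⟨s, a⟩ : Σ s, A s) - π s a • P s)) y := by
    intro s
    have h1 : HasFDerivAt (fun (x : (Σ s, A s) → ℝ) a => x ⟨s, a⟩ / G.atParent x s)
      (ContinuousLinearMap.pi fun a => (G.atParent y s)⁻¹ •
        (ContinuousLinearMap.proj (⟨s, a⟩ : Σ s, A s) - π s a • P s)) y :=
      hasFDerivAt_pi.2 fun a => hq s a
    have h2 : HasFDerivAt (reg.psi (α s)) (∑ a, reg.grad (α s) (π s) a •
        (ContinuousLinearMap.proj a : (A s → ℝ) →L[ℝ] ℝ))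
        (fun a => y ⟨s, a⟩ / G.atParent y s) := by
      rw [hy, G.seqForm_div_atParent hπ s]
      exact reg.hasFDerivAt_psi (α s) (hπ s)
    have h3 := (hP s).fun_mul (h2.comp y h1)
    refine h3.congr_fderiv ?_
    ext v
    have e : (fun a => y ⟨s, a⟩ / G.atParent y s) = π s := by
      rw [hy, G.seqForm_div_atParent hπ s]
    have := (hp s).ne'
    simp only [add_apply, smul_apply, sub_apply, _root_.sum_apply, smul_eq_mul, e,
      ContinuousLinearMap.proj_apply, ContinuousLinearMap.comp_apply, Function.comp,
      ContinuousLinearMap.pi_apply, Finset.mul_sum]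
    rw [add_comm]
    congr 1
    refine Finset.sum_congr rfl fun a _ => ?_
    field_simp
  have hD := HasFDerivAt.fun_sum fun s (_ : s ∈ (univ : Finset S)) => hterm s
  rw [hsum, bregman, hD.fderiv]
  simp only [_root_.sum_apply, ← Finset.sum_sub_distrib]
  refine Finset.sum_congr rfl fun s _ => ?_
  rw [G.seqForm_div_atParent hπ' s, hy, G.seqForm_div_atParent hπ s, ← hy,
    Reg.bregman_psi _ _ _ (hπ s)]
  simp only [add_apply, smul_apply, sub_apply, _root_.sum_apply, smul_eq_mul,
    ContinuousLinearMap.proj_apply, Pi.sub_apply, hPsub]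
  rw [hy, G.atParent_seqForm, G.atParent_seqForm]
  have : ∑ a, reg.grad (α s) (π s) a * (G.seqForm π' ⟨s, a⟩ - G.seqForm π ⟨s, a⟩ -
      π s a * (G.ownReach π' s - G.ownReach π s)) =
      G.ownReach π' s * ∑ a, reg.grad (α s) (π s) a * (π' s a - π s a) := by
    rw [Finset.mul_sum]
    refine Finset.sum_congr rfl fun a _ => ?_
    simp only [seqForm]; ring
  rw [this]
  ring

end EFG

/-! ### Stability of the scaling of the feedback -/

namespace EFG

variable {S : Type u} {A : S → Type v} [Fintype S] [DecidableEq S] [∀ s, Fintype (A s)]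
  [∀ s, DecidableEq (A s)] (G : EFG S A)

/-- The standing assumptions on the parameters and the run. `Q` is any upper bound of the
feedback. -/
structure Admissible (fb : Feedback) (reg : Reg) (α : S → ℝ) (τ : ℝ) (γs : S → ℝ)
    (ν : (s : S) → A s → ℝ) (γ : ℝ) (η : S → ℝ) (T : ℕ) (π πbar : ℕ → (s : S) → A s → ℝ)
    (Q : ℝ) : Prop where
  alpha_pos : ∀ s, 0 < α s
  tau_pos : 0 < τ
  gammas_pos : ∀ s, 0 < γs s
  nu_pos : ∀ s a, 0 < ν s a
  gamma_pos : 0 < γ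
  gamma_le : ∀ π, Feasible γs ν π → ∀ x : Σ s, A s, γ ≤ G.seqForm π x
  eta_pos : ∀ s, 0 < η s
  run : G.IsLazyQFR fb reg α τ γs ν η T π πbar
  bound_nonneg : 0 ≤ Q
  feedback_le : ∀ t, 1 ≤ t → t ≤ T → ∀ s a, |G.feedback fb reg α τ (π t) s a| ≤ Q

namespace Admissible

variable {G} {fb : Feedback} {reg : Reg} {α : S → ℝ} {τ : ℝ} {γs : S → ℝ}
    {ν : (s : S) → A s → ℝ} {γ : ℝ} {η : S → ℝ} {T : ℕ} {π πbar : ℕ → (s : S) → A s → ℝ}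
    {Q : ℝ} (H : G.Admissible fb reg α τ γs ν γ η T π πbar Q)
include H

theorem bar_one : πbar 1 = π 1 := by
  funext s a; rw [H.run.init, H.run.init_bar]

theorem feasible {t : ℕ} (h1 : 1 ≤ t) (hT : t ≤ T) : Feasible γs ν (π t) := by
  rcases h1.eq_or_lt with rfl | h1
  · exact H.run.init_feasible
  · exact H.run.step_mem t h1 hT

theorem feasible_bar {t : ℕ} (h1 : 1 ≤ t) (hT : t ≤ T + 1) : Feasible γs ν (πbar t) := by
  rcases h1.eq_or_lt with rfl | h1
  · rw [H.bar_one]; exact H.run.init_feasible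
  · obtain ⟨t, rfl⟩ := Nat.exists_eq_add_of_lt h1
    exact H.run.step_bar_mem (1 + t) (by omega) (by omega)

theorem pos {ρ : (s : S) → A s → ℝ} (hρ : Feasible γs ν ρ) (s : S) (a : A s) : 0 < ρ s a :=
  hρ.pos H.gammas_pos H.nu_pos s a

theorem nonempty (s : S) : Nonempty (A s) := by
  by_contra h
  rw [not_nonempty_iff] at h
  simpa using H.run.init_feasible.sum_eq_one s

theorem gamma_le_apply {ρ : (s : S) → A s → ℝ} (hρ : Feasible γs ν ρ) (s : S) (a : A s) :
    γ ≤ ρ s a :=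
  (H.gamma_le ρ hρ ⟨s, a⟩).trans (hρ.seqForm_le ⟨s, a⟩)

theorem gamma_le_one (s : S) : γ ≤ 1 := by
  obtain ⟨a⟩ := H.nonempty s
  exact (H.gamma_le_apply H.run.init_feasible s a).trans (H.run.init_feasible.le_one s a)

theorem gamma_le_pathProd {ρ : (s : S) → A s → ℝ} (hρ : Feasible γs ν ρ) (s : S)
    {l : List (Σ s, A s)} (hl : G.OwnPath l) : γ ≤ pathProd ρ l :=
  hl.le_pathProd (H.gamma_le_one s) (H.gamma_le ρ hρ)

theorem log_nonneg (s : S) : 0 ≤ Real.log (1 / γ) :=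
  Real.log_nonneg (one_le_one_div H.gamma_pos (H.gamma_le_one s))

omit H in
theorem sum_chance_pos (s : S) : 0 < ((G.nodes s).map (fun h => h.chance)).sum := by
  obtain ⟨h, hh⟩ := G.infoset_nonempty s
  obtain ⟨m, hm⟩ := Multiset.exists_cons_of_mem (show h ∈ G.nodes s from hh)
  rw [hm, Multiset.map_cons, Multiset.sum_cons]
  refine add_pos_of_pos_of_nonneg (G.chance_pos_of_mem_nodes hh) (Multiset.sum_nonneg ?_)
  intro r hr
  obtain ⟨h', hh', rfl⟩ := Multiset.mem_map.1 hr
  exact (G.chance_pos_of_mem_nodes (s := s) (by rw [hm]; exact Multiset.mem_cons_of_mem hh')).le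

theorem M₁_pos (s : S) : 0 < G.M₁ fb γ := by
  cases fb with
  | counterfactual => exact one_pos
  | trajectoryQ => exact one_pos
  | qValue =>
    have : Nonempty S := ⟨s⟩
    refine mul_pos H.gamma_pos ?_
    obtain ⟨s', hs'⟩ := exists_eq_ciInf_of_finite
      (f := fun s => ((G.nodes s).map (fun h => h.chance)).sum)
    rw [← hs']
    exact sum_chance_pos s'

theorem M₁_le_scale {ρ : (s : S) → A s → ℝ} (hρ : Feasible γs ν ρ) (s : S) :
    G.M₁ fb γ ≤ G.scale fb ρ s := by
  cases fb with
  | counterfactual => exact le_rfl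
  | trajectoryQ =>
    exact one_le_one_div (G.ownReach_pos (H.pos hρ) s)
      (pathProd_le_one hρ.nonneg hρ.le_one _)
  | qValue =>
    have h1 : (⨅ s, ((G.nodes s).map (fun h => h.chance)).sum) ≤
        ((G.nodes s).map (fun h => h.chance)).sum :=
      ciInf_le (Set.finite_range _).bddBelow s
    refine (mul_le_mul_of_nonneg_left h1 H.gamma_pos.le).trans ?_
    rw [← Multiset.sum_map_mul_left]
    refine Multiset.sum_map_le_sum_map _ _ fun h hh => ?_
    rw [mul_comm]
    exact mul_le_mul_of_nonneg_left
      (H.gamma_le_pathProd hρ s (G.ownPath_filter (G.along_of_mem_nodes hh) _))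
      (G.chance_pos_of_mem_nodes hh).le

theorem scale_pos {ρ : (s : S) → A s → ℝ} (hρ : Feasible γs ν ρ) (s : S) :
    0 < G.scale fb ρ s := (H.M₁_pos s).trans_le (H.M₁_le_scale hρ s)

theorem scale_le_M₂ {ρ : (s : S) → A s → ℝ} (hρ : Feasible γs ν ρ) (s : S) :
    G.scale fb ρ s ≤ fb.M₂ γ := by
  cases fb with
  | counterfactual => exact le_rfl
  | trajectoryQ =>
    exact one_div_le_one_div_of_le H.gamma_pos (H.gamma_le_pathProd hρ s (G.ownPath_ownSeq s))
  | qValue => exact G.oppReach_le_one hρ s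

/-- The feedback times its scaling is the counterfactual value. -/
theorem scale_mul_feedback {ρ : (s : S) → A s → ℝ} (hρ : Feasible γs ν ρ) (s : S) (a : A s) :
    G.scale fb ρ s * G.feedback fb reg α τ ρ s a = G.regCfValue reg α τ ρ s a := by
  have hm := (H.scale_pos hρ s).ne'
  cases fb with
  | counterfactual => simp [scale, feedback]
  | trajectoryQ =>
    have := (G.ownReach_pos (H.pos hρ) s).ne'
    simp only [scale, feedback]
    field_simp
  | qValue =>
    simp only [scale] at hm
    simp only [scale, feedback]
    field_simp

theorem tau_div_scale_le {ρ : (s : S) → A s → ℝ} (hρ : Feasible γs ν ρ) (s : S) :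
    τ / G.scale fb ρ s ≤ τ / G.M₁ fb γ :=
  div_le_div_of_nonneg_left H.tau_pos.le (H.M₁_pos s) (H.M₁_le_scale hρ s)

theorem cent_term_nonneg (s : S) : 0 ≤ 2 * Q / α s + τ / G.M₁ fb γ * Real.log (1 / γ) := by
  have h1 := H.bound_nonneg
  have h2 := H.alpha_pos s
  have h3 := H.tau_pos
  have h4 := H.M₁_pos s
  have h5 := H.log_nonneg s
  positivity

omit H in
theorem cent_term_le (s : S) :
    2 * Q / α s + τ / G.M₁ fb γ * Real.log (1 / γ) ≤ G.Cent fb α τ γ Q :=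
  le_ciSup (f := fun s => 2 * Q / α s + τ / G.M₁ fb γ * Real.log (1 / γ))
    (Set.finite_range _).bddAbove s

theorem Cent_nonneg : 0 ≤ G.Cent fb α τ γ Q := Real.iSup_nonneg H.cent_term_nonneg

theorem Cdiff_nonneg (s : S) : 0 ≤ G.Cdiff fb reg α τ γ Q s := by
  have h1 := H.bound_nonneg
  have h2 := H.alpha_pos s
  have h3 := H.tau_pos
  have h4 := H.M₁_pos s
  have h5 := H.log_nonneg s
  cases reg <;> simp only [Cdiff] <;> positivity

omit H in
theorem Cdiff_le (s : S) :
    G.Cdiff fb reg α τ γ Q s ≤ ⨆ s', G.Cdiff fb reg α τ γ Q s' :=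
  le_ciSup (f := fun s => G.Cdiff fb reg α τ γ Q s) (Set.finite_range _).bddAbove s

theorem iSup_Cdiff_nonneg : 0 ≤ ⨆ s', G.Cdiff fb reg α τ γ Q s' :=
  Real.iSup_nonneg H.Cdiff_nonneg

theorem abs_log_sub_le (he : reg = .entropy) {t : ℕ} (h1 : 1 ≤ t) (hT : t ≤ T) (s : S)
    {c y : A s → ℝ}
    (hc : c ∈ perturbedSimplex (γs s) (ν s)) (hy : y ∈ perturbedSimplex (γs s) (ν s))
    (hy0 : ∀ a, γ ≤ y a) (hc0 : ∀ a, 0 < c a)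
    (hmin : IsMinOn (G.stepObjective fb reg α τ η (π t) s c)
      (perturbedSimplex (γs s) (ν s)) y) (a : A s) :
    |Real.log (y a) - Real.log (c a)| ≤ η s * G.Cent fb α τ γ Q := by
  subst he
  have hρ := H.feasible h1 hT
  refine (prox_entropy_abs_log_sub_le (H.alpha_pos s)
    (div_pos H.tau_pos (H.scale_pos hρ s)).le (H.eta_pos s) H.gamma_pos
    (fun a => (mul_pos (H.gammas_pos s) (H.nu_pos s a)).le) (H.feedback_le t h1 hT s)
    hy hc hy0 hc0 hmin a).trans ?_
  refine mul_le_mul_of_nonneg_left ((add_le_add_right ?_ _).trans (cent_term_le s))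
    (H.eta_pos s).le
  exact mul_le_mul_of_nonneg_right (H.tau_div_scale_le hρ s) (H.log_nonneg s)

theorem abs_sub_le (he : reg = .euclidean) {t : ℕ} (h1 : 1 ≤ t) (hT : t ≤ T) (s : S)
    {c y : A s → ℝ}
    (hc : c ∈ perturbedSimplex (γs s) (ν s)) (hy : y ∈ perturbedSimplex (γs s) (ν s))
    (hy0 : ∀ a, 0 < y a) (hc0 : ∀ a, 0 < c a)
    (hmin : IsMinOn (G.stepObjective fb reg α τ η (π t) s c)
      (perturbedSimplex (γs s) (ν s)) y) (a : A s) :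
    |y a - c a| ≤ η s * ⨆ s', G.Cdiff fb reg α τ γ Q s' := by
  refine le_trans ?_ (mul_le_mul_of_nonneg_left (Cdiff_le s) (H.eta_pos s).le)
  subst he
  have hρ := H.feasible h1 hT
  refine (prox_euclidean_abs_sub_le (H.alpha_pos s)
    (div_pos H.tau_pos (H.scale_pos hρ s)).le (H.eta_pos s) (H.feedback_le t h1 hT s)
    hy hc hy0 hc0 hmin a).trans ?_
  refine mul_le_mul_of_nonneg_left (add_le_add_right ?_ _) (H.eta_pos s).le
  rw [mul_div_assoc]
  exact mul_le_mul_of_nonneg_left (H.tau_div_scale_le hρ s) (by positivity)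

/-- Consecutive strategies are at most three proximal steps apart: from `π (t + 1)` to
`πbar (t + 1)`, from there to `πbar t`, and from there to `π t`. -/
theorem dist_consecutive_le {s : S} (f : (A s → ℝ) → ℝ) {R : ℝ} (hR : 0 ≤ R)
    (hf : ∀ t, 1 ≤ t → t ≤ T → ∀ c y, c ∈ perturbedSimplex (γs s) (ν s) →
      y ∈ perturbedSimplex (γs s) (ν s) → (∀ a, γ ≤ y a) → (∀ a, γ ≤ c a) →
      IsMinOn (G.stepObjective fb reg α τ η (π t) s c) (perturbedSimplex (γs s) (ν s)) y →
      |f y - f c| ≤ R) {t : ℕ} (h1 : 1 ≤ t) (hT : t + 1 ≤ T) :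
    |f (π (t + 1) s) - f (π t s)| ≤ 3 * R := by
  have hg {ρ : (s : S) → A s → ℝ} (hρ : Feasible γs ν ρ) := H.gamma_le_apply hρ
  have e1 : |f (π (t + 1) s) - f (πbar (t + 1) s)| ≤ R :=
    hf t h1 (by omega) _ _ (H.feasible_bar (by omega) (by omega) s)
      (H.feasible (by omega) hT s) (hg (H.feasible (by omega) hT) s)
      (hg (H.feasible_bar (by omega) (by omega)) s)
      (by simpa using H.run.step_min (t + 1) (by omega) hT s)
  have e2 : |f (πbar (t + 1) s) - f (πbar t s)| ≤ R :=
    hf t h1 (by omega) _ _ (H.feasible_bar h1 (by omega) s)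
      (H.feasible_bar (by omega) (by omega) s) (hg (H.feasible_bar (by omega) (by omega)) s)
      (hg (H.feasible_bar h1 (by omega)) s) (H.run.step_bar_min t h1 (by omega) s)
  have e3 : |f (π t s) - f (πbar t s)| ≤ R := by
    rcases h1.eq_or_lt with rfl | h2
    · rw [H.bar_one]; simpa using hR
    · exact hf (t - 1) (by omega) (by omega) _ _ (H.feasible_bar h1 (by omega) s)
        (H.feasible h1 (by omega) s) (hg (H.feasible h1 (by omega)) s)
        (hg (H.feasible_bar h1 (by omega)) s) (H.run.step_min t h2 (by omega) s)
  rw [abs_le] at *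
  constructor <;> linarith [e1.1, e1.2, e2.1, e2.2, e3.1, e3.2]

theorem abs_log_consecutive_le (he : reg = .entropy) {t : ℕ} (h1 : 1 ≤ t) (hT : t + 1 ≤ T)
    (s : S) (a : A s) :
    |Real.log (π (t + 1) s a) - Real.log (π t s a)| ≤ 3 * (η s * G.Cent fb α τ γ Q) :=
  H.dist_consecutive_le (fun y => Real.log (y a))
    (mul_nonneg (H.eta_pos s).le H.Cent_nonneg)
    (fun _ h1 hT _ _ hc hy hy0 hc0 hmin => H.abs_log_sub_le he h1 hT s hc hy hy0
      (fun a => H.gamma_pos.trans_le (hc0 a)) hmin a) h1 hT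

theorem abs_consecutive_le (he : reg = .euclidean) {t : ℕ} (h1 : 1 ≤ t) (hT : t + 1 ≤ T)
    (s : S) (a : A s) :
    |π (t + 1) s a - π t s a| ≤ 3 * (η s * ⨆ s', G.Cdiff fb reg α τ γ Q s') :=
  H.dist_consecutive_le (fun y => y a)
    (mul_nonneg (H.eta_pos s).le H.iSup_Cdiff_nonneg)
    (fun _ h1 hT _ _ hc hy hy0 hc0 hmin => H.abs_sub_le he h1 hT s hc hy
      (fun a => H.gamma_pos.trans_le (hy0 a)) (fun a => H.gamma_pos.trans_le (hc0 a)) hmin a) h1 hT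

theorem etaAnc_nonneg (s : S) : 0 ≤ G.etaAnc η s := by
  refine Real.sSup_nonneg ?_
  rintro r ⟨h, -, x, -, rfl⟩
  exact (H.eta_pos _).le

omit H in
theorem le_etaAnc {s : S} {h : Node S A} (hh : h ∈ G.nodes s) {x : Σ s, A s} (hx : x ∈ h.path) :
    η x.1 ≤ G.etaAnc η s := by
  refine le_csSup ((Set.finite_range η).bddAbove.mono ?_) ⟨h, hh, x, hx, rfl⟩
  rintro r ⟨h, -, x, -, rfl⟩
  exact ⟨x.1, rfl⟩

/-- By (A) at the last infoset of player `i` on the path, the learning rates on the path add up to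
at most twice the largest one. -/
theorem sum_eta_le (hA : G.CondA η) {s : S} {h : Node S A} (hh : h ∈ G.nodes s) (i : Fin 2) :
    ((h.path.filter (fun x => G.player x.1 = i)).map (fun x => η x.1)).sum ≤
      2 * G.etaAnc η s := by
  rcases List.eq_nil_or_concat (h.path.filter (fun x => G.player x.1 = i)) with e | ⟨l, x, e⟩
  · rw [e]; simpa using H.etaAnc_nonneg s
  · rw [List.concat_eq_append] at e
    obtain ⟨m₁, m₂, e1, h1, h2⟩ := List.filter_eq_append_iff.1 e
    obtain ⟨n₁, n₂, rfl, h3, h4, h5⟩ := List.filter_eq_cons_iff.1 h2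
    have hx : x ∈ h.path := by rw [e1]; simp
    obtain ⟨h', hm, hp⟩ := G.along_of_mem_nodes hh (m₁ ++ n₁) x n₂ (by rw [e1]; simp)
    have h6 := hA x.1 i h' hm
    rw [hp] at h6
    simp only [Node.root, List.nil_append, List.filter_append] at h6
    rw [List.filter_eq_nil_iff.2 h3, List.append_nil, h1] at h6
    rw [e]
    simp only [List.map_append, List.sum_append, List.map_cons, List.map_nil, List.sum_singleton]
    linarith [le_etaAnc (G := G) (η := η) hh hx]

omit H in
theorem abs_log_pathProd_sub_le {ρ ρ' : (s : S) → A s → ℝ} (hρ : ∀ s a, 0 < ρ s a)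
    (hρ' : ∀ s a, 0 < ρ' s a) {R : ℝ}
    (h : ∀ s a, |Real.log (ρ' s a) - Real.log (ρ s a)| ≤ 3 * (η s * R))
    (l : List (Σ s, A s)) :
    |Real.log (pathProd ρ' l) - Real.log (pathProd ρ l)| ≤
      3 * R * (l.map (fun x => η x.1)).sum := by
  induction l with
  | nil => simp
  | cons x l ih =>
    rw [pathProd_cons, pathProd_cons, Real.log_mul (hρ' _ _).ne' (pathProd_pos hρ' l).ne',
      Real.log_mul (hρ _ _).ne' (pathProd_pos hρ l).ne', List.map_cons, List.sum_cons]
    have h1 := h x.1 x.2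
    rw [abs_le] at *
    constructor <;> linarith [ih.1, ih.2, h1.1, h1.2]

omit H in
theorem abs_pathProd_sub_le {ρ ρ' : (s : S) → A s → ℝ} (hρ : Feasible γs ν ρ)
    (hρ' : Feasible γs ν ρ') {R : ℝ} (h : ∀ s a, |ρ' s a - ρ s a| ≤ 3 * (η s * R))
    (l : List (Σ s, A s)) :
    |pathProd ρ' l - pathProd ρ l| ≤ 3 * R * (l.map (fun x => η x.1)).sum := by
  induction l with
  | nil => simp
  | cons x l ih =>
    rw [pathProd_cons, pathProd_cons, List.map_cons, List.sum_cons]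
    have h1 := h x.1 x.2
    have e : ρ' x.1 x.2 * pathProd ρ' l - ρ x.1 x.2 * pathProd ρ l =
        (ρ' x.1 x.2 - ρ x.1 x.2) * pathProd ρ' l + ρ x.1 x.2 * (pathProd ρ' l - pathProd ρ l) := by
      ring
    have h2 : |(ρ' x.1 x.2 - ρ x.1 x.2) * pathProd ρ' l| ≤ |ρ' x.1 x.2 - ρ x.1 x.2| := by
      rw [abs_mul, abs_of_nonneg (pathProd_nonneg hρ'.nonneg l)]
      exact mul_le_of_le_one_right (abs_nonneg _) (pathProd_le_one hρ'.nonneg hρ'.le_one l)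
    have h3 : |ρ x.1 x.2 * (pathProd ρ' l - pathProd ρ l)| ≤ |pathProd ρ' l - pathProd ρ l| := by
      rw [abs_mul, abs_of_nonneg (hρ.nonneg _ _)]
      exact mul_le_of_le_one_left (abs_nonneg _) (hρ.le_one _ _)
    rw [e]
    refine (abs_add_le _ _).trans ?_
    linarith

/-- Entropic stability of the reach probabilities of a player; it is symmetric in the two
profiles because the estimate of the logarithms is. -/
theorem reach_entropy (he : reg = .entropy) (hA : G.CondA η) (hB : G.CondB fb α τ γ Q η)
    {t : ℕ} (h1 : 1 ≤ t) (hT : t + 1 ≤ T) {s : S} {h : Node S A} (hh : h ∈ G.nodes s)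
    (i : Fin 2) :
    |h.reach G.player (π (t + 1)) i - h.reach G.player (π t) i| ≤
        12 * G.Cent fb α τ γ Q * G.etaAnc η s * h.reach G.player (π t) i ∧
    |h.reach G.player (π (t + 1)) i - h.reach G.player (π t) i| ≤
        12 * G.Cent fb α τ γ Q * G.etaAnc η s * h.reach G.player (π (t + 1)) i := by
  have hp := H.pos (H.feasible h1 (by omega))
  have hp' := H.pos (H.feasible (t := t + 1) (by omega) hT)
  have key := abs_log_pathProd_sub_le hp hp' (H.abs_log_consecutive_le he h1 hT)
    (h.path.filter (fun x => G.player x.1 = i))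
  have hX := H.Cent_nonneg
  have hsum := mul_le_mul_of_nonneg_left (H.sum_eta_le hA hh i)
    (by positivity : 0 ≤ 3 * G.Cent fb α τ γ Q)
  have hB' := hB s
  have hE := H.etaAnc_nonneg s
  have main : ∀ P P' : ℝ, 0 < P → 0 < P' →
      |Real.log P' - Real.log P| ≤ 6 * G.etaAnc η s * G.Cent fb α τ γ Q →
      |P' - P| ≤ 12 * G.Cent fb α τ γ Q * G.etaAnc η s * P := by
    intro P P' hP hP' hl
    have e : P' = P * Real.exp (Real.log P' - Real.log P) := by
      rw [Real.exp_sub, Real.exp_log hP, Real.exp_log hP']; field_simp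
    have h2 := Real.abs_exp_sub_one_le (hl.trans hB')
    have e2 : P' - P = P * (Real.exp (Real.log P' - Real.log P) - 1) := by
      rw [mul_sub, ← e, mul_one]
    rw [e2, abs_mul, abs_of_pos hP, mul_comm]
    refine mul_le_mul_of_nonneg_right ?_ hP.le
    linarith
  have hl := key.trans hsum
  simp only [reach_eq_pathProd]
  refine ⟨main _ _ (pathProd_pos hp _) (pathProd_pos hp' _) (hl.trans_eq (by ring)), ?_⟩
  rw [abs_sub_comm] at hl ⊢
  exact main _ _ (pathProd_pos hp' _) (pathProd_pos hp _) (hl.trans_eq (by ring))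

/-- Euclidean stability of the reach probabilities of a player. -/
theorem reach_euclidean (he : reg = .euclidean) (hA : G.CondA η)
    {t : ℕ} (h1 : 1 ≤ t) (hT : t + 1 ≤ T) {s : S} {h : Node S A} (hh : h ∈ G.nodes s)
    (i : Fin 2) :
    |h.reach G.player (π (t + 1)) i - h.reach G.player (π t) i| ≤
        6 * (⨆ s', G.Cdiff fb reg α τ γ Q s') * G.etaAnc η s := by
  have key := abs_pathProd_sub_le (H.feasible h1 (by omega)) (H.feasible (t := t + 1) (by omega) hT)
    (H.abs_consecutive_le he h1 hT) (h.path.filter (fun x => G.player x.1 = i))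
  have hY := H.iSup_Cdiff_nonneg
  have hsum := mul_le_mul_of_nonneg_left (H.sum_eta_le hA hh i)
    (by positivity : 0 ≤ 3 * ⨆ s', G.Cdiff fb reg α τ γ Q s')
  exact (key.trans hsum).trans_eq (by ring)

omit H in
theorem exists_node_reach (s : S) : ∃ h ∈ G.nodes s, ∀ ρ : (s : S) → A s → ℝ,
    G.ownReach ρ s = h.reach G.player ρ (G.player s) :=
  ⟨_, (G.infoset_nonempty s).choose_spec, fun _ => rfl⟩

omit H in
theorem abs_oppReach_sub_le {s : S} {ρ ρ' : (s : S) → A s → ℝ} (f : Node S A → ℝ)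
    (h : ∀ h ∈ G.nodes s, |h.reach G.player ρ' (1 - G.player s) -
      h.reach G.player ρ (1 - G.player s)| ≤ f h) :
    |G.oppReach ρ' s - G.oppReach ρ s| ≤ ((G.nodes s).map fun h => h.chance * f h).sum := by
  rw [oppReach, oppReach, ← Multiset.sum_map_sub]
  refine Multiset.abs_sum_le_sum_abs.trans ?_
  rw [Multiset.map_map]
  refine Multiset.sum_map_le_sum_map _ _ fun h' hh => ?_
  rw [Function.comp, ← mul_sub, abs_mul, abs_of_pos (G.chance_pos_of_mem_nodes hh)]
  exact mul_le_mul_of_nonneg_left (h h' hh) (G.chance_pos_of_mem_nodes hh).le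

/-- Additive and multiplicative stability of the scaling of the feedback. -/
theorem scale_stable (hA : G.CondA η) (hB : G.CondB fb α τ γ Q η)
    {t : ℕ} (h1 : 1 ≤ t) (hT : t + 1 ≤ T) (s : S) :
    |G.scale fb (π (t + 1)) s - G.scale fb (π t) s| ≤
        G.Cminus fb reg α τ γ Q s * G.etaAnc η s ∧
    |1 - G.scale fb (π (t + 1)) s / G.scale fb (π t) s| ≤
        G.Cslash fb reg α τ γ Q s * G.etaAnc η s := by
  have hf := H.feasible h1 (by omega : t ≤ T)
  have hf' := H.feasible (by omega : 1 ≤ t + 1) hT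
  have hE := H.etaAnc_nonneg s
  have hm := H.scale_pos hf s
  have hm1 := H.M₁_le_scale hf s
  have hM1 := H.M₁_pos s
  have hγ := H.gamma_pos
  have hγ1 := H.gamma_le_one s
  have hX := H.Cent_nonneg
  have hY := H.iSup_Cdiff_nonneg
  -- multiplicative stability from additive stability relative to the scaling
  have hmul : ∀ C, |G.scale fb (π (t + 1)) s - G.scale fb (π t) s| ≤ C * G.scale fb (π t) s →
      |1 - G.scale fb (π (t + 1)) s / G.scale fb (π t) s| ≤ C := by
    intro C hC
    rw [one_sub_div hm.ne', abs_div, abs_of_pos hm, div_le_iff₀ hm, abs_sub_comm]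
    exact hC
  cases fb with
  | counterfactual => simp [scale, Cminus, Cslash]
  | trajectoryQ =>
    obtain ⟨h, hh, hr⟩ := exists_node_reach (G := G) s
    have hP := G.ownReach_pos (H.pos hf) s
    have hP' := G.ownReach_pos (H.pos hf') s
    have hPγ : γ ≤ G.ownReach (π t) s := H.gamma_le_pathProd hf s (G.ownPath_ownSeq s)
    have hPγ' : γ ≤ G.ownReach (π (t + 1)) s := H.gamma_le_pathProd hf' s (G.ownPath_ownSeq s)
    have e : 1 / G.ownReach (π (t + 1)) s - 1 / G.ownReach (π t) s =
        -(G.ownReach (π (t + 1)) s - G.ownReach (π t) s) /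
          (G.ownReach (π (t + 1)) s * G.ownReach (π t) s) := by
      field_simp; ring
    cases reg with
    | entropy =>
      have h2 := (H.reach_entropy rfl hA hB h1 hT hh (G.player s)).2
      rw [← hr, ← hr] at h2
      have h3 : |1 / G.ownReach (π (t + 1)) s - 1 / G.ownReach (π t) s| ≤
          12 * G.Cent .trajectoryQ α τ γ Q * G.etaAnc η s * (1 / G.ownReach (π t) s) := by
        rw [e, abs_div, abs_neg, abs_of_pos (mul_pos hP' hP), div_le_iff₀ (mul_pos hP' hP)]
        refine h2.trans_eq ?_
        field_simp
      refine ⟨h3.trans ?_, hmul _ h3⟩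
      have h4 : 1 / G.ownReach (π t) s ≤ 1 / γ := one_div_le_one_div_of_le hγ hPγ
      refine (mul_le_mul_of_nonneg_left h4 (by positivity)).trans_eq ?_
      simp only [Cminus]; ring
    | euclidean =>
      have h2 := H.reach_euclidean rfl hA h1 hT hh (G.player s)
      rw [← hr, ← hr] at h2
      have h3 : |1 / G.ownReach (π (t + 1)) s - 1 / G.ownReach (π t) s| ≤
          6 / γ ^ 2 * (⨆ s', G.Cdiff .trajectoryQ .euclidean α τ γ Q s') * G.etaAnc η s := by
        rw [e, abs_div, abs_neg, abs_of_pos (mul_pos hP' hP)]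
        refine (div_le_div₀ (by positivity) h2 (by positivity)
          (mul_le_mul hPγ' hPγ hγ.le hP'.le)).trans_eq ?_
        field_simp
      refine ⟨h3, hmul _ (h3.trans ?_)⟩
      have e2 : G.Cslash .trajectoryQ .euclidean α τ γ Q s =
          6 / γ ^ 2 * (⨆ s', G.Cdiff .trajectoryQ .euclidean α τ γ Q s') := by
        simp [Cslash, M₁]
      rw [e2]
      exact le_mul_of_one_le_right (by positivity) hm1
  | qValue =>
    cases reg with
    | entropy =>
      have h2 : |G.oppReach (π (t + 1)) s - G.oppReach (π t) s| ≤
          12 * G.Cent .qValue α τ γ Q * G.etaAnc η s * G.oppReach (π t) s := by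
        refine (abs_oppReach_sub_le _ fun h hh =>
          (H.reach_entropy rfl hA hB h1 hT hh (1 - G.player s)).1).trans_eq ?_
        rw [oppReach, ← Multiset.sum_map_mul_left]
        exact congrArg Multiset.sum (Multiset.map_congr rfl fun h _ => by ring)
      refine ⟨h2.trans ?_, hmul _ h2⟩
      simp only [Cminus, Feedback.M₂, mul_one]
      exact mul_le_of_le_one_right (by positivity) (G.oppReach_le_one hf s)
    | euclidean =>
      have h2 : |G.oppReach (π (t + 1)) s - G.oppReach (π t) s| ≤
          G.Cminus .qValue .euclidean α τ γ Q s * G.etaAnc η s := by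
        refine (abs_oppReach_sub_le _ fun h hh =>
          H.reach_euclidean rfl hA h1 hT hh (1 - G.player s)).trans ?_
        refine (Multiset.sum_le_card_nsmul _
          (6 * (⨆ s', G.Cdiff .qValue .euclidean α τ γ Q s') * G.etaAnc η s) ?_).trans_eq ?_
        · intro r hr
          obtain ⟨h, hh, rfl⟩ := Multiset.mem_map.1 hr
          exact mul_le_of_le_one_left (by positivity) (G.chance_le_one_of_mem_nodes hh)
        · rw [Multiset.card_map, nsmul_eq_mul, Cminus]; ring
      refine ⟨h2, hmul _ (h2.trans ?_)⟩
      have e2 : G.Cminus .qValue .euclidean α τ γ Q s =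
          G.Cslash .qValue .euclidean α τ γ Q s * G.M₁ .qValue γ := by
        simp only [Cminus, Cslash]; field_simp
      have h0 : 0 ≤ G.Cslash .qValue .euclidean α τ γ Q s := by
        simp only [Cslash]; positivity
      rw [e2, mul_right_comm]
      exact mul_le_mul_of_nonneg_left hm1 (mul_nonneg h0 hE)

theorem Cslash_nonneg (s : S) : 0 ≤ G.Cslash fb reg α τ γ Q s := by
  have hM1 := H.M₁_pos s
  have hγ := H.gamma_pos
  have hX := H.Cent_nonneg
  have hY := H.iSup_Cdiff_nonneg
  cases fb <;> cases reg <;> simp only [Cslash, le_refl] <;> positivity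

end Admissible

end EFG

/-! ### The recursion for the local Bregman divergences -/

/-- Summation of a recursion with slowly varying weights: the weights may change by at most half
of the contraction. -/
theorem sum_telescope_le {T : ℕ} {τ η M : ℝ} {m D : ℕ → ℝ} (hη : 0 < η) (hτ : 0 < τ)
    (hM : 0 ≤ M)
    (hD : ∀ t, 1 ≤ t → t ≤ T + 1 → 0 ≤ D t) (hm0 : ∀ t, 1 ≤ t → t ≤ T → 0 ≤ m t ∧ m t ≤ M)
    (hm : ∀ t, 1 ≤ t → t + 1 ≤ T → 2 * |m (t + 1) - m t| ≤ τ * η) :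
    τ / 2 * ∑ t ∈ Finset.Icc 2 T, D t - M / η * D 1 ≤
      ∑ t ∈ Finset.Icc 1 T, (τ * D (t + 1) + m t / η * (D (t + 1) - D t)) := by
  have key : ∀ n, 1 ≤ n → n ≤ T →
      τ / 2 * ∑ t ∈ Finset.Icc 2 n, D t + m n / η * D (n + 1) + τ * D (n + 1) - m 1 / η * D 1 ≤
        ∑ t ∈ Finset.Icc 1 n, (τ * D (t + 1) + m t / η * (D (t + 1) - D t)) := by
    intro n hn
    induction n, hn using Nat.le_induction with
    | base => intro _; simp; linarith
    | succ n hn ih =>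
      intro hnT
      have ih := ih (by omega)
      rw [Finset.sum_Icc_succ_top (by omega), Finset.sum_Icc_succ_top (by omega)]
      have h1 := hm n hn hnT
      have h2 : m (n + 1) / η - m n / η ≤ τ / 2 := by
        rw [← sub_div, div_le_iff₀ hη]
        linarith [le_abs_self (m (n + 1) - m n)]
      have h3 := mul_le_mul_of_nonneg_right h2 (hD (n + 1) (by omega) (by omega))
      linarith
  rcases Nat.eq_zero_or_pos T with rfl | hT
  · have := mul_nonneg (div_nonneg hM hη.le) (hD 1 le_rfl (by omega))
    simpa using this
  · have h1 := key T hT le_rfl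
    have h2 := hD (T + 1) (by omega) le_rfl
    have h3 := hm0 T hT le_rfl
    have h4 : 0 ≤ m T / η * D (T + 1) := mul_nonneg (div_nonneg h3.1 hη.le) h2
    have h5 : m 1 / η * D 1 ≤ M / η * D 1 :=
      mul_le_mul_of_nonneg_right (div_le_div_of_nonneg_right (hm0 1 le_rfl hT).2 hη.le)
        (hD 1 le_rfl (by omega))
    nlinarith

namespace EFG

variable {S : Type u} {A : S → Type v} [Fintype S] [DecidableEq S] [∀ s, Fintype (A s)]
  [∀ s, DecidableEq (A s)]

namespace Admissible

variable {G : EFG S A} {fb : Feedback} {reg : Reg} {α : S → ℝ} {τ : ℝ} {γs : S → ℝ}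
    {ν : (s : S) → A s → ℝ} {γ : ℝ} {η : S → ℝ} {T : ℕ} {π πbar : ℕ → (s : S) → A s → ℝ}
    {Q : ℝ} (H : G.Admissible fb reg α τ γs ν γ η T π πbar Q)
include H

theorem kappa_mul_le (s : S) :
    reg.kappa (A s) / α s * Q ≤ G.Cdiff fb reg α τ γ Q s := by
  have h1 := H.bound_nonneg
  have h2 := H.alpha_pos s
  have h3 := H.tau_pos
  have h4 := H.M₁_pos s
  have h5 := H.log_nonneg s
  cases reg with
  | entropy =>
    simp only [Reg.kappa, Cdiff]
    exact mul_le_mul_of_nonneg_left (le_add_of_nonneg_right (by positivity)) (by positivity)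
  | euclidean =>
    simp only [Reg.kappa, Cdiff]
    exact le_add_of_nonneg_right (by positivity)

/-- The gain of the step `πbar (t + 1)` over `π t`, after the proximal term of `πbar (t + 1)` has
been spent. For `t ≥ 2` the optimality of `π t` replaces the feedback by its change since the
last step; for `t = 1` the uniform strategy minimizes the regularizer. -/
theorem step_gain_le (hA : G.CondA η) (hB : G.CondB fb α τ γ Q η)
    {t : ℕ} (h1 : 1 ≤ t) (hT : t ≤ T) (s : S) :
    ∑ a, G.feedback fb reg α τ (π t) s a * (πbar (t + 1) s a - π t s a)
        + τ / G.scale fb (π t) s * (reg.psi (α s) (π t s) - reg.psi (α s) (πbar (t + 1) s))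
        - 1 / η s * bregman (reg.psi (α s)) (πbar (t + 1) s) (πbar t s) ≤
      2 * Q * G.Cdiff fb reg α τ γ Q s * η s +
        τ / G.scale fb (π t) s * (G.Cslash fb reg α τ γ Q s * G.etaAnc η s *
          |reg.psi (α s) (π t s) - reg.psi (α s) (πbar (t + 1) s)|) := by
  have := H.nonempty s
  have hf := H.feasible h1 hT
  have hfb := H.feasible_bar h1 (by omega)
  have hfb' := H.feasible_bar (t := t + 1) (by omega) (by omega)
  have hη := H.eta_pos s
  have hα := H.alpha_pos s
  have hQ := H.bound_nonneg
  have hm := H.scale_pos hf s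
  have hτ := H.tau_pos
  have hk := H.kappa_mul_le s
  have hκ := reg.kappa_pos (ι := A s)
  have hk2 := mul_le_mul_of_nonneg_left hk (by positivity : 0 ≤ 2 * Q * η s)
  have hk3 : η s * reg.kappa (A s) / (2 * α s) * (2 * Q) ^ 2 =
      2 * Q * η s * (reg.kappa (A s) / α s * Q) := by field_simp
  set d := reg.psi (α s) (π t s) - reg.psi (α s) (πbar (t + 1) s) with hd
  have hS0 : 0 ≤ G.Cslash fb reg α τ γ Q s * G.etaAnc η s * |d| :=
    mul_nonneg (mul_nonneg (H.Cslash_nonneg s) (H.etaAnc_nonneg s)) (abs_nonneg _)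
  rcases h1.eq_or_lt with rfl | h2
  · have hd0 : d ≤ 0 := by
      have e : π 1 s = fun _ => 1 / (Fintype.card (A s) : ℝ) := funext (H.run.init s)
      rw [hd, e, sub_nonpos]
      exact reg.psi_uniform_le hα (H.pos hfb' s) (hfb'.sum_eq_one s)
    have hy := reg.inner_sub_bregman_le (R := 2 * Q) hα hη (x := πbar (1 + 1) s) (y := πbar 1 s)
      (g := G.feedback fb reg α τ (π 1) s)
      (fun a => (H.feedback_le 1 le_rfl hT s a).trans (by linarith)) (H.pos hfb' s) (H.pos hfb s)
      (hfb'.sum_eq_one s) (hfb.sum_eq_one s)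
    rw [hk3, H.bar_one] at hy
    rw [H.bar_one]
    have h3 : τ / G.scale fb (π 1) s * d ≤ 0 :=
      mul_nonpos_of_nonneg_of_nonpos (div_pos hτ hm).le hd0
    have h4 := mul_nonneg (div_pos hτ hm).le hS0
    linarith
  · obtain ⟨t, rfl⟩ : ∃ r, t = r + 1 := ⟨t - 1, by omega⟩
    have hf' := H.feasible (t := t) (by omega) (by omega)
    have hm' := H.scale_pos hf' s
    have hmin := H.run.step_min (t + 1) h2 hT s
    rw [Nat.add_sub_cancel] at hmin
    have h3 := prox_three_point reg (α s) (τ / G.scale fb (π t) s) (1 / η s)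
      (convex_perturbedSimplex (γs s) (ν s)) (hf s) (hfb' s) (H.pos hf s) (H.pos hfb s) hmin
    have hy := reg.inner_sub_bregman_le (R := 2 * Q) hα hη (x := πbar (t + 1 + 1) s)
      (y := π (t + 1) s)
      (g := fun a => G.feedback fb reg α τ (π (t + 1)) s a - G.feedback fb reg α τ (π t) s a)
      (fun a => (abs_sub _ _).trans (by
        linarith [H.feedback_le (t + 1) h1 hT s a,
          H.feedback_le t (by omega) (by omega) s a])) (H.pos hfb' s) (H.pos hf s)
      (hfb'.sum_eq_one s) (hf.sum_eq_one s)
    rw [hk3] at hy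
    simp only [sub_mul, Finset.sum_sub_distrib] at hy
    have hD1 := mul_nonneg (by positivity : 0 ≤ 1 / η s)
      (reg.bregman_nonneg hα (H.pos hf s) (H.pos hfb s) (hf.sum_eq_one s) (hfb.sum_eq_one s))
    have hD2 := mul_nonneg (div_pos hτ hm').le
      (reg.bregman_nonneg hα (H.pos hfb' s) (H.pos hf s) (hfb'.sum_eq_one s) (hf.sum_eq_one s))
    have hst := (H.scale_stable hA hB (by omega : 1 ≤ t) hT s).2
    have h5 : (τ / G.scale fb (π (t + 1)) s - τ / G.scale fb (π t) s) * d ≤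
        τ / G.scale fb (π (t + 1)) s * (G.Cslash fb reg α τ γ Q s * G.etaAnc η s * |d|) := by
      have e : (τ / G.scale fb (π (t + 1)) s - τ / G.scale fb (π t) s) * d =
          τ / G.scale fb (π (t + 1)) s *
            ((1 - G.scale fb (π (t + 1)) s / G.scale fb (π t) s) * d) := by field_simp
      rw [e]
      refine mul_le_mul_of_nonneg_left ((le_abs_self _).trans ?_) (div_pos hτ hm).le
      rw [abs_mul]
      exact mul_le_mul_of_nonneg_right hst (abs_nonneg _)
    rw [sub_mul] at h5
    have h6 : τ / G.scale fb (π t) s * (reg.psi (α s) (πbar (t + 1 + 1) s) -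
        reg.psi (α s) (π (t + 1) s)) = -(τ / G.scale fb (π t) s * d) := by rw [hd]; ring
    rw [add_mul, h6] at h3
    linarith

/-- One step of the recursion for the local Bregman divergence to a feasible profile `πs`. -/
theorem local_recursion (hA : G.CondA η) (hB : G.CondB fb α τ γ Q η)
    {t : ℕ} (h1 : 1 ≤ t) (hT : t ≤ T) {πs : (s : S) → A s → ℝ} (hs : Feasible γs ν πs) (s : S) :
    (τ * bregman (reg.psi (α s)) (πs s) (πbar (t + 1) s) + G.scale fb (π t) s / η s *
        (bregman (reg.psi (α s)) (πs s) (πbar (t + 1) s) -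
          bregman (reg.psi (α s)) (πs s) (πbar t s))) +
      (∑ a, G.regCfValue reg α τ (π t) s a * (πs s a - π t s a)
          - τ * (reg.psi (α s) (πs s) - reg.psi (α s) (π t s))) ≤
      2 * Q * G.Cdiff fb reg α τ γ Q s * η s * fb.M₂ γ +
        τ * (G.Cslash fb reg α τ γ Q s * G.etaAnc η s *
          |reg.psi (α s) (π t s) - reg.psi (α s) (πbar (t + 1) s)|) := by
  have hf := H.feasible h1 hT
  have hfb := H.feasible_bar h1 (by omega)
  have hfb' := H.feasible_bar (t := t + 1) (by omega) (by omega)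
  have hm := H.scale_pos hf s
  have hη := H.eta_pos s
  have hQ := H.bound_nonneg
  have h3 := mul_le_mul_of_nonneg_left (prox_three_point reg (α s) (τ / G.scale fb (π t) s)
    (1 / η s) (convex_perturbedSimplex (γs s) (ν s)) (hfb' s) (hs s) (H.pos hfb' s) (H.pos hfb s)
    (H.run.step_bar_min t h1 hT s)) hm.le
  have h4 := mul_le_mul_of_nonneg_left (H.step_gain_le hA hB h1 hT s) hm.le
  have e1 : ∑ a, G.regCfValue reg α τ (π t) s a * (πs s a - π t s a) =
      G.scale fb (π t) s * (∑ a, G.feedback fb reg α τ (π t) s a * (πs s a - πbar (t + 1) s a) +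
        ∑ a, G.feedback fb reg α τ (π t) s a * (πbar (t + 1) s a - π t s a)) := by
    rw [← Finset.sum_add_distrib, Finset.mul_sum]
    refine Finset.sum_congr rfl fun a _ => ?_
    rw [← H.scale_mul_feedback hf s a]; ring
  have e2 : ∀ r, G.scale fb (π t) s * (τ / G.scale fb (π t) s * r) = τ * r := fun r => by
    field_simp
  have h5 : G.scale fb (π t) s * (2 * Q * G.Cdiff fb reg α τ γ Q s * η s) ≤
      2 * Q * G.Cdiff fb reg α τ γ Q s * η s * fb.M₂ γ := by
    rw [mul_comm]
    exact mul_le_mul_of_nonneg_left (H.scale_le_M₂ hf s)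
      (mul_nonneg (mul_nonneg (by positivity) (H.Cdiff_nonneg s)) hη.le)
  rw [e1]
  simp only [mul_add, mul_sub, add_mul, e2] at h3 h4 ⊢
  have e3 : ∀ r, G.scale fb (π t) s * (1 / η s * r) = G.scale fb (π t) s / η s * r := fun r => by
    ring
  simp only [e3] at h3 h4
  linarith

theorem M₂_nonneg : 0 ≤ fb.M₂ γ := by
  have := H.gamma_pos
  cases fb <;> simp only [Feedback.M₂] <;> positivity

/-- The general bound on the distances between the proximal centers and the equilibrium: the
local recursions, weighted by the reach probabilities of the equilibrium, are added up over the
infosets, where the regrets disappear, and over time. -/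
theorem sum_bregman_le (hA : G.CondA η) (hB : G.CondB fb α τ γ Q η)
    (hratio : ∀ s, 2 * G.Cminus fb reg α τ γ Q s * G.etaAnc η s ≤ τ * η s)
    {πs : (s : S) → A s → ℝ} (hs : G.IsRegNE reg α τ γs ν πs) :
    ∑ t ∈ Finset.Icc 2 T,
        bregman (G.dilatedRegTotal reg α) (G.seqForm πs) (G.seqForm (πbar t)) ≤
      2 * ∑ s, G.Cslash fb reg α τ γ Q s * G.etaAnc η s * G.ownReach πs s *
          ∑ t ∈ Finset.Icc 1 T,
            |reg.psi (α s) (π t s) - reg.psi (α s) (πbar (t + 1) s)|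
      + 4 / τ * ∑ s, G.Cdiff fb reg α τ γ Q s * G.ownReach πs s * Q * η s * fb.M₂ γ * T
      + 2 / τ * ∑ s, fb.M₂ γ / η s * G.ownReach πs s *
          bregman (reg.psi (α s)) (πs s) (πbar 1 s) := by
  have hτ := H.tau_pos
  have hspos := H.pos hs.1
  set D : S → ℕ → ℝ := fun s t => bregman (reg.psi (α s)) (πs s) (πbar t s) with hDdef
  have hw : ∀ s, 0 < G.ownReach πs s := G.ownReach_pos hspos
  have hlhs : ∑ t ∈ Finset.Icc 2 T,
      bregman (G.dilatedRegTotal reg α) (G.seqForm πs) (G.seqForm (πbar t)) =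
      ∑ s, G.ownReach πs s * ∑ t ∈ Finset.Icc 2 T, D s t := by
    simp only [Finset.mul_sum]
    rw [Finset.sum_comm]
    refine Finset.sum_congr rfl fun t ht => ?_
    rw [Finset.mem_Icc] at ht
    exact G.bregman_dilatedRegTotal reg α (H.pos (H.feasible_bar (by omega) (by omega))) hspos
  have hloc : ∀ s, G.ownReach πs s * (τ / 2 * ∑ t ∈ Finset.Icc 2 T, D s t
      - fb.M₂ γ / η s * D s 1) ≤ ∑ t ∈ Finset.Icc 1 T, G.ownReach πs s * (τ * D s (t + 1) +
        G.scale fb (π t) s / η s * (D s (t + 1) - D s t)) := by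
    intro s
    rw [← Finset.mul_sum]
    refine mul_le_mul_of_nonneg_left ?_ (hw s).le
    have := H.nonempty s
    refine sum_telescope_le (m := fun t => G.scale fb (π t) s) (H.eta_pos s) hτ H.M₂_nonneg ?_ ?_ ?_
    · intro t h1 hT
      have hf := H.feasible_bar h1 hT
      exact reg.bregman_nonneg (H.alpha_pos s) (hspos s) (H.pos hf s) (hs.1.sum_eq_one s)
        (hf.sum_eq_one s)
    · intro t h1 hT
      exact ⟨(H.scale_pos (H.feasible h1 hT) s).le, H.scale_le_M₂ (H.feasible h1 hT) s⟩
    · intro t h1 hT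
      have := (H.scale_stable hA hB h1 hT s).1
      linarith [hratio s]
  have hstep : ∀ t ∈ Finset.Icc 1 T, ∑ s, G.ownReach πs s * (τ * D s (t + 1) +
        G.scale fb (π t) s / η s * (D s (t + 1) - D s t)) ≤
      ∑ s, G.ownReach πs s * (2 * Q * G.Cdiff fb reg α τ γ Q s * η s * fb.M₂ γ +
        τ * (G.Cslash fb reg α τ γ Q s * G.etaAnc η s *
          |reg.psi (α s) (π t s) - reg.psi (α s) (πbar (t + 1) s)|)) := by
    intro t ht
    rw [Finset.mem_Icc] at ht
    have h1 := hs.regret_nonneg G (H.feasible ht.1 ht.2) H.gammas_pos H.nu_pos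
    have h2 := Finset.sum_le_sum fun s (_ : s ∈ univ) =>
      mul_le_mul_of_nonneg_left (H.local_recursion hA hB ht.1 ht.2 hs.1 s) (hw s).le
    simp only [mul_add (G.ownReach πs _), Finset.sum_add_distrib] at h2 ⊢
    linarith
  have h := (Finset.sum_le_sum fun s (_ : s ∈ univ) => hloc s).trans
    (Finset.sum_comm.trans_le (Finset.sum_le_sum hstep))
  have h' := mul_le_mul_of_nonneg_left h (by positivity : 0 ≤ 2 / τ)
  rw [hlhs]
  have e1 : 2 / τ * ∑ s, G.ownReach πs s * (τ / 2 * ∑ t ∈ Finset.Icc 2 T, D s t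
      - fb.M₂ γ / η s * D s 1) = ∑ s, G.ownReach πs s * ∑ t ∈ Finset.Icc 2 T, D s t -
      2 / τ * ∑ s, fb.M₂ γ / η s * G.ownReach πs s * D s 1 := by
    rw [Finset.mul_sum, Finset.mul_sum, ← Finset.sum_sub_distrib]
    refine Finset.sum_congr rfl fun s _ => ?_
    field_simp
  have e2 : 2 / τ * ∑ t ∈ Finset.Icc 1 T, ∑ s, G.ownReach πs s *
      (2 * Q * G.Cdiff fb reg α τ γ Q s * η s * fb.M₂ γ +
        τ * (G.Cslash fb reg α τ γ Q s * G.etaAnc η s *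
          |reg.psi (α s) (π t s) - reg.psi (α s) (πbar (t + 1) s)|)) =
      2 * ∑ s, G.Cslash fb reg α τ γ Q s * G.etaAnc η s * G.ownReach πs s *
          ∑ t ∈ Finset.Icc 1 T,
            |reg.psi (α s) (π t s) - reg.psi (α s) (πbar (t + 1) s)|
      + 4 / τ * ∑ s, G.Cdiff fb reg α τ γ Q s * G.ownReach πs s * Q * η s * fb.M₂ γ * T := by
    rw [Finset.sum_comm, Finset.mul_sum, Finset.mul_sum, Finset.mul_sum, ← Finset.sum_add_distrib]
    refine Finset.sum_congr rfl fun s _ => ?_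
    rw [← Finset.mul_sum, Finset.sum_add_distrib, Finset.sum_const, Nat.card_Icc, nsmul_eq_mul,
      ← Finset.mul_sum, ← Finset.mul_sum, Nat.add_sub_cancel]
    field_simp
    ring
  rw [e1, e2] at h'
  linarith

end Admissible

end EFG

/-! ### Polynomial dependence on the size of the game -/

namespace EFG

variable {S : Type u} {A : S → Type v} [Fintype S] [DecidableEq S] [∀ s, Fintype (A s)]
  [∀ s, DecidableEq (A s)]

theorem finite_feedback (G : EFG S A) (fb : Feedback) (reg : Reg) (α : S → ℝ) (τ : ℝ) (T : ℕ)
    (π : ℕ → (s : S) → A s → ℝ) :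
    {r | ∃ t ∈ Finset.Icc 1 T, ∃ s, ∃ a : A s,
      r = |G.feedback fb reg α τ (π t) s a|}.Finite := by
  refine (Set.finite_range (fun p : Finset.Icc 1 T × (Σ s, A s) =>
    |G.feedback fb reg α τ (π p.1) p.2.1 p.2.2|)).subset ?_
  rintro r ⟨t, ht, s, a, rfl⟩
  exact ⟨(⟨t, ht⟩, ⟨s, a⟩), rfl⟩

theorem abs_feedback_le_qNorm (G : EFG S A) (fb : Feedback) (reg : Reg) (α : S → ℝ) (τ : ℝ)
    {T : ℕ} (π : ℕ → (s : S) → A s → ℝ) {t : ℕ} (h1 : 1 ≤ t) (hT : t ≤ T) (s : S) (a : A s) :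
    |G.feedback fb reg α τ (π t) s a| ≤ G.qNorm fb reg α τ T π :=
  le_csSup (G.finite_feedback fb reg α τ T π).bddAbove
    ⟨t, Finset.mem_Icc.2 ⟨h1, hT⟩, s, a, rfl⟩

theorem qNorm_nonneg (G : EFG S A) (fb : Feedback) (reg : Reg) (α : S → ℝ) (τ : ℝ)
    (T : ℕ) (π : ℕ → (s : S) → A s → ℝ) : 0 ≤ G.qNorm fb reg α τ T π := by
  refine Real.sSup_nonneg ?_
  rintro r ⟨t, -, s, a, rfl⟩
  exact abs_nonneg _

theorem le_iSup_of_finite {ι : Type*} [Finite ι] (f : ι → ℝ) (i : ι) : f i ≤ ⨆ i, f i :=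
  le_ciSup (Set.finite_range f).bddAbove i

namespace Admissible

variable {G : EFG S A} {fb : Feedback} {reg : Reg} {α : S → ℝ} {τ : ℝ} {γs : S → ℝ}
    {ν : (s : S) → A s → ℝ} {γ : ℝ} {η : S → ℝ} {T : ℕ} {π πbar : ℕ → (s : S) → A s → ℝ}
    {Q : ℝ} (H : G.Admissible fb reg α τ γs ν γ η T π πbar Q)
include H

theorem one_le_card (s : S) : (1 : ℝ) ≤ Fintype.card (A s) := by
  have := H.nonempty s
  exact_mod_cast Fintype.card_pos

omit H in
theorem card_le_maxActions (s : S) : (Fintype.card (A s) : ℝ) ≤ G.maxActions :=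
  le_iSup_of_finite (fun s => (Fintype.card (A s) : ℝ)) s

omit H in
theorem card_le_maxNodes (s : S) : (Multiset.card (G.nodes s) : ℝ) ≤ G.maxNodes :=
  le_iSup_of_finite (fun s => (Multiset.card (G.nodes s) : ℝ)) s

omit H in
theorem one_le_maxNodes (s : S) : 1 ≤ G.maxNodes := by
  refine le_trans ?_ (card_le_maxNodes s)
  obtain ⟨h, hh⟩ := G.infoset_nonempty s
  exact_mod_cast Multiset.card_pos_iff_exists_mem.2 ⟨h, hh⟩

theorem alpha_mul_card_le (s : S) : α s * Fintype.card (A s) ≤ (⨆ s, α s) * G.maxActions :=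
  mul_le_mul (le_iSup_of_finite α s) (card_le_maxActions s) (Nat.cast_nonneg _)
    ((H.alpha_pos s).le.trans (le_iSup_of_finite α s))

theorem abs_futureReg_le {ρ : (s : S) → A s → ℝ} (hρ : Feasible γs ν ρ) (s : S) (a : A s) :
    |G.futureReg reg α ρ s a| ≤ Fintype.card S * ((⨆ s, α s) * G.maxActions) := by
  have hpos := H.pos hρ
  have hnn : ∀ s : S, 0 ≤ (⨆ s, α s) * G.maxActions := fun s =>
    (mul_nonneg (H.alpha_pos s).le (Nat.cast_nonneg _)).trans (H.alpha_mul_card_le s)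
  rw [futureReg, Finset.sum_filter]
  refine (Finset.abs_sum_le_sum_abs _ _).trans ?_
  refine (Finset.sum_le_card_nsmul _ _ ((⨆ s, α s) * G.maxActions) fun s' _ => ?_).trans_eq
    (by rw [nsmul_eq_mul, Finset.card_univ])
  split_ifs with h
  · have := H.nonempty s'
    have h1 := reg.psi_nonneg (H.alpha_pos s') (hpos s') (hρ.sum_eq_one s')
    have h2 := reg.psi_le (H.alpha_pos s') (hpos s') (hρ.sum_eq_one s')
    have h3 : G.ownReach ρ s' / G.seqForm ρ ⟨s, a⟩ ≤ 1 := by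
      rw [div_le_one (G.seqForm_pos hpos _)]
      obtain ⟨l₁, l₂, e⟩ := List.append_of_mem h
      have e1 := G.ownPath_ownSeq s' l₁ _ l₂ e
      rw [ownReach_eq, e, pathProd_append, pathProd_cons, ← mul_assoc, e1]
      exact mul_le_of_le_one_right (G.seqForm_pos hpos _).le
        (pathProd_le_one hρ.nonneg hρ.le_one _)
    have h4 : 0 ≤ G.ownReach ρ s' / G.seqForm ρ ⟨s, a⟩ :=
      div_nonneg (G.ownReach_pos hpos s').le (G.seqForm_pos hpos _).le
    rw [abs_of_nonneg (mul_nonneg h4 h1)]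
    exact (mul_le_of_le_one_left h1 h3).trans (h2.trans (H.alpha_mul_card_le s'))
  · simpa using hnn s

theorem abs_regCfValue_le {ρ : (s : S) → A s → ℝ} (hρ : Feasible γs ν ρ) (s : S) (a : A s) :
    |G.regCfValue reg α τ ρ s a| ≤
      1 + τ * Fintype.card S * (⨆ s, α s) * G.maxActions := by
  rw [regCfValue]
  refine (abs_sub _ _).trans (add_le_add (G.abs_cfValue_le_one hρ (H.pos hρ) s a) ?_)
  rw [abs_mul, abs_of_pos H.tau_pos, mul_assoc τ, mul_assoc τ, mul_assoc (Fintype.card S : ℝ)]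
  exact mul_le_mul_of_nonneg_left (H.abs_futureReg_le hρ s a) H.tau_pos.le

theorem sizeQ_nonneg (s : S) : 0 ≤ G.sizeQ fb α τ γ := by
  have h1 := H.tau_pos
  have h2 := (H.alpha_pos s).le.trans (le_iSup_of_finite α s)
  have h3 := (zero_le_one.trans (H.one_le_card s)).trans (card_le_maxActions (G := G) s)
  have h4 := H.M₁_pos s
  unfold sizeQ
  positivity

/-- The feedback is the counterfactual value divided by its scaling, which is at least `M₁`. -/
theorem abs_feedback_le_sizeQ {ρ : (s : S) → A s → ℝ}
    (hρ : Feasible γs ν ρ) (s : S) (a : A s) :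
    |G.feedback fb reg α τ ρ s a| ≤ G.sizeQ fb α τ γ := by
  have hm := H.scale_pos hρ s
  have e : G.feedback fb reg α τ ρ s a = G.regCfValue reg α τ ρ s a / G.scale fb ρ s := by
    rw [← H.scale_mul_feedback hρ, mul_div_cancel_left₀ _ hm.ne']
  rw [e, abs_div, abs_of_pos hm]
  have h1 := H.abs_regCfValue_le hρ s a
  exact div_le_div₀ ((abs_nonneg _).trans h1) h1 (H.M₁_pos s) (H.M₁_le_scale hρ s)

theorem iInf_alpha_pos [Nonempty S] : 0 < ⨅ s, α s := by
  obtain ⟨s, hs⟩ := exists_eq_ciInf_of_finite (f := α)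
  rw [← hs]; exact H.alpha_pos s

theorem iInf_eta_pos [Nonempty S] : 0 < ⨅ s, η s := by
  obtain ⟨s, hs⟩ := exists_eq_ciInf_of_finite (f := η)
  rw [← hs]; exact H.eta_pos s

theorem div_alpha_le [Nonempty S] (hQ : Q ≤ G.sizeQ fb α τ γ) (s : S) :
    Q / α s ≤ G.sizeQ fb α τ γ / ⨅ s, α s :=
  div_le_div₀ (H.sizeQ_nonneg s) hQ H.iInf_alpha_pos
    (ciInf_le (Set.finite_range α).bddBelow s)

theorem Cdiff_le_sizeC (hQ : Q ≤ G.sizeQ fb α τ γ) (s : S) :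
    G.Cdiff fb reg α τ γ Q s ≤ G.sizeC fb α τ γ := by
  have : Nonempty S := ⟨s⟩
  have hα := H.alpha_pos s
  have h1 := H.div_alpha_le hQ s
  have hQα : 0 ≤ Q / α s := div_nonneg H.bound_nonneg hα.le
  have hc := H.one_le_card s
  have hN := card_le_maxActions (G := G) s
  have hM := H.M₁_pos s
  have hτ := H.tau_pos
  have hl := H.log_nonneg s
  have hτM : 0 ≤ τ / G.M₁ fb γ := by positivity
  have e : G.sizeC fb α τ γ = 2 * (G.maxActions * (G.sizeQ fb α τ γ / ⨅ s, α s)) +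
      2 * (τ / G.M₁ fb γ * (Real.log (1 / γ) + G.maxActions)) := by
    unfold sizeC; ring
  rw [e]
  have h2 : (Fintype.card (A s) : ℝ) * (Q / α s) ≤
      G.maxActions * (G.sizeQ fb α τ γ / ⨅ s, α s) :=
    mul_le_mul hN h1 hQα (by linarith)
  have h2' : Q / α s ≤ Fintype.card (A s) * (Q / α s) := le_mul_of_one_le_left hQα hc
  cases reg with
  | entropy =>
    have e2 : G.Cdiff fb .entropy α τ γ Q s =
        2 * (Q / α s) + 2 * (τ / G.M₁ fb γ * Real.log (1 / γ)) := by
      simp only [Cdiff]; field_simp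
    rw [e2]
    have h3 : τ / G.M₁ fb γ * Real.log (1 / γ) ≤
        τ / G.M₁ fb γ * (Real.log (1 / γ) + G.maxActions) :=
      mul_le_mul_of_nonneg_left (by linarith) hτM
    linarith
  | euclidean =>
    have e2 : G.Cdiff fb .euclidean α τ γ Q s =
        Fintype.card (A s) * (Q / α s) + 2 * (τ / G.M₁ fb γ * √(Fintype.card (A s))) := by
      simp only [Cdiff]; ring
    rw [e2]
    have hs : √(Fintype.card (A s) : ℝ) ≤ Fintype.card (A s) := by
      rw [Real.sqrt_le_left (by linarith)]
      nlinarith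
    have h3 : τ / G.M₁ fb γ * √(Fintype.card (A s)) ≤
        τ / G.M₁ fb γ * (Real.log (1 / γ) + G.maxActions) :=
      mul_le_mul_of_nonneg_left (by linarith) hτM
    linarith

theorem Cent_le_sizeC (hQ : Q ≤ G.sizeQ fb α τ γ) [Nonempty S] :
    G.Cent fb α τ γ Q ≤ G.sizeC fb α τ γ := by
  refine ciSup_le fun s => ?_
  have hα := H.alpha_pos s
  have h1 := H.div_alpha_le hQ s
  have hQα : 0 ≤ Q / α s := div_nonneg H.bound_nonneg hα.le
  have hN := (H.one_le_card s).trans (card_le_maxActions (G := G) s)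
  have hM := H.M₁_pos s
  have hτ := H.tau_pos
  have hl := H.log_nonneg s
  have hτM : 0 ≤ τ / G.M₁ fb γ := by positivity
  have e : G.sizeC fb α τ γ = 2 * (G.maxActions * (G.sizeQ fb α τ γ / ⨅ s, α s)) +
      2 * (τ / G.M₁ fb γ * (Real.log (1 / γ) + G.maxActions)) := by
    unfold sizeC; ring
  rw [e, mul_div_assoc]
  have h2 : Q / α s ≤ G.maxActions * (G.sizeQ fb α τ γ / ⨅ s, α s) :=
    h1.trans (le_mul_of_one_le_left (hQα.trans h1) hN)
  have h3 : τ / G.M₁ fb γ * Real.log (1 / γ) ≤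
      τ / G.M₁ fb γ * (Real.log (1 / γ) + G.maxActions) :=
    mul_le_mul_of_nonneg_left (by linarith) hτM
  have h4 : 0 ≤ τ / G.M₁ fb γ * Real.log (1 / γ) := mul_nonneg hτM hl
  linarith

theorem sizeC_nonneg (hQ : Q ≤ G.sizeQ fb α τ γ) (s : S) : 0 ≤ G.sizeC fb α τ γ :=
  (H.Cdiff_nonneg s).trans (H.Cdiff_le_sizeC hQ s)

theorem Cminus_le (hfb : fb ≠ .trajectoryQ) (hQ : Q ≤ G.sizeQ fb α τ γ) (s : S) :
    G.Cminus fb reg α τ γ Q s ≤ 12 * G.maxNodes * G.sizeC fb α τ γ := by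
  have : Nonempty S := ⟨s⟩
  have hC := H.sizeC_nonneg hQ s
  have hL := one_le_maxNodes (G := G) s
  cases fb with
  | counterfactual => simp only [Cminus]; positivity
  | trajectoryQ => exact absurd rfl hfb
  | qValue =>
    cases reg with
    | entropy =>
      have h1 := H.Cent_le_sizeC hQ
      simp only [Cminus, Feedback.M₂]
      nlinarith
    | euclidean =>
      have h1 : (⨆ s', G.Cdiff .qValue .euclidean α τ γ Q s') ≤ G.sizeC .qValue α τ γ :=
        ciSup_le fun s => H.Cdiff_le_sizeC hQ s
      have h2 := mul_le_mul (card_le_maxNodes (G := G) s) h1 H.iSup_Cdiff_nonneg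
        (by linarith : 0 ≤ G.maxNodes)
      have h3 : 0 ≤ G.maxNodes * G.sizeC .qValue α τ γ := by positivity
      simp only [Cminus]
      linarith

theorem M₁_le_one (hfb : fb ≠ .trajectoryQ) (s : S) : G.M₁ fb γ ≤ 1 := by
  refine (H.M₁_le_scale H.run.init_feasible s).trans ((H.scale_le_M₂ H.run.init_feasible s).trans ?_)
  cases fb with
  | trajectoryQ => exact absurd rfl hfb
  | counterfactual => exact le_rfl
  | qValue => exact le_rfl

theorem Cslash_le (hfb : fb ≠ .trajectoryQ) (hQ : Q ≤ G.sizeQ fb α τ γ) (s : S) :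
    G.Cslash fb reg α τ γ Q s ≤ 12 * G.maxNodes * G.sizeC fb α τ γ / G.M₁ fb γ := by
  have h1 := H.Cminus_le hfb hQ s
  have hM := H.M₁_pos s
  have hM1 := H.M₁_le_one hfb s
  rw [le_div_iff₀ hM]
  refine le_trans ?_ h1
  cases fb with
  | counterfactual => simp [Cslash, Cminus]
  | trajectoryQ => exact absurd rfl hfb
  | qValue =>
    cases reg with
    | entropy =>
      have := H.Cent_nonneg
      simp only [Cslash, Cminus, Feedback.M₂, mul_one]
      exact mul_le_of_le_one_right (by positivity) hM1
    | euclidean =>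
      simp only [Cslash, Cminus]
      refine le_of_eq ?_
      field_simp

/-- The three sums of the general bound are polynomial in the size of the game. -/
theorem sum_bregman_le_poly [hS : Nonempty S] (hfb : fb ≠ .trajectoryQ) (hQ : Q ≤ G.sizeQ fb α τ γ)
    {πs : (s : S) → A s → ℝ} (hs : Feasible γs ν πs) :
    2 * ∑ s, G.Cslash fb reg α τ γ Q s * G.etaAnc η s * G.ownReach πs s *
          ∑ t ∈ Finset.Icc 1 T,
            |reg.psi (α s) (π t s) - reg.psi (α s) (πbar (t + 1) s)|
      + 4 / τ * ∑ s, G.Cdiff fb reg α τ γ Q s * G.ownReach πs s * Q * η s * fb.M₂ γ * T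
      + 2 / τ * ∑ s, fb.M₂ γ / η s * G.ownReach πs s *
          bregman (reg.psi (α s)) (πs s) (πbar 1 s) ≤
    24 * Fintype.card S * G.maxNodes * G.sizeC fb α τ γ * (⨆ s, α s) * G.maxActions
            / G.M₁ fb γ * ((⨆ s, G.etaAnc η s) * T)
        + 4 * Fintype.card S * G.sizeC fb α τ γ * G.sizeQ fb α τ γ * ((⨆ s, η s) * T / τ)
        + 2 * Fintype.card S * (⨆ s, α s) * G.maxActions * (1 / (τ * ⨅ s, η s)) := by
  have hτ := H.tau_pos
  have hM₂ : fb.M₂ γ = 1 := by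
    cases fb with
    | trajectoryQ => exact absurd rfl hfb
    | counterfactual => rfl
    | qValue => rfl
  have hw0 : ∀ s, 0 ≤ G.ownReach πs s := fun s => (G.ownReach_pos (H.pos hs) s).le
  have hw1 : ∀ s, G.ownReach πs s ≤ 1 := fun s => pathProd_le_one hs.nonneg hs.le_one _
  have hαN : 0 ≤ (⨆ s, α s) * G.maxActions := by
    obtain ⟨s⟩ := hS
    exact (mul_nonneg (H.alpha_pos s).le (Nat.cast_nonneg _)).trans (H.alpha_mul_card_le s)
  have hT : (0 : ℝ) ≤ T := Nat.cast_nonneg T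
  have hsum : ∀ (f : S → ℝ) (c : ℝ), (∀ s, f s ≤ c) → ∑ s, f s ≤ Fintype.card S * c := by
    intro f c hf
    refine (Finset.sum_le_card_nsmul univ f c fun s _ => hf s).trans_eq ?_
    rw [nsmul_eq_mul, Finset.card_univ]
  have b1 : ∀ s, G.Cslash fb reg α τ γ Q s * G.etaAnc η s * G.ownReach πs s *
      ∑ t ∈ Finset.Icc 1 T, |reg.psi (α s) (π t s) - reg.psi (α s) (πbar (t + 1) s)| ≤
      12 * G.maxNodes * G.sizeC fb α τ γ / G.M₁ fb γ * (⨆ s, G.etaAnc η s) * 1 *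
        (T * ((⨆ s, α s) * G.maxActions)) := by
    intro s
    have := H.nonempty s
    have hE := H.etaAnc_nonneg s
    have hE' := le_iSup_of_finite (G.etaAnc η) s
    have hC0 := H.Cslash_nonneg s
    have hC := H.Cslash_le hfb hQ s
    refine mul_le_mul (mul_le_mul (mul_le_mul hC hE' hE (hC0.trans hC)) (hw1 s) (hw0 s)
      (mul_nonneg (hC0.trans hC) (hE.trans hE'))) ?_ (Finset.sum_nonneg fun _ _ => abs_nonneg _)
      (mul_nonneg (mul_nonneg (hC0.trans hC) (hE.trans hE')) zero_le_one)
    refine (Finset.sum_le_card_nsmul _ _ ((⨆ s, α s) * G.maxActions) fun t ht => ?_).trans_eq ?_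
    · rw [Finset.mem_Icc] at ht
      have hf := H.feasible ht.1 ht.2
      have hf' := H.feasible_bar (t := t + 1) (by omega) (by omega)
      exact (reg.abs_psi_sub_le (H.alpha_pos s) (H.pos hf s) (hf.sum_eq_one s) (H.pos hf' s)
        (hf'.sum_eq_one s)).trans (H.alpha_mul_card_le s)
    · rw [Nat.card_Icc, nsmul_eq_mul, Nat.add_sub_cancel]
  have b2 : ∀ s, G.Cdiff fb reg α τ γ Q s * G.ownReach πs s * Q * η s * fb.M₂ γ * T ≤
      G.sizeC fb α τ γ * 1 * G.sizeQ fb α τ γ * (⨆ s, η s) * 1 * T := by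
    intro s
    have hC0 := H.Cdiff_nonneg s
    have hC := H.Cdiff_le_sizeC hQ s
    have hB := H.sizeQ_nonneg s
    have hη := (H.eta_pos s).le
    have hη' := le_iSup_of_finite η s
    have hQ0 := H.bound_nonneg
    have hK := hC0.trans hC
    have hη0 := hη.trans hη'
    rw [hM₂]
    have := hw0 s
    have := hw1 s
    gcongr
  have b3 : ∀ s, fb.M₂ γ / η s * G.ownReach πs s * bregman (reg.psi (α s)) (πs s) (πbar 1 s) ≤
      1 / (⨅ s, η s) * 1 * ((⨆ s, α s) * G.maxActions) := by
    intro s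
    have := H.nonempty s
    have e : πbar 1 s = fun _ => 1 / (Fintype.card (A s) : ℝ) := funext (H.run.init_bar s)
    have hf := H.feasible_bar le_rfl (by omega)
    have hD0 := reg.bregman_nonneg (H.alpha_pos s) (H.pos hs s) (H.pos hf s) (hs.sum_eq_one s)
      (hf.sum_eq_one s)
    have hD : bregman (reg.psi (α s)) (πs s) (πbar 1 s) ≤ (⨆ s, α s) * G.maxActions := by
      rw [e]
      exact (reg.bregman_uniform_le (H.alpha_pos s) (H.pos hs s) (hs.sum_eq_one s)).trans
        (H.alpha_mul_card_le s)
    have hi := H.iInf_eta_pos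
    have hi' : (⨅ s, η s) ≤ η s := ciInf_le (Set.finite_range η).bddBelow s
    have := hw0 s
    have := hw1 s
    rw [hM₂]
    gcongr
  have c1 := mul_le_mul_of_nonneg_left (hsum _ _ b1) (by norm_num : (0 : ℝ) ≤ 2)
  have c2 := mul_le_mul_of_nonneg_left (hsum _ _ b2) (by positivity : 0 ≤ 4 / τ)
  have c3 := mul_le_mul_of_nonneg_left (hsum _ _ b3) (by positivity : 0 ≤ 2 / τ)
  refine (add_le_add (add_le_add c1 c2) c3).trans_eq ?_
  ring

end Admissible

end EFG

end LazyQFR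

open LazyQFR in
theorem mainTheorem3 {S : Type*} {A : S → Type*} [Fintype S] [DecidableEq S]
    [∀ s, Fintype (A s)] [∀ s, DecidableEq (A s)] (G : EFG S A)
    (fb : Feedback) (reg : Reg) (α : S → ℝ) (hα : ∀ s, 0 < α s) (τ : ℝ) (hτ : 0 < τ)
    -- exploration: `γ_s`, `ν_s`, and a lower bound `γ` of all reach probabilities
    (γs : S → ℝ) (hγs : ∀ s, 0 < γs s ∧ γs s ≤ 1)
    (ν : (s : S) → A s → ℝ) (hν : ∀ s, ν s ∈ stdSimplex ℝ (A s)) (hνpos : ∀ s a, 0 < ν s a)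
    (γ : ℝ) (hγ : 0 < γ)
    (hγle : ∀ π, EFG.Feasible γs ν π → ∀ x : Σ s, A s, γ ≤ G.seqForm π x)
    -- learning rates, and the iterates
    (η : S → ℝ) (hη : ∀ s, 0 < η s) (T : ℕ) (π πbar : ℕ → (s : S) → A s → ℝ)
    (hrun : G.IsLazyQFR fb reg α τ γs ν η T π πbar)
    (Q : ℝ) (hQ : Q = G.qNorm fb reg α τ T π)
    -- `η_s^anc / η_s ≤ τ / (2 C_s^-)`, which is void if `C_s^- = 0`
    (hratio : ∀ s, 2 * G.Cminus fb reg α τ γ Q s * G.etaAnc η s ≤ τ * η s)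
    (hA : G.CondA η) (hB : G.CondB fb α τ γ Q η) (hC : G.CondC fb α τ γ Q η)
    -- the equilibrium of the regularized and perturbed game
    (πstar : (s : S) → A s → ℝ) (hstar : G.IsRegNE reg α τ γs ν πstar) :
    (∑ t ∈ Finset.Icc 2 T,
        bregman (G.dilatedRegTotal reg α) (G.seqForm πstar) (G.seqForm (πbar t)) ≤
      2 * ∑ s, G.Cslash fb reg α τ γ Q s * G.etaAnc η s * G.ownReach πstar s *
          ∑ t ∈ Finset.Icc 1 T,
            |reg.psi (α s) (π t s) - reg.psi (α s) (πbar (t + 1) s)|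
      + 4 / τ * ∑ s, G.Cdiff fb reg α τ γ Q s * G.ownReach πstar s * Q * η s * fb.M₂ γ * T
      + 2 / τ * ∑ s, fb.M₂ γ / η s * G.ownReach πstar s *
          bregman (reg.psi (α s)) (πstar s) (πbar 1 s)) ∧
    -- polynomial dependence on the size of the game
    (fb ≠ Feedback.trajectoryQ →
      (∀ s, G.Cminus fb reg α τ γ Q s ≤ 12 * G.maxNodes * G.sizeC fb α τ γ) ∧
      ∑ t ∈ Finset.Icc 2 T,
          bregman (G.dilatedRegTotal reg α) (G.seqForm πstar) (G.seqForm (πbar t)) ≤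
        24 * Fintype.card S * G.maxNodes * G.sizeC fb α τ γ * (⨆ s, α s) * G.maxActions
            / G.M₁ fb γ * ((⨆ s, G.etaAnc η s) * T)
        + 4 * Fintype.card S * G.sizeC fb α τ γ * G.sizeQ fb α τ γ * ((⨆ s, η s) * T / τ)
        + 2 * Fintype.card S * (⨆ s, α s) * G.maxActions * (1 / (τ * ⨅ s, η s))) := by
  have H : G.Admissible fb reg α τ γs ν γ η T π πbar Q :=
    { alpha_pos := hα
      tau_pos := hτ
      gammas_pos := fun s => (hγs s).1
      nu_pos := hνpos
      gamma_pos := hγ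
      gamma_le := hγle
      eta_pos := hη
      run := hrun
      bound_nonneg := hQ ▸ G.qNorm_nonneg fb reg α τ T π
      feedback_le := fun t h1 hT s a => hQ ▸ G.abs_feedback_le_qNorm fb reg α τ π h1 hT s a }
  have hmain := H.sum_bregman_le hA hB hratio hstar
  refine ⟨hmain, fun hfb => ?_⟩
  rcases isEmpty_or_nonempty S with hS | hS
  · exact ⟨fun s => isEmptyElim s, hmain.trans (by simp)⟩
  have hQle : Q ≤ G.sizeQ fb α τ γ := by
    rw [hQ]
    refine Real.sSup_le ?_ (H.sizeQ_nonneg hS.some)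
    rintro r ⟨t, ht, s, a, rfl⟩
    rw [Finset.mem_Icc] at ht
    exact H.abs_feedback_le_sizeQ (H.feasible ht.1 ht.2) s a
  exact ⟨fun s => H.Cminus_le hfb hQle s, hmain.trans (H.sum_bregman_le_poly hfb hQle hstar.1)⟩
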